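/- Fix $q\in(0,1)$. All processes below start from the empty configuration, and "converges" means weak convergence of all finite-dimensional distributions. $\mathrm{Conf}(S)$ is the set of finite particle configurations (multisets) in $S$, where $\mathrm{Conf}(S)=\bigsqcup_k S^k/S_k$ has its natural topology; $\eta(x)$ is the number of particles at $x$. **Vertex model.** Let $u>0$, $\xi_0>0$, $\upxi_i>0$, $\mathsf s_i\in(-1,0)$ ($i\ge1$) with $\sup_i(-\upxi_i\mathsf s_i)<\infty$ (for example, $\upxi_i$ and $\mathsf s_i$ uniformly bounded away from the endpoints of their intervals). The stochastic higher spin six vertex model with step Bernoulli boundary condition is the discrete time Markov chain $\mathbf X_{\mathrm v}(\mathfrak t)$, $\mathfrak t=0,1,\dots$, on $\mathrm{Conf}(\mathbb Z_{\ge1})$ with the update $\eta'(i)=\eta(i)-h(i)+h(i-1)$, where $h(i)\in\{0,1\}$ are sampled from left to right with $$\mathbb P(h(0)=1)=\frac{\xi_0u}{1+\xi_0u},\quad \mathbb P(h(i)=1\mid h(i-1)=0)=\frac{-\upxi_i\mathsf s_iu(1-q^{\eta(i)})}{1-\upxi_i\mathsf s_iu},\quad \mathbb P(h(i)=1\mid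 h(i-1)=1)=\frac{\mathsf s_i^2q^{\eta(i)}-\upxi_i\mathsf s_iu}{1-\upxi_i\mathsf s_iu}.$$ **Half-continuous model.** $\mathbf X_{\mathrm{hc}}(t)$, $t\ge0$, is the pure jump Markov process on $\mathrm{Conf}(\mathbb Z_{\ge1})$ in which a particle leaves an infinite stack at $0$ at rate $\xi_0$, and a particle leaves a location $i\ge1$ at rate $-\upxi_i\mathsf s_i(1-q^{\eta(i)})$. A particle which leaves $i\ge0$ jumps instantaneously to $j>i$ with probability $(1-\mathsf s_j^2q^{\eta(j)})\prod_{i<k<j}\mathsf s_k^2q^{\eta(k)}$, with $\eta$ the configuration before the jump. (In both models a particle that never stops is removed; this has probability zero if the $\mathsf s_i$ are bounded away from $-1$.) **Exponential model.** Let $\uplambda>0$; let $\boldsymbol\upxi$ be a function on $\mathbb R_{\ge0}$ which is bounded away from $0$ and $+\infty$, continuous outside a locally finite set, and has left and right limits; let $\mathbf B\subset\mathbb R_{>0}$ have no accumulation points in $\mathbb R_{\ge0}$, and let $\mathbf p:\mathbf B\to(0,1)$. The inhomogeneous exponential jump model $\mathbf X(t)$, $t\ge0$, is the pure jump Markov process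 on $\mathrm{Conf}(\mathbb R_{>0})$ in which a particle leaves an infinite stack at $0$ at rate $\boldsymbol\upxi(0)$, and a particle leaves an occupied location $x>0$ at rate $\boldsymbol\upxi(x)(1-q^{\eta(x)})$. A particle which leaves $x\ge0$ jumps instantaneously to the right by a distance which is $\ge y$ (for $y>0$) with probability $$e^{-\uplambda y}\,q^{\#\{\text{particles in }(x,x+y)\}}\prod_{b\in\mathbf B,\ x<b<x+y}\mathbf p(b),$$ computed from the configuration before the jump. **Scaling.** For $\varepsilon>0$ let $\mathbf B^\varepsilon=\{\lfloor\varepsilon^{-1}b\rfloor:b\in\mathbf B\}\cap\mathbb Z_{\ge1}$, let $\xi_0=\boldsymbol\upxi(0)$, and let $\upxi_i>0$, $\mathsf s_i\in(-1,0)$ be given by $\mathsf s_i^2=e^{-\varepsilon\uplambda}$, $-\upxi_i\mathsf s_i=\boldsymbol\upxi(i\varepsilon)$ for $i\notin\mathbf B^\varepsilon$, and by $\mathsf s_i^2=\mathbf p(b)$, $-\upxi_i\mathsf s_i=\boldsymbol\upxi(b)$ for $i=\lfloor\varepsilon^{-1}b\rfloor\in\mathbf B^\varepsilon$, $b\in\mathbf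 B$ (if several $b$ give the same $i$, any one of them is used). Denote the models with these parameters by $\mathbf X^{\varepsilon}_{\mathrm v}$ and $\mathbf X^{\varepsilon}_{\mathrm{hc}}$, and let $\varepsilon\cdot$ denote the map of configurations which moves every particle from $i$ to $i\varepsilon$. **Proposition.** 1. For fixed $\xi_0,\upxi_i,\mathsf s_i$ as above, $\{\mathbf X_{\mathrm v}(\lfloor tu^{-1}\rfloor)\}_{t\ge0}$ converges to $\{\mathbf X_{\mathrm{hc}}(t)\}_{t\ge0}$ as $u\searrow0$. 2. $\{\varepsilon\cdot\mathbf X^{\varepsilon}_{\mathrm{hc}}(t)\}_{t\ge0}$ converges to $\{\mathbf X(t)\}_{t\ge0}$ as $\varepsilon\searrow0$. 3. Consequently $\varepsilon\cdot\mathbf X^{\varepsilon}_{\mathrm v}(\lfloor tu^{-1}\rfloor)$ converges to $\mathbf X(t)$ as first $u\searrow0$ and then $\varepsilon\searrow0$: for all $0\le t_1\le\dots\le t_k$ and every bounded continuous $f\ge0$ on $\mathrm{Conf}(\mathbb R_{>0})^k$, $$\lim_{\varepsilon\searrow0}\lim_{u\searrow0}\mathbb E f\bigl(\varepsilon\cdot\mathbf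 X^{\varepsilon}_{\mathrm v}(\lfloor t_1u^{-1}\rfloor),\dots,\varepsilon\cdot\mathbf X^{\varepsilon}_{\mathrm v}(\lfloor t_ku^{-1}\rfloor)\bigr)=\mathbb E f\bigl(\mathbf X(t_1),\dots,\mathbf X(t_k)\bigr).$$ -/

import Mathlib

open Filter Topology MeasureTheory Set
open scoped NNReal ENNReal BoundedContinuousFunction

noncomputable section

/-! ### Configuration spaces -/

/-- The half-line `ℝ_{>0}`. It is also the range of the small parameters `u` and `ε`. -/
abbrev PosReal : Type := {x : ℝ // 0 < x}

/-- The filter `x ↘ 0` on `ℝ_{>0}`. -/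
def downToZero : Filter PosReal := comap Subtype.val (𝓝 (0 : ℝ))

/-- The locations `1, 2, 3, …` form a discrete space. -/
instance instTopPNat : TopologicalSpace ℕ+ := ⊥

/-- The space of finite particle configurations in `α`: a configuration `x₁ ≥ x₂ ≥ … ≥ x_k` is
the multiset of the locations of its particles, several of which may coincide. The number of
particles at the location `x` is `η.count x`. -/
abbrev Conf (α : Type*) : Type _ := Multiset α

/-- The natural topology of `Conf α = ⊔_k α^k / S_k`: the quotient topology for the map which
forgets the order of the particles. -/
instance instTopConf (α : Type*) [TopologicalSpace α] : TopologicalSpace (Conf α) :=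
  TopologicalSpace.coinduced (fun l : List α => (l : Multiset α)) inferInstance

/-- The Borel `σ`-algebra. -/
instance instMeasConf (α : Type*) [TopologicalSpace α] : MeasurableSpace (Conf α) :=
  borel _

/-- The rescaling `i ↦ i ε` of space from `ℤ_{≥1}` to `ℝ_{>0}`. -/
def scaleSite (ε : PosReal) (i : ℕ+) : PosReal :=
  ⟨(i : ℝ) * (ε : ℝ), mul_pos (by exact_mod_cast i.pos) ε.2⟩

/-! ### Markov processes and convergence of finite-dimensional distributions -/

/-- A family of transition operators: `P t f x` is the expectation of `f` of the state at time `t`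
when the state at time `0` is `x`. -/
abbrev TransitionOp (T E : Type*) : Type _ := T → (E → ℝ≥0∞) → E → ℝ≥0∞

/-- Expectation of `f (X (t 0), …, X (t (k-1)))` for a time-homogeneous Markov process with
transition operators `P` which is in the state `x` at time `s ≤ t 0 ≤ … ≤ t (k-1)`. -/
def fddExpectation {T E : Type*} [Sub T] (P : TransitionOp T E) :
    (k : ℕ) → T → (Fin k → T) → ((Fin k → E) → ℝ≥0∞) → E → ℝ≥0∞
  | 0, _, _, f, _ => f Fin.elim0
  | k + 1, s, t, f, x =>
      P (t 0 - s)
        (fun y => fddExpectation P k (t 0) (Fin.tail t) (fun z => f (Fin.cons y z)) y) x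

/-- `X`, defined on the probability space `(Ω, μ)`, is a Markov process with transition operators
`P` started from `x₀` at time `0`: its finite-dimensional distributions are those determined by
`P` and `x₀`. -/
structure IsMarkovProcess {T E Ω : Type*} [Sub T] [Zero T] [Preorder T]
    [TopologicalSpace E] [MeasurableSpace E] [MeasurableSpace Ω]
    (P : TransitionOp T E) (x₀ : E) (X : T → Ω → E) (μ : Measure Ω) : Prop where
  isProbabilityMeasure : IsProbabilityMeasure μ
  measurable : ∀ t, Measurable (X t)
  fdd : ∀ (k : ℕ) (t : Fin k → T), Monotone t → (∀ i, 0 ≤ t i) → ∀ f : (Fin k → E) →ᵇ ℝ≥0,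
    ∫⁻ ω, (f (fun i => X (t i) ω) : ℝ≥0∞) ∂μ
      = fddExpectation P k 0 t (fun z => (f z : ℝ≥0∞)) x₀

/-- Convergence of the processes `X n`, on the spaces `(Ω n, μ n)`, to the process `Y` in the sense
of finite-dimensional distributions, along the filter `l`: for all times `t₁ ≤ … ≤ t_k` the joint
law of `(X n t₁, …, X n t_k)` converges weakly to the joint law of `(Y t₁, …, Y t_k)`. -/
def ConvergesFDD {ι E Ω' : Type*} {Ω : ι → Type*} [TopologicalSpace E]
    [∀ n, MeasurableSpace (Ω n)] [MeasurableSpace Ω']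
    (X : ∀ n, ℝ≥0 → Ω n → E) (μ : ∀ n, Measure (Ω n)) (l : Filter ι)
    (Y : ℝ≥0 → Ω' → E) (ν : Measure Ω') : Prop :=
  ∀ (k : ℕ) (t : Fin k → ℝ≥0), Monotone t → ∀ f : (Fin k → E) →ᵇ ℝ≥0,
    Tendsto (fun n => ∫⁻ ω, (f (fun i => X n (t i) ω) : ℝ≥0∞) ∂(μ n)) l
      (𝓝 (∫⁻ ω, (f (fun i => Y (t i) ω) : ℝ≥0∞) ∂ν))

/-- Jump intensities of a continuous time pure jump process: `A f x = ∫ f(y) Q(x, dy)`, where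
`Q(x, dy)` is the rate of jumping from `x` into `dy`. -/
abbrev JumpIntensity (E : Type*) : Type _ := (E → ℝ≥0∞) → E → ℝ≥0∞

/-- The expectation of `f` of the state at time `t` on the event that at most `n - 1` jumps occur
up to time `t`, for the pure jump Markov process with intensities `A`: from the state `x` the first
jump occurs after an exponential waiting time with rate `R x = A 1 x`, and then the new state has
the distribution `Q(x, dy) / R x`. -/
def jumpOpUpTo {E : Type*} (A : JumpIntensity E) : ℕ → ℝ → (E → ℝ≥0∞) → E → ℝ≥0∞
  | 0, _, _, _ => 0
  | n + 1, t, f, x =>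
      ENNReal.ofReal (Real.exp (-(A 1 x).toReal * t)) * f x
        + ∫⁻ s in Ioc (0 : ℝ) t, ENNReal.ofReal (Real.exp (-(A 1 x).toReal * s))
            * A (jumpOpUpTo A n (t - s) f) x

/-- The transition operators of the pure jump Markov process with intensities `A`. -/
def jumpTransition {E : Type*} (A : JumpIntensity E) : TransitionOp ℝ≥0 E :=
  fun t f x => ⨆ n, jumpOpUpTo A n t f x

/-! ### Stochastic higher spin six vertex model with step Bernoulli boundary condition -/

/-- `P(h(0) = 1)`. -/
def entranceProb (u ξ₀ : ℝ) : ℝ := ξ₀ * u / (1 + ξ₀ * u)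

/-- `P(h(i) = 1 ∣ h(i-1) = h)`, where `m = η(i)` and `ξ`, `s` are the parameters at `i`. -/
def vertexProb (q u ξ s : ℝ) (m h : ℕ) : ℝ :=
  if h = 0 then (-ξ * s * u * (1 - q ^ m)) / (1 - ξ * s * u)
  else (s ^ 2 * q ^ m - ξ * s * u) / (1 - ξ * s * u)

/-- The numbers `h(0), h(1), h(2), …` of particles moving from `i` to `i + 1` in one time step,
sampled from left to right with the help of independent uniform random variables `U 0, U 1, …`. -/
def horizontalFlow (q u ξ₀ : ℝ) (ξ s : ℕ+ → ℝ) (η : Conf ℕ+) (U : ℕ → unitInterval) : ℕ → ℕ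
  | 0 => if (U 0 : ℝ) < entranceProb u ξ₀ then 1 else 0
  | n + 1 =>
      if (U (n + 1) : ℝ) < vertexProb q u (ξ n.succPNat) (s n.succPNat) (η.count n.succPNat)
          (horizontalFlow q u ξ₀ ξ s η U n)
      then 1 else 0

/-- The probability of the update `η ↦ η'` in one time step, `η'(i) = η(i) - h(i) + h(i-1)`. -/
def vertexTransProb (q u ξ₀ : ℝ) (ξ s : ℕ+ → ℝ) (η η' : Conf ℕ+) : ℝ≥0∞ :=
  Measure.infinitePi (fun _ : ℕ => (volume : Measure unitInterval))
    {U | ∀ n : ℕ, η'.count n.succPNat + horizontalFlow q u ξ₀ ξ s η U (n + 1)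
      = η.count n.succPNat + horizontalFlow q u ξ₀ ξ s η U n}

/-- One step of the vertex model. -/
def vertexStep (q u ξ₀ : ℝ) (ξ s : ℕ+ → ℝ) (f : Conf ℕ+ → ℝ≥0∞) (η : Conf ℕ+) : ℝ≥0∞ :=
  ∑' η' : Conf ℕ+, vertexTransProb q u ξ₀ ξ s η η' * f η'

/-- `X` is the stochastic higher spin six vertex model, started from the empty configuration. -/
def IsVertexModel {Ω : Type*} [MeasurableSpace Ω] (q u ξ₀ : ℝ) (ξ s : ℕ+ → ℝ)
    (X : ℕ → Ω → Conf ℕ+) (μ : Measure Ω) : Prop :=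
  IsMarkovProcess (fun (n : ℕ) f => (vertexStep q u ξ₀ ξ s)^[n] f) 0 X μ

/-- Admissible inhomogeneity parameters `ξ_i > 0`, `s_i ∈ (-1, 0)`. This holds as soon as the `ξ_i`
and the `s_i` are uniformly bounded away from the endpoints of these intervals. -/
structure AdmissibleVertexParameters (ξ s : ℕ+ → ℝ) : Prop where
  pos : ∀ i, 0 < ξ i
  spin : ∀ i, s i ∈ Ioo (-1 : ℝ) 0
  bounded : ∃ C : ℝ, ∀ i, -ξ i * s i ≤ C

/-! ### Half-continuous vertex model -/

/-- The probability that a moving particle started at `i` flies past the locations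
`i+1, …, j-1`. -/
def flyPastProb (q : ℝ) (s : ℕ+ → ℝ) (η : Conf ℕ+) (i : ℕ) (j : ℕ+) : ℝ :=
  ∏ k ∈ (Finset.Ico 1 j).filter (fun k : ℕ+ => i < (k : ℕ)), s k ^ 2 * q ^ η.count k

/-- Expectation of `f` of the new configuration, after a particle which started at the location `i`
(`i = 0` is the infinite stack) has jumped. The jump probabilities are computed from the
configuration `η` before the jump, and `rest` consists of the particles which do not move.
The second term accounts for a particle which never stops and thus leaves the system; its
probability is zero if the `s_k` are bounded away from `-1`. -/
def hcJump (q : ℝ) (s : ℕ+ → ℝ) (f : Conf ℕ+ → ℝ≥0∞) (η rest : Conf ℕ+) (i : ℕ) : ℝ≥0∞ :=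
  (∑' j : ℕ+, if i < (j : ℕ) then
      ENNReal.ofReal (flyPastProb q s η i j * (1 - s j ^ 2 * q ^ η.count j)) * f (j ::ₘ rest)
    else 0)
    + (⨅ j : ℕ+, ENNReal.ofReal (flyPastProb q s η i j)) * f rest

/-- The jump intensities of the half-continuous vertex model. -/
def hcIntensity (q ξ₀ : ℝ) (ξ s : ℕ+ → ℝ) : JumpIntensity (Conf ℕ+) := fun f η =>
  ENNReal.ofReal ξ₀ * hcJump q s f η η 0
    + ∑ i ∈ η.toFinset,
        ENNReal.ofReal (ξ i * (-s i) * (1 - q ^ η.count i)) * hcJump q s f η (η.erase i) i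

/-- `X` is the half-continuous vertex model, started from the empty configuration. -/
def IsHalfContinuousModel {Ω : Type*} [MeasurableSpace Ω] (q ξ₀ : ℝ) (ξ s : ℕ+ → ℝ)
    (X : ℝ≥0 → Ω → Conf ℕ+) (μ : Measure Ω) : Prop :=
  IsMarkovProcess (jumpTransition (hcIntensity q ξ₀ ξ s)) 0 X μ

/-! ### Inhomogeneous exponential jump model -/

/-- The data of the exponential jump model, apart from `q`: the jumping distance parameter `lam`,
the speed function `ξ` on `[0, ∞)` and the roadblocks `B` with the probabilities `p`. -/
structure IsExpModelData (lam : ℝ) (ξ : ℝ → ℝ) (B : Set ℝ) (p : ℝ → ℝ) : Prop where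
  lam_pos : 0 < lam
  /-- The speed function is bounded away from `0` and `+∞`. -/
  speed_bounds : ∃ c C : ℝ, 0 < c ∧ ∀ x, 0 ≤ x → c ≤ ξ x ∧ ξ x ≤ C
  /-- It is continuous outside a locally finite set. -/
  speed_piecewise : ∃ D : Set ℝ, (∀ x, 0 ≤ x → ¬ AccPt x (𝓟 D)) ∧
    ∀ x, 0 ≤ x → x ∉ D → ContinuousWithinAt ξ (Ici 0) x
  speed_left : ∀ x, 0 < x → ∃ y, Tendsto ξ (𝓝[<] x) (𝓝 y)
  speed_right : ∀ x, 0 ≤ x → ∃ y, Tendsto ξ (𝓝[>] x) (𝓝 y)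
  roadblock_pos : ∀ b ∈ B, 0 < b
  roadblock_discrete : ∀ x, 0 ≤ x → ¬ AccPt x (𝓟 B)
  roadblock_prob : ∀ b ∈ B, p b ∈ Ioo (0 : ℝ) 1

/-- The probability that a moving particle which started at `x ≥ 0` travels a distance `≥ y`, where
`y > 0` and `η` is the configuration before the jump. The exponent of `q` is the number
`𝔥(x+) - 𝔥(x+y)` of particles strictly between `x` and `x + y`. -/
def travelProb (q lam : ℝ) (B : Set ℝ) (p : ℝ → ℝ) (η : Conf PosReal) (x y : ℝ) : ℝ :=
  Real.exp (-lam * y) * q ^ η.countP (fun z => x < (z : ℝ) ∧ (z : ℝ) < x + y)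
    * ∏ᶠ b ∈ B ∩ Ioo x (x + y), p b

/-- The traveled distance as a function of a uniform random variable `v`: it is `≥ y` if and only
if `v ≤ travelProb … y`. -/
def travelDistance (q lam : ℝ) (B : Set ℝ) (p : ℝ → ℝ) (η : Conf PosReal) (x : ℝ)
    (v : unitInterval) : ℝ :=
  sSup {y : ℝ | 0 < y ∧ (v : ℝ) ≤ travelProb q lam B p η x y}

/-- The law, on `ℝ_{>0}`, of the final location of a moving particle which started at `x ≥ 0`. -/
def landingLaw (q lam : ℝ) (B : Set ℝ) (p : ℝ → ℝ) (η : Conf PosReal) (x : ℝ) :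
    Measure PosReal :=
  ((volume : Measure unitInterval).map
    (fun v => x + travelDistance q lam B p η x v)).comap Subtype.val

/-- The jump intensities of the inhomogeneous exponential jump model. -/
def expIntensity (q lam : ℝ) (ξ : ℝ → ℝ) (B : Set ℝ) (p : ℝ → ℝ) :
    JumpIntensity (Conf PosReal) := fun f η =>
  ENNReal.ofReal (ξ 0) * ∫⁻ z, f (z ::ₘ η) ∂(landingLaw q lam B p η 0)
    + ∑ x ∈ η.toFinset, ENNReal.ofReal (ξ x * (1 - q ^ η.count x))
        * ∫⁻ z, f (z ::ₘ η.erase x) ∂(landingLaw q lam B p η x)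

/-- `X` is the inhomogeneous exponential jump model, started from the empty configuration. -/
def IsExponentialModel {Ω : Type*} [MeasurableSpace Ω] (q lam : ℝ) (ξ : ℝ → ℝ) (B : Set ℝ)
    (p : ℝ → ℝ) (X : ℝ≥0 → Ω → Conf PosReal) (μ : Measure Ω) : Prop :=
  IsMarkovProcess (jumpTransition (expIntensity q lam ξ B p)) 0 X μ

/-! ### Scaling of the parameters -/

/-- The set `B^ε = {⌊b/ε⌋ : b ∈ B}`. -/
def scaledRoadblocks (ε : PosReal) (B : Set ℝ) : Set ℕ+ :=
  {i | ∃ b ∈ B, ⌊(ε : ℝ)⁻¹ * b⌋ = ((i : ℕ) : ℤ)}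

/-- The parameters `ξv i > 0`, `s i ∈ (-1, 0)` of the vertex model are obtained from the data of the
exponential jump model by the scaling with `ε`. If several roadblocks `b` have the same
`⌊b/ε⌋ = i`, then any one of them may determine the parameters at `i`. -/
structure IsScaledParameters (lam : ℝ) (ξ : ℝ → ℝ) (B : Set ℝ) (p : ℝ → ℝ) (ε : PosReal)
    (ξv s : ℕ+ → ℝ) : Prop where
  pos : ∀ i, 0 < ξv i
  spin : ∀ i, s i ∈ Ioo (-1 : ℝ) 0
  regular : ∀ i, i ∉ scaledRoadblocks ε B →
    s i ^ 2 = Real.exp (-(ε : ℝ) * lam) ∧ -ξv i * s i = ξ ((i : ℝ) * ε)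
  roadblock : ∀ i, i ∈ scaledRoadblocks ε B →
    ∃ b ∈ B, ⌊(ε : ℝ)⁻¹ * b⌋ = ((i : ℕ) : ℤ) ∧ s i ^ 2 = p b ∧ -ξv i * s i = ξ b

end

/-! Only lower bounds are ever proved. If the expectations of nonnegative test functions satisfy
`liminf ≥` in the limit, the same bound for the complement `M - f`, together with the total mass `M`
being kept in the limit and not exceeded before it, forces convergence
(`tendsto_of_le_liminf_of_compl`). Fatou's lemma then replaces dominated convergence, tightness and
error estimates. Rare events may be dropped, and explosion matters only through the total mass.

A transfer lemma, `fddExpectation_le_liminf`, reduces several times to one: it asks that the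
transition operators of the prelimit asymptotically dominate those of the limit, where "states
converge" is a relation chosen to suit each limit.

Limit `u ↘ 0`. Restrict one step of the vertex model to horizontal flows carrying at most one
particle. The probability of each such path is an infinite product, and bounding it below gives
`le_vertexStep`: a step dominates `exp(-uR) f + u exp(-uK) A f`, with `A` the jump intensities of
the half-continuous model and `R` its total rate. Iterating and decomposing at the first jump gives
a Riemann sum for the integral that defines `jumpOpUpTo` (`jumpOpUpTo_le_liminf_iterate`). Mass is
kept because the half-continuous model does not explode (`jumpTransition_hc_const`).

Limit `ε ↘ 0`. The exponential model is not continuous in the configuration: it matters whether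
particles coincide with each other or with a roadblock. So configurations converge in the sense of
`ConfLimit`, which preserves coincidences and keeps particles at continuity points of the speed or
at roadblocks. Products of `s_k² q^η(k)` converge to travel probabilities (`tendsto_flyPastProb`).
When one uniform variable drives both landing locations, these converge, with their coincidences,
for all but countably many of its values (`tracksWith_stopSite`), so `ConfLimit` survives a jump.
Induction on the number of jumps and Fatou finish (`jumpOpUpTo_le_liminf_hc`). -/

noncomputable section

/-! ### Lower limits of extended nonnegative functions -/

section LowerLimits

variable {ι : Type*} {l : Filter ι}

theorem le_liminf_mul_of_tendsto [l.NeBot] {a b : ℝ≥0∞} {f g : ι → ℝ≥0∞}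
    (hf : Tendsto f l (𝓝 a)) (hg : b ≤ liminf g l) :
    a * b ≤ liminf (fun i => f i * g i) l := by
  have h := ENNReal.le_liminf_mul (u := f) (v := g) (f := l)
  rw [hf.liminf_eq] at h
  exact (mul_le_mul_right hg a).trans h

theorem le_liminf_add_of_le {a b : ℝ≥0∞} {f g : ι → ℝ≥0∞}
    (hf : a ≤ liminf f l) (hg : b ≤ liminf g l) :
    a + b ≤ liminf (fun i => f i + g i) l := by
  refine (add_le_add hf hg).trans ?_
  rw [liminf_eq_iSup_iInf (u := f), liminf_eq_iSup_iInf (u := g)]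
  refine ENNReal.biSup_add_biSup_le' ⟨univ, univ_mem⟩ ⟨univ, univ_mem⟩ fun s hs s' hs' => ?_
  refine le_liminf_of_le (by isBoundedDefault) ?_
  filter_upwards [hs, hs'] with i h1 h2
  exact add_le_add (iInf₂_le i h1) (iInf₂_le i h2)

theorem sum_le_liminf_sum {κ : Type*} {s : Finset κ} {a : κ → ℝ≥0∞} {f : κ → ι → ℝ≥0∞}
    (h : ∀ k ∈ s, a k ≤ liminf (f k) l) :
    ∑ k ∈ s, a k ≤ liminf (fun i => ∑ k ∈ s, f k i) l := by
  classical
  induction s using Finset.induction_on with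
  | empty => simp
  | insert k s hk ih =>
    simp only [Finset.sum_insert hk]
    exact le_liminf_add_of_le (h k (Finset.mem_insert_self k s))
      (ih fun k' hk' => h k' (Finset.mem_insert_of_mem hk'))

theorem tsum_le_liminf_tsum [l.IsCountablyGenerated] {κ : Type*} {a : κ → ℝ≥0∞}
    {f : κ → ι → ℝ≥0∞} (h : ∀ k, a k ≤ liminf (f k) l) :
    ∑' k, a k ≤ liminf (fun i => ∑' k, f k i) l := by
  rw [ENNReal.tsum_eq_iSup_sum]
  refine iSup_le fun s => (sum_le_liminf_sum fun k _ => h k).trans ?_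
  refine liminf_le_liminf (Eventually.of_forall fun i => ENNReal.sum_le_tsum s)

theorem lintegral_le_liminf_lintegral [l.IsCountablyGenerated] {α : Type*} [MeasurableSpace α]
    {μ : Measure α} {f : α → ℝ≥0∞} {F : ι → α → ℝ≥0∞} (hF : ∀ i, Measurable (F i))
    (h : ∀ᵐ a ∂μ, f a ≤ liminf (fun i => F i a) l) :
    ∫⁻ a, f a ∂μ ≤ liminf (fun i => ∫⁻ a, F i a ∂μ) l :=
  (lintegral_mono_ae h).trans (lintegral_liminf_le hF)

/-- Lower bounds for a quantity and for its complement imply convergence. -/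
theorem tendsto_of_le_liminf_of_compl {a b M : ℝ≥0∞} (hM : M ≠ ∞) {f g : ι → ℝ≥0∞}
    (hf : a ≤ liminf f l) (hg : b ≤ liminf g l) (hab : M ≤ a + b) (hfg : ∀ i, f i + g i ≤ M) :
    Tendsto f l (𝓝 a) := by
  by_cases hl : l.NeBot
  swap
  · rw [not_neBot] at hl; simp [hl]
  have hbM : b ≤ M := hg.trans <| by
    refine (liminf_le_liminf (Eventually.of_forall fun i => ?_)).trans_eq (liminf_const M)
    exact le_add_self.trans (hfg i)
  have hb : b ≠ ∞ := ne_top_of_le_ne_top hM hbM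
  refine tendsto_of_le_liminf_of_limsup_le hf ?_
  refine ENNReal.le_of_forall_pos_le_add fun δ hδ _ => ?_
  refine limsup_le_of_le (by isBoundedDefault) ?_
  -- The case `b = 0` is separate because truncated subtraction gives `b - δ < b` only for `b ≠ 0`.
  have hgb : ∀ᶠ i in l, b ≤ g i + δ := by
    rcases eq_or_ne b 0 with h0 | h0
    · simp [h0]
    have : b - δ < b := ENNReal.sub_lt_self hb h0 (by simpa using hδ.ne')
    filter_upwards [eventually_lt_of_lt_liminf (this.trans_le hg)] with i hi
    exact tsub_le_iff_right.1 hi.le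
  filter_upwards [hgb] with i hi
  have h1 : f i + b ≤ a + δ + b := by
    calc f i + b ≤ f i + (g i + δ) := by gcongr
      _ = (f i + g i) + δ := by ring
      _ ≤ M + δ := by gcongr; exact hfg i
      _ ≤ a + b + δ := by gcongr
      _ = a + δ + b := by ring
  exact (ENNReal.add_le_add_iff_right hb).1 h1

end LowerLimits

/-! ### Lower limits of finite-dimensional distributions -/

/-- If the transition operators `P i` asymptotically dominate `Q`, then so do the expectations of
functions of several times. -/
theorem fddExpectation_le_liminf {ι T E E' : Type*} [Sub T] {l : Filter ι}
    {P : ι → TransitionOp T E} {Q : TransitionOp ℝ≥0 E'} {C : (ι → E) → E' → Prop}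
    {D : (ι → T) → ℝ≥0 → Prop}
    (hPQ : ∀ τ r, D τ r → ∀ (G : ι → E → ℝ≥0∞) (G' : E' → ℝ≥0∞),
      (∀ y y', C y y' → G' y' ≤ liminf (fun i => G i (y i)) l) →
      ∀ x x', C x x' → Q r G' x' ≤ liminf (fun i => P i (τ i) (G i) (x i)) l) :
    ∀ (k : ℕ) (s : ι → T) (s' : ℝ≥0) (t : ι → Fin k → T) (t' : Fin k → ℝ≥0),
      (∀ j : Fin k, j.1 = 0 → D (fun i => t i j - s i) (t' j - s')) →
      (∀ j j' : Fin k, j.1 + 1 = j'.1 → D (fun i => t i j' - t i j) (t' j' - t' j)) →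
      ∀ (F : ι → (Fin k → E) → ℝ≥0∞) (F' : (Fin k → E') → ℝ≥0∞),
      (∀ (z : ι → Fin k → E) (z' : Fin k → E'), (∀ j, C (fun i => z i j) (z' j)) → F' z' ≤ liminf (fun i => F i (z i)) l) →
      ∀ x x', C x x' → fddExpectation Q k s' t' F' x'
        ≤ liminf (fun i => fddExpectation (P i) k (s i) (t i) (F i) (x i)) l
  | 0, s, s', t, t', _, _, F, F', hF, x, x', hx => by
      simp only [fddExpectation]
      exact hF (fun _ => Fin.elim0) Fin.elim0 (fun j => j.elim0)
  | k + 1, s, s', t, t', h0, h1, F, F', hF, x, x', hx => by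
      simp only [fddExpectation]
      -- The expectation over the later times, as a function of the state at the first time, is
      -- itself a test function with the liminf property, by induction.
      refine hPQ _ _ (h0 0 rfl) _ _ (fun y y' hy => ?_) x x' hx
      refine fddExpectation_le_liminf hPQ k (fun i => t i 0) (t' 0) (fun i => Fin.tail (t i))
        (Fin.tail t') ?_ ?_ _ _ ?_ y y' hy
      · intro j hj
        exact h1 0 j.succ (by simp [hj])
      · intro j j' hjj'
        exact h1 j.succ j'.succ (by simp [hjj'])
      · intro z z' hz
        refine hF (fun i => Fin.cons (y i) (z i)) (Fin.cons y' z') (fun j => ?_)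
        refine Fin.cases ?_ (fun j => ?_) j
        · simpa using hy
        · simpa using hz j

theorem fddExpectation_add {T E : Type*} [Sub T] {P : TransitionOp T E}
    (hP : ∀ t f g x, P t (fun y => f y + g y) x = P t f x + P t g x) :
    ∀ (k : ℕ) (s : T) (t : Fin k → T) (F G : (Fin k → E) → ℝ≥0∞) (x : E),
      fddExpectation P k s t (fun z => F z + G z) x
        = fddExpectation P k s t F x + fddExpectation P k s t G x
  | 0, _, _, _, _, _ => rfl
  | k + 1, s, t, F, G, x => by
      simp only [fddExpectation, fddExpectation_add hP k, hP]

theorem fddExpectation_const {T E : Type*} [Sub T] {P : TransitionOp T E} {c : ℝ≥0∞}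
    (hP : ∀ t x, P t (fun _ => c) x = c) :
    ∀ (k : ℕ) (s : T) (t : Fin k → T) (x : E), fddExpectation P k s t (fun _ => c) x = c
  | 0, _, _, _ => rfl
  | k + 1, s, t, x => by
      simp only [fddExpectation, fddExpectation_const hP k, hP]

/-! ### The topology of configuration spaces -/

instance instDiscretePNat : @DiscreteTopology ℕ+ instTopPNat := ⟨rfl⟩

instance instBorelConf (α : Type*) [TopologicalSpace α] : BorelSpace (Conf α) := ⟨rfl⟩

instance instDiscreteConf (α : Type*) [TopologicalSpace α] [DiscreteTopology α] :
    DiscreteTopology (Conf α) :=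
  discreteTopology_iff_forall_isOpen.2 fun _ =>
    isOpen_coinduced.2 (isOpen_discrete (α := List α) _)

theorem continuous_coe_conf {α : Type*} [TopologicalSpace α] :
    Continuous (fun l : List α => (l : Conf α)) :=
  continuous_coinduced_rng

/-- After an ordering of the particles is fixed, the convergence already holds for lists, and
forgetting the order is continuous. -/
theorem tendsto_map_conf {ι α : Type*} {β : Type*} [TopologicalSpace α] {l : Filter ι}
    {φ : ι → β → α} {ψ : β → α} (x : Multiset β)
    (h : ∀ z ∈ x, Tendsto (fun i => φ i z) l (𝓝 (ψ z))) :
    Tendsto (fun i => (x.map (φ i) : Conf α)) l (𝓝 (x.map ψ)) := by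
  induction x using Quotient.inductionOn with
  | h x =>
    have key : Tendsto (fun i => x.map (φ i)) l (𝓝 (x.map ψ)) := by
      induction x with
      | nil => simp
      | cons a x ih =>
        exact (h a (by simp)).cons (ih fun z hz => h z (by simp at hz ⊢; tauto))
    exact (continuous_coe_conf.tendsto _).comp key

/-- The configurations whose particles can be distributed over the given sets. -/
def confBox {α : Type*} (U : List (Set α)) : Set (Conf α) :=
  {m | ∃ x : List α, (x : Conf α) = m ∧ List.Forall₂ (· ∈ ·) x U}

/-- The preimage in the space of lists is the union of the boxes with permuted sides, because a
permutation of the points can be traded for one of the sets. -/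
theorem isOpen_confBox {α : Type*} [TopologicalSpace α] {U : List (Set α)}
    (hU : ∀ s ∈ U, IsOpen s) : IsOpen (confBox U) := by
  refine isOpen_coinduced.2 (isOpen_iff_mem_nhds.2 ?_)
  rintro x ⟨x', hx', hxU⟩
  have hp : List.Perm x x' := (Multiset.coe_eq_coe.1 hx').symm
  obtain ⟨U', h1, h2⟩ := (List.perm_comp_forall₂ hp hxU :)
  rw [nhds_list]
  have h3 : List.Forall₂ (fun (b : α) (s : Set α) => id s ∈ 𝓝 b) x U' := by
    have h4 : ∀ s ∈ U', IsOpen s := fun s hs => hU s (h2.mem_iff.1 hs)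
    clear h2 hxU hp hx'
    induction h1 with
    | nil => exact List.Forall₂.nil
    | cons h _ ih =>
      exact List.Forall₂.cons ((h4 _ (by simp)).mem_nhds h) (ih fun s hs => h4 s (by simp [hs]))
  refine mem_of_superset (mem_traverse _ _ h3) fun y hy => ?_
  have hy' := (List.mem_traverse _ _).1 hy
  obtain ⟨y', h5, h6⟩ : ∃ y', List.Perm y y' ∧ List.Forall₂ (· ∈ ·) y' U := by
    have := List.forall₂_comp_perm_eq_perm_comp_forall₂ (r := fun (a : α) (s : Set α) => a ∈ s)
    have h7 : Relation.Comp (List.Forall₂ fun (a : α) (s : Set α) => a ∈ s) List.Perm y U :=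
      ⟨U', hy', h2⟩
    rw [this] at h7
    exact h7
  exact ⟨y', (Multiset.coe_eq_coe.2 h5.symm), h6⟩

/-- Second countability makes continuous functions on `Fin k → Conf α` measurable for the product of
the Borel σ-algebras, hence test functions of several times measurable. The boxes with sides in a
countable basis form a countable basis. -/
instance instSecondCountableConf (α : Type*) [TopologicalSpace α] [SecondCountableTopology α] :
    SecondCountableTopology (Conf α) := by
  set b := TopologicalSpace.countableBasis α
  have hb := TopologicalSpace.isBasis_countableBasis α
  have hbas : TopologicalSpace.IsTopologicalBasis
      (confBox '' {U : List (Set α) | ∀ s ∈ U, s ∈ b}) := by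
    refine TopologicalSpace.isTopologicalBasis_of_isOpen_of_nhds ?_ ?_
    · rintro _ ⟨U, hU, rfl⟩
      exact isOpen_confBox fun s hs => hb.isOpen (hU s hs)
    · intro m O hm hO
      induction m using Quotient.inductionOn with
      | h x =>
        have h1 : (fun l : List α => (l : Conf α)) ⁻¹' O ∈ 𝓝 x :=
          (isOpen_coinduced.1 hO).mem_nhds hm
        rw [nhds_list, mem_traverse_iff] at h1
        obtain ⟨us, h2, h3⟩ := h1
        have h4 : ∃ vs : List (Set α), (∀ s ∈ vs, s ∈ b) ∧ List.Forall₂ (· ∈ ·) x vs ∧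
            List.Forall₂ (· ⊆ ·) vs us := by
          clear h3 hm hO
          induction h2 with
          | nil => exact ⟨[], by simp, List.Forall₂.nil, List.Forall₂.nil⟩
          | cons h _ ih =>
            obtain ⟨vs, h5, h6, h7⟩ := ih
            obtain ⟨v, hv, hv1, hv2⟩ := hb.mem_nhds_iff.1 h
            refine ⟨v :: vs, ?_, List.Forall₂.cons hv1 h6, List.Forall₂.cons hv2 h7⟩
            intro s hs
            rcases List.mem_cons.1 hs with rfl | hs
            · exact hv
            · exact h5 s hs
        obtain ⟨vs, h5, h6, h7⟩ := h4
        refine ⟨_, ⟨vs, h5, rfl⟩, ⟨x, rfl, h6⟩, ?_⟩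
        rintro _ ⟨y, rfl, hy⟩
        refine h3 (show y ∈ traverse id us from ?_)
        refine (List.mem_traverse _ _).2 ?_
        clear h6 h2 h3 h5 hm
        induction hy generalizing us with
        | nil => cases h7; exact List.Forall₂.nil
        | cons h _ ih =>
          cases h7 with
          | cons h8 h9 => exact List.Forall₂.cons (h8 h) (ih _ h9)
  refine hbas.secondCountableTopology ((Set.Countable.image ?_ _))
  have hc : Countable b := (TopologicalSpace.countable_countableBasis α).to_subtype
  rw [← Set.range_list_map_coe]
  exact Set.countable_range _

instance instNeBotDownToZero : downToZero.NeBot := by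
  refine comap_neBot fun s hs => ?_
  obtain ⟨δ, hδ, h⟩ := Metric.mem_nhds_iff.1 hs
  exact ⟨⟨δ / 2, by positivity⟩, h (by simp [abs_of_pos hδ]; linarith)⟩

instance instCountablyGeneratedDownToZero : downToZero.IsCountablyGenerated :=
  inferInstanceAs (comap Subtype.val (𝓝 (0 : ℝ))).IsCountablyGenerated

theorem tendsto_val_downToZero : Tendsto (fun ε : PosReal => (ε : ℝ)) downToZero (𝓝 0) :=
  tendsto_comap

theorem continuous_map_conf {α β : Type*} [TopologicalSpace α] [DiscreteTopology α]
    [TopologicalSpace β] (φ : α → β) : Continuous (fun η : Conf α => (η.map φ : Conf β)) :=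
  continuous_of_discreteTopology

end

noncomputable section

/-! ### Functionals given by countable sums -/

/-- The functional `Φ` is a sum of values with weights in `[0, ∞]`. -/
def IsSumFunctional {E : Type*} (Φ : (E → ℝ≥0∞) → ℝ≥0∞) : Prop :=
  ∃ q : E → ℝ≥0∞, ∀ f, Φ f = ∑' y, q y * f y

namespace IsSumFunctional

variable {E : Type*} {Φ Ψ : (E → ℝ≥0∞) → ℝ≥0∞}

theorem eval (y : E) : IsSumFunctional (fun f : E → ℝ≥0∞ => f y) := by
  classical
  refine ⟨fun z => if z = y then 1 else 0, fun f => ?_⟩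
  rw [tsum_eq_single y (by intro z hz; simp [hz])]
  simp

theorem zero : IsSumFunctional (fun _ : E → ℝ≥0∞ => 0) := ⟨0, by simp⟩

theorem tsum {κ : Type*} {Φ : κ → (E → ℝ≥0∞) → ℝ≥0∞} (h : ∀ k, IsSumFunctional (Φ k)) :
    IsSumFunctional (fun f => ∑' k, Φ k f) := by
  choose q hq using h
  refine ⟨fun y => ∑' k, q k y, fun f => ?_⟩
  simp only [hq, ← ENNReal.tsum_mul_right]
  exact ENNReal.tsum_comm

theorem add (h : IsSumFunctional Φ) (h' : IsSumFunctional Ψ) :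
    IsSumFunctional (fun f => Φ f + Ψ f) := by
  obtain ⟨q, hq⟩ := h
  obtain ⟨q', hq'⟩ := h'
  exact ⟨fun y => q y + q' y, fun f => by simp only [hq, hq', add_mul, ENNReal.tsum_add]⟩

theorem const_mul (c : ℝ≥0∞) (h : IsSumFunctional Φ) : IsSumFunctional (fun f => c * Φ f) := by
  obtain ⟨q, hq⟩ := h
  exact ⟨fun y => c * q y, fun f => by simp only [hq, mul_assoc, ENNReal.tsum_mul_left]⟩

theorem sum {κ : Type*} {s : Finset κ} {Φ : κ → (E → ℝ≥0∞) → ℝ≥0∞}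
    (h : ∀ k, IsSumFunctional (Φ k)) : IsSumFunctional (fun f => ∑ k ∈ s, Φ k f) := by
  classical
  induction s using Finset.induction_on with
  | empty => simpa using zero
  | insert k s hk ih => simpa only [Finset.sum_insert hk] using (h k).add ih

theorem map_add (h : IsSumFunctional Φ) (f g : E → ℝ≥0∞) :
    Φ (fun y => f y + g y) = Φ f + Φ g := by
  obtain ⟨q, hq⟩ := h
  simp only [hq, mul_add, ENNReal.tsum_add]

theorem map_const_mul (h : IsSumFunctional Φ) (c : ℝ≥0∞) (f : E → ℝ≥0∞) :
    Φ (fun y => c * f y) = c * Φ f := by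
  obtain ⟨q, hq⟩ := h
  simp only [hq, ← ENNReal.tsum_mul_left]
  exact tsum_congr fun y => by ring

theorem map_const (h : IsSumFunctional Φ) (c : ℝ≥0∞) : Φ (fun _ => c) = c * Φ 1 := by
  rw [← h.map_const_mul]; simp

theorem mono (h : IsSumFunctional Φ) {f g : E → ℝ≥0∞} (hfg : f ≤ g) : Φ f ≤ Φ g := by
  obtain ⟨q, hq⟩ := h
  rw [hq, hq]
  exact ENNReal.tsum_le_tsum fun y => mul_le_mul_right (hfg y) _

theorem measurable [Countable E] (h : IsSumFunctional Φ) {α : Type*} [MeasurableSpace α]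
    {F : α → E → ℝ≥0∞} (hF : ∀ y, Measurable fun a => F a y) : Measurable fun a => Φ (F a) := by
  obtain ⟨q, hq⟩ := h
  simp only [hq]
  exact Measurable.tsum fun y => (hF y).const_mul _

/-- Fatou's lemma for a weighted sum. With additivity, monotonicity and measurability in parameters,
this is what the lattice jump kernels are used for. -/
theorem le_liminf (h : IsSumFunctional Φ) {ι : Type*} {l : Filter ι} [l.NeBot]
    [l.IsCountablyGenerated] {f : E → ℝ≥0∞} {F : ι → E → ℝ≥0∞}
    (hF : ∀ y, f y ≤ liminf (fun i => F i y) l) : Φ f ≤ liminf (fun i => Φ (F i)) l := by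
  obtain ⟨q, hq⟩ := h
  simp only [hq]
  exact tsum_le_liminf_tsum fun y => le_liminf_mul_of_tsum_aux (hF y)
where
  le_liminf_mul_of_tsum_aux {ι : Type _} {l : Filter ι} [l.NeBot] {a b : ℝ≥0∞} {g : ι → ℝ≥0∞}
      (hg : b ≤ liminf g l) : a * b ≤ liminf (fun i => a * g i) l :=
    le_liminf_mul_of_tendsto tendsto_const_nhds hg

end IsSumFunctional

/-! ### Pure jump processes with a countable state space -/

theorem lintegral_exp_Ioc {b t : ℝ} (hb : 0 ≤ b) (ht : 0 ≤ t) :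
    ∫⁻ s in Ioc 0 t, ENNReal.ofReal (b * Real.exp (-b * s))
      = ENNReal.ofReal (1 - Real.exp (-b * t)) := by
  have hint : IntervalIntegrable (fun s => b * Real.exp (-b * s)) volume 0 t :=
    Continuous.intervalIntegrable (by fun_prop) _ _
  rw [← ofReal_integral_eq_lintegral_ofReal]
  · congr 1
    rw [← intervalIntegral.integral_of_le ht,
      intervalIntegral.integral_eq_sub_of_hasDerivAt (f := fun s => -Real.exp (-b * s))]
    · simp; ring
    · intro x _
      have := ((hasDerivAt_id x).const_mul (-b)).exp.neg
      simp only [id, mul_one] at this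
      exact this.congr_deriv (by ring)
    · exact hint
  · exact (intervalIntegrable_iff_integrableOn_Ioc_of_le ht).1 hint
  · exact Eventually.of_forall fun s => by positivity

section Jump

variable {E : Type*} {A : JumpIntensity E}

theorem jumpOpUpTo_succ (n : ℕ) (t : ℝ) (f : E → ℝ≥0∞) (x : E) :
    jumpOpUpTo A (n + 1) t f x = ENNReal.ofReal (Real.exp (-(A 1 x).toReal * t)) * f x
        + ∫⁻ s in Ioc (0 : ℝ) t, ENNReal.ofReal (Real.exp (-(A 1 x).toReal * s))
            * A (jumpOpUpTo A n (t - s) f) x := rfl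

/-- The exponential waiting time either exceeds `t` or has its density `R exp(-R s)` on `(0, t]`. -/
theorem exp_add_lintegral_jump (hfin : ∀ x, A 1 x ≠ ∞) {t : ℝ} (ht : 0 ≤ t) (x : E) :
    ENNReal.ofReal (Real.exp (-(A 1 x).toReal * t))
      + ∫⁻ s in Ioc (0 : ℝ) t, ENNReal.ofReal (Real.exp (-(A 1 x).toReal * s)) * A 1 x = 1 := by
  have h : ∀ s, ENNReal.ofReal (Real.exp (-(A 1 x).toReal * s)) * A 1 x
      = ENNReal.ofReal ((A 1 x).toReal * Real.exp (-(A 1 x).toReal * s)) := by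
    intro s
    rw [mul_comm, ENNReal.ofReal_mul ENNReal.toReal_nonneg, ENNReal.ofReal_toReal (hfin x)]
  simp only [h]
  rw [lintegral_exp_Ioc ENNReal.toReal_nonneg ht,
    ← ENNReal.ofReal_add (Real.exp_pos _).le]
  · simp
  · have : Real.exp (-(A 1 x).toReal * t) ≤ 1 :=
      Real.exp_le_one_iff.2 (by nlinarith [@ENNReal.toReal_nonneg (A 1 x)])
    linarith

variable (hA : ∀ x, IsSumFunctional fun f => A f x)

include hA

theorem jumpOpUpTo_le_succ (n : ℕ) (t : ℝ) (f : E → ℝ≥0∞) :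
    jumpOpUpTo A n t f ≤ jumpOpUpTo A (n + 1) t f := by
  induction n generalizing t with
  | zero => exact fun x => zero_le
  | succ n ih =>
    intro x
    rw [jumpOpUpTo_succ, jumpOpUpTo_succ]
    gcongr with s
    exact (hA x).mono (ih _)

theorem monotone_jumpOpUpTo (t : ℝ) (f : E → ℝ≥0∞) (x : E) :
    Monotone fun n => jumpOpUpTo A n t f x :=
  monotone_nat_of_le_succ fun n => jumpOpUpTo_le_succ hA n t f x

variable [Countable E]

theorem measurable_jumpOpUpTo (n : ℕ) (f : E → ℝ≥0∞) (x : E) :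
    Measurable fun t => jumpOpUpTo A n t f x := by
  induction n generalizing x with
  | zero => exact measurable_const
  | succ n ih =>
    simp only [jumpOpUpTo_succ]
    refine Measurable.add (by fun_prop) ?_
    -- The domain of integration depends on `t`; an indicator on the plane reduces the claim to
    -- joint measurability.
    have h : ∀ t : ℝ, ∫⁻ s in Ioc (0 : ℝ) t, ENNReal.ofReal (Real.exp (-(A 1 x).toReal * s))
        * A (jumpOpUpTo A n (t - s) f) x = ∫⁻ s, {p : ℝ × ℝ | 0 < p.2 ∧ p.2 ≤ p.1}.indicator
          (fun p => ENNReal.ofReal (Real.exp (-(A 1 x).toReal * p.2))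
            * A (jumpOpUpTo A n (p.1 - p.2) f) x) (t, s) := by
      intro t
      rw [← lintegral_indicator measurableSet_Ioc]
      rfl
    simp only [h]
    refine Measurable.lintegral_prod_right' (f := {p : ℝ × ℝ | 0 < p.2 ∧ p.2 ≤ p.1}.indicator
          (fun p => ENNReal.ofReal (Real.exp (-(A 1 x).toReal * p.2))
            * A (jumpOpUpTo A n (p.1 - p.2) f) x)) ?_
    refine Measurable.indicator ?_ ?_
    · refine Measurable.mul (by fun_prop) ((hA x).measurable fun y => ?_)
      exact (ih y).comp (measurable_fst.sub measurable_snd)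
    · exact (measurableSet_lt measurable_const measurable_snd).inter
        (measurableSet_le measurable_snd measurable_fst)

theorem measurable_jump_integrand (n : ℕ) (t : ℝ) (f : E → ℝ≥0∞) (x : E) :
    Measurable fun s => ENNReal.ofReal (Real.exp (-(A 1 x).toReal * s))
      * A (jumpOpUpTo A n (t - s) f) x := by
  refine Measurable.mul (by fun_prop) ((hA x).measurable fun y => ?_)
  exact (measurable_jumpOpUpTo hA n f y).comp (measurable_const.sub measurable_id)

theorem jumpOpUpTo_add (n : ℕ) (t : ℝ) (f g : E → ℝ≥0∞) :
    jumpOpUpTo A n t (fun y => f y + g y)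
      = fun x => jumpOpUpTo A n t f x + jumpOpUpTo A n t g x := by
  induction n generalizing t with
  | zero => ext x; simp [jumpOpUpTo]
  | succ n ih =>
    ext x
    simp only [jumpOpUpTo_succ, ih, (hA x).map_add, mul_add]
    rw [lintegral_add_left (measurable_jump_integrand hA n t f x)]
    ring

theorem jumpOpUpTo_const_mul (n : ℕ) (t : ℝ) (c : ℝ≥0∞) (f : E → ℝ≥0∞) :
    jumpOpUpTo A n t (fun y => c * f y) = fun x => c * jumpOpUpTo A n t f x := by
  induction n generalizing t with
  | zero => ext x; simp [jumpOpUpTo]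
  | succ n ih =>
    ext x
    simp only [jumpOpUpTo_succ, ih, (hA x).map_const_mul, mul_add]
    rw [← lintegral_const_mul c (measurable_jump_integrand hA n t f x)]
    congr 1
    · ring
    · exact lintegral_congr fun s => by ring

theorem jumpTransition_add (t : ℝ≥0) (f g : E → ℝ≥0∞) (x : E) :
    jumpTransition A t (fun y => f y + g y) x
      = jumpTransition A t f x + jumpTransition A t g x := by
  simp only [jumpTransition, jumpOpUpTo_add hA]
  exact (ENNReal.iSup_add_iSup_of_monotone (monotone_jumpOpUpTo hA _ f x)
    (monotone_jumpOpUpTo hA _ g x)).symm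

theorem jumpTransition_const (t : ℝ≥0) (c : ℝ≥0∞) (x : E) :
    jumpTransition A t (fun _ => c) x = c * jumpTransition A t (fun _ => 1) x := by
  have h := fun n => congrFun (jumpOpUpTo_const_mul hA n t c fun _ => 1) x
  simp only [mul_one] at h
  simp only [jumpTransition, h, ENNReal.mul_iSup]

variable (hfin : ∀ x, A 1 x ≠ ∞)

include hfin

omit [Countable E] in
theorem jumpOpUpTo_one_le (n : ℕ) {t : ℝ} (ht : 0 ≤ t) (x : E) :
    jumpOpUpTo A n t (fun _ => 1) x ≤ 1 := by
  induction n generalizing t x with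
  | zero => exact zero_le
  | succ n ih =>
    rw [jumpOpUpTo_succ, mul_one]
    refine le_of_le_of_eq ?_ (exp_add_lintegral_jump hfin ht x)
    refine add_le_add le_rfl ?_
    refine setLIntegral_mono' (measurableSet_Ioc (a := (0 : ℝ)) (b := t)) fun s hs => ?_
    gcongr
    exact (hA x).mono fun y => ih (sub_nonneg.2 hs.2) y

/-- A jump process cannot explode if a jump increases the size of the state by at most `1` and if
the jump rates grow at most linearly with this size. -/
theorem one_le_jumpOpUpTo_add {size : E → ℕ} {a : ℝ} (ha : 0 < a)
    (hrate : ∀ x, (A 1 x).toReal ≤ a * (size x + 1))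
    (hsize : ∀ x (f g : E → ℝ≥0∞), (∀ y, size y ≤ size x + 1 → f y ≤ g y) → A f x ≤ A g x)
    (n : ℕ) {t : ℝ} (ht : 0 ≤ t) (x : E) :
    1 ≤ jumpOpUpTo A n t (fun _ => 1) x
      + ENNReal.ofReal ((size x + 1) * Real.exp (a * t) / (size x + 1 + n)) := by
  -- The error term is Markov's inequality for a Yule process of rate `a` started with `size x + 1`
  -- individuals: its mean at time `t` is `(size x + 1) exp(a t)`, and `n` births bring it to `size
  -- x + 1 + n`.
  induction n generalizing t x with
  | zero =>
    have h1 : (1 : ℝ) ≤ (size x + 1) * Real.exp (a * t) / (size x + 1 + (0 : ℕ)) := by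
      have : (0 : ℝ) < size x + 1 := by positivity
      rw [Nat.cast_zero, add_zero, mul_comm, mul_div_assoc, div_self this.ne', mul_one]
      exact Real.one_le_exp (by positivity)
    calc (1 : ℝ≥0∞) = ENNReal.ofReal 1 := by simp
      _ ≤ _ := ENNReal.ofReal_le_ofReal h1
      _ ≤ _ := le_add_self
  | succ n ih =>
    set R := (A 1 x).toReal with hR
    have hR0 : 0 ≤ R := ENNReal.toReal_nonneg
    set N : ℝ := size x + 1 with hN
    have hN1 : 1 ≤ N := by simp [hN]
    have hRA : A 1 x = ENNReal.ofReal R := (ENNReal.ofReal_toReal (hfin x)).symm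
    set H : ℝ → E → ℝ≥0∞ := fun s y =>
      ENNReal.ofReal ((size y + 1) * Real.exp (a * s) / (size y + 1 + n)) with hH
    have hmono : ∀ s : ℝ, A (H s) x
        ≤ ENNReal.ofReal ((N + 1) * Real.exp (a * s) / (N + 1 + n)) * A 1 x := by
      intro s
      rw [← (hA x).map_const]
      refine hsize x _ _ fun y hy => ENNReal.ofReal_le_ofReal ?_
      have hy' : (size y : ℝ) + 1 ≤ N + 1 := by
        have : (size y : ℝ) ≤ size x + 1 := by exact_mod_cast hy
        rw [hN]; linarith
      rw [div_le_div_iff₀ (by positivity) (by positivity)]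
      have h0 : (0 : ℝ) ≤ n := by positivity
      have h2 := mul_le_mul_of_nonneg_right hy' h0
      have h3 := (Real.exp_pos (a * s)).le
      nlinarith [mul_le_mul_of_nonneg_left h2 h3]
    have hint : ∫⁻ s in Ioc (0 : ℝ) t, ENNReal.ofReal (Real.exp (-R * s)) * A (H (t - s)) x
        ≤ ENNReal.ofReal (N * Real.exp (a * t) / (N + (n + 1 : ℕ))) := by
      have hRa : 0 < R + a := by linarith
      -- The product `exp(-R s) exp(a (t - s))` is `exp(a t) / (R + a)` times the exponential
      -- density of rate `R + a`, whose integral is at most `1`.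
      set K : ℝ := (N + 1) * R * Real.exp (a * t) / ((N + 1 + n) * (R + a)) with hK
      have hK0 : 0 ≤ K := by positivity
      calc ∫⁻ s in Ioc (0 : ℝ) t, ENNReal.ofReal (Real.exp (-R * s)) * A (H (t - s)) x
          ≤ ∫⁻ s in Ioc (0 : ℝ) t, ENNReal.ofReal K
              * ENNReal.ofReal ((R + a) * Real.exp (-(R + a) * s)) := by
            refine lintegral_mono fun s => ?_
            refine (mul_le_mul_right (hmono (t - s)) _).trans_eq ?_
            rw [hRA, ← ENNReal.ofReal_mul (by positivity), ← ENNReal.ofReal_mul (by positivity),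
              ← ENNReal.ofReal_mul (by positivity)]
            congr 1
            have e1 : Real.exp (a * (t - s)) = Real.exp (a * t) * Real.exp (-(a * s)) := by
              rw [← Real.exp_add]; ring_nf
            have e2 : Real.exp (-(R + a) * s) = Real.exp (-R * s) * Real.exp (-(a * s)) := by
              rw [← Real.exp_add]; ring_nf
            rw [e1, e2, hK]
            field_simp
        _ = ENNReal.ofReal K * ENNReal.ofReal (1 - Real.exp (-(R + a) * t)) := by
            rw [lintegral_const_mul _ (by fun_prop), lintegral_exp_Ioc hRa.le ht]
        _ ≤ ENNReal.ofReal K * 1 := by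
            gcongr
            rw [← ENNReal.ofReal_one]
            exact ENNReal.ofReal_le_ofReal (by linarith [Real.exp_pos (-(R + a) * t)])
        _ ≤ _ := by
            rw [mul_one]
            refine ENNReal.ofReal_le_ofReal ?_
            rw [hK, div_le_div_iff₀ (by positivity) (by positivity)]
            -- This is `R ≤ a N`, the linear bound on the rates.
            have h1 : (N + 1) * R ≤ N * (R + a) := by
              have := hrate x
              nlinarith
            push_cast
            have h2 : 0 ≤ Real.exp (a * t) * (N + 1 + n) := by positivity
            nlinarith [mul_le_mul_of_nonneg_right h1 h2]
    calc (1 : ℝ≥0∞) = ENNReal.ofReal (Real.exp (-R * t))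
          + ∫⁻ s in Ioc (0 : ℝ) t, ENNReal.ofReal (Real.exp (-R * s)) * A 1 x :=
          (exp_add_lintegral_jump hfin ht x).symm
      _ ≤ ENNReal.ofReal (Real.exp (-R * t))
          + ∫⁻ s in Ioc (0 : ℝ) t, (ENNReal.ofReal (Real.exp (-R * s))
              * A (jumpOpUpTo A n (t - s) (fun _ => 1)) x
            + ENNReal.ofReal (Real.exp (-R * s)) * A (H (t - s)) x) := by
          refine add_le_add le_rfl ?_
          refine setLIntegral_mono' (measurableSet_Ioc (a := (0 : ℝ)) (b := t)) fun s hs => ?_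
          rw [← mul_add, ← (hA x).map_add]
          gcongr
          exact (hA x).mono fun y => ih (sub_nonneg.2 hs.2) y
      _ = jumpOpUpTo A (n + 1) t (fun _ => 1) x
          + ∫⁻ s in Ioc (0 : ℝ) t, ENNReal.ofReal (Real.exp (-R * s)) * A (H (t - s)) x := by
          rw [lintegral_add_left (measurable_jump_integrand hA n t _ x), jumpOpUpTo_succ, mul_one,
            add_assoc]
      _ ≤ _ := by gcongr

theorem jumpTransition_one {size : E → ℕ} {a : ℝ} (ha : 0 < a)
    (hrate : ∀ x, (A 1 x).toReal ≤ a * (size x + 1))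
    (hsize : ∀ x (f g : E → ℝ≥0∞), (∀ y, size y ≤ size x + 1 → f y ≤ g y) → A f x ≤ A g x)
    (t : ℝ≥0) (x : E) : jumpTransition A t (fun _ => 1) x = 1 := by
  refine le_antisymm (iSup_le fun n => jumpOpUpTo_one_le hA hfin n t.2 x) ?_
  have h1 : ∀ n : ℕ, 1 ≤ jumpTransition A t (fun _ => 1) x
      + ENNReal.ofReal ((size x + 1) * Real.exp (a * t) / (size x + 1 + n)) := fun n =>
    (one_le_jumpOpUpTo_add hA hfin ha hrate hsize n t.2 x).trans
      (add_le_add_left (le_iSup (fun n => jumpOpUpTo A n t (fun _ => 1) x) n) _)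
  have h2 : Tendsto (fun n : ℕ => ENNReal.ofReal
      ((size x + 1) * Real.exp (a * t) / (size x + 1 + n))) atTop (𝓝 0) := by
    rw [← ENNReal.ofReal_zero]
    refine ENNReal.tendsto_ofReal (Tendsto.div_atTop tendsto_const_nhds ?_)
    exact tendsto_atTop_add_const_left _ _ tendsto_natCast_atTop_atTop
  have h3 := (tendsto_const_nhds (x := jumpTransition A t (fun _ => 1) x)).add h2
  rw [add_zero] at h3
  exact ge_of_tendsto' h3 h1

end Jump
end

noncomputable section

/-! ### The half-continuous vertex model -/

/-- The probability of flying past the location `k`. -/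
def passWeight (q : ℝ) (s : ℕ+ → ℝ) (η : Conf ℕ+) (k : ℕ+) : ℝ := s k ^ 2 * q ^ η.count k

/-- The total jump rate of the half-continuous vertex model. -/
def totalRate (q ξ₀ : ℝ) (ξ s : ℕ+ → ℝ) (η : Conf ℕ+) : ℝ :=
  ξ₀ + ∑ i ∈ η.toFinset, ξ i * (-s i) * (1 - q ^ η.count i)

/-- The sum telescopes. In use `a m` is the probability of flying past `m` locations, and the
infimum is the probability of never stopping. -/
theorem tsum_sub_succ_add_iInf {a : ℕ → ℝ} (ha : Antitone a) (h0 : ∀ m, 0 ≤ a m) :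
    ∑' m, ENNReal.ofReal (a m - a (m + 1)) + ⨅ m, ENNReal.ofReal (a m) = ENNReal.ofReal (a 0) := by
  have h1 : ∀ N, ∑ m ∈ Finset.range N, ENNReal.ofReal (a m - a (m + 1)) + ENNReal.ofReal (a N)
      = ENNReal.ofReal (a 0) := by
    intro N
    rw [← ENNReal.ofReal_sum_of_nonneg fun m _ => sub_nonneg.2 (ha (Nat.le_succ m)),
      Finset.sum_range_sub', ← ENNReal.ofReal_add (sub_nonneg.2 (ha (Nat.zero_le N))) (h0 N)]
    congr 1; ring
  have h2 : Tendsto (fun N => ∑ m ∈ Finset.range N, ENNReal.ofReal (a m - a (m + 1))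
      + ENNReal.ofReal (a N)) atTop
      (𝓝 (∑' m, ENNReal.ofReal (a m - a (m + 1)) + ⨅ m, ENNReal.ofReal (a m))) :=
    (ENNReal.tendsto_nat_tsum _).add
      (tendsto_atTop_iInf fun m n h => ENNReal.ofReal_le_ofReal (ha h))
  exact tendsto_nhds_unique h2 (by simp only [h1]; exact tendsto_const_nhds)

theorem exists_eq_succPNat {i : ℕ} {j : ℕ+} (h : i < j) : ∃ m, j = (i + m).succPNat := by
  refine ⟨(j : ℕ) - i - 1, ?_⟩
  rw [← PNat.coe_inj, Nat.succPNat_coe]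
  omega

theorem succPNat_add_injective (i : ℕ) : Function.Injective fun m => (i + m).succPNat := by
  intro m m' h
  have := Nat.succPNat_injective h
  omega

theorem filter_Ico_succPNat (i m : ℕ) :
    (Finset.Ico 1 (i + m).succPNat).filter (fun k : ℕ+ => i < (k : ℕ))
      = (Finset.range m).image fun k => (i + k).succPNat := by
  ext k
  simp only [Finset.mem_filter, Finset.mem_Ico, Finset.mem_image, Finset.mem_range]
  constructor
  · rintro ⟨⟨_, h1⟩, h2⟩
    obtain ⟨m', rfl⟩ := exists_eq_succPNat h2
    refine ⟨m', ?_, rfl⟩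
    have := PNat.coe_lt_coe _ _ |>.2 h1
    simp only [Nat.succPNat_coe] at this
    omega
  · rintro ⟨m', h1, rfl⟩
    refine ⟨⟨one_le, ?_⟩, ?_⟩
    · rw [← PNat.coe_lt_coe]; simp only [Nat.succPNat_coe]; omega
    · simp only [Nat.succPNat_coe]; omega

theorem flyPastProb_succPNat (q : ℝ) (s : ℕ+ → ℝ) (η : Conf ℕ+) (i m : ℕ) :
    flyPastProb q s η i (i + m).succPNat
      = ∏ k ∈ Finset.range m, passWeight q s η (i + k).succPNat := by
  rw [flyPastProb, filter_Ico_succPNat, Finset.prod_image (succPNat_add_injective i).injOn]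
  rfl

theorem flyPastProb_eq_one (q : ℝ) (s : ℕ+ → ℝ) (η : Conf ℕ+) {i : ℕ} {j : ℕ+} (h : (j : ℕ) ≤ i + 1) :
    flyPastProb q s η i j = 1 := by
  rw [flyPastProb, Finset.filter_false_of_mem, Finset.prod_empty]
  intro k hk
  have := PNat.coe_lt_coe _ _ |>.2 (Finset.mem_Ico.1 hk).2
  omega

/-- Indexing by the number `m` of locations flown past removes the condition `i < j` and turns the
fly-past probabilities into products over `range m`. -/
theorem hcJump_eq (q : ℝ) (s : ℕ+ → ℝ) (f : Conf ℕ+ → ℝ≥0∞) (η rest : Conf ℕ+) (i : ℕ) :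
    hcJump q s f η rest i
      = ∑' m, ENNReal.ofReal ((∏ k ∈ Finset.range m, passWeight q s η (i + k).succPNat)
          * (1 - passWeight q s η (i + m).succPNat)) * f ((i + m).succPNat ::ₘ rest)
        + (⨅ m, ENNReal.ofReal (∏ k ∈ Finset.range m, passWeight q s η (i + k).succPNat))
          * f rest := by
  rw [hcJump]
  congr 1
  · rw [← (succPNat_add_injective i).tsum_eq]
    · refine tsum_congr fun m => ?_
      rw [if_pos (by simp only [Nat.succPNat_coe]; omega), flyPastProb_succPNat]
      rfl
    · intro j hj
      have : i < (j : ℕ) := by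
        by_contra h
        simp [h] at hj
      obtain ⟨m, rfl⟩ := exists_eq_succPNat this
      exact ⟨m, rfl⟩
  · congr 1
    refine le_antisymm (le_iInf fun m => ?_) (le_iInf fun j => ?_)
    · rw [← flyPastProb_succPNat]
      exact iInf_le _ _
    · by_cases h : i < (j : ℕ)
      · obtain ⟨m, rfl⟩ := exists_eq_succPNat h
        rw [flyPastProb_succPNat]
        exact iInf_le _ _
      -- For `j ≤ i` the product is empty and equals the term `m = 0`, so these `j` do not affect
      -- the infimum.
      · rw [flyPastProb_eq_one _ _ _ (by omega)]
        exact (iInf_le _ 0).trans (by simp)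

theorem isSumFunctional_hcJump (q : ℝ) (s : ℕ+ → ℝ) (η rest : Conf ℕ+) (i : ℕ) :
    IsSumFunctional fun f => hcJump q s f η rest i := by
  simp only [hcJump_eq]
  exact (IsSumFunctional.tsum fun m => (IsSumFunctional.eval _).const_mul _).add
    ((IsSumFunctional.eval _).const_mul _)

theorem isSumFunctional_hcIntensity (q ξ₀ : ℝ) (ξ s : ℕ+ → ℝ) (η : Conf ℕ+) :
    IsSumFunctional fun f => hcIntensity q ξ₀ ξ s f η :=
  ((isSumFunctional_hcJump q s η η 0).const_mul _).add
    (IsSumFunctional.sum fun i => (isSumFunctional_hcJump q s η (η.erase i) i).const_mul _)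

section Rates

variable {q ξ₀ : ℝ} (hq : q ∈ Ioo (0 : ℝ) 1) {ξ s : ℕ+ → ℝ} (hs : ∀ i, s i ∈ Ioo (-1 : ℝ) 0)

include hq hs

theorem passWeight_pos (η : Conf ℕ+) (k : ℕ+) : 0 < passWeight q s η k := by
  have := (hs k).2.ne
  have := hq.1
  unfold passWeight; positivity

theorem passWeight_lt_one (η : Conf ℕ+) (k : ℕ+) : passWeight q s η k < 1 := by
  have h1 : s k ^ 2 < 1 := by nlinarith [(hs k).1, (hs k).2]
  have h2 : q ^ η.count k ≤ 1 := pow_le_one₀ hq.1.le hq.2.le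
  have h3 : 0 < q ^ η.count k := pow_pos hq.1 _
  unfold passWeight
  nlinarith [sq_nonneg (s k)]

theorem prod_passWeight_pos (η : Conf ℕ+) (i m : ℕ) :
    0 < ∏ k ∈ Finset.range m, passWeight q s η (i + k).succPNat :=
  Finset.prod_pos fun _ _ => passWeight_pos hq hs η _

theorem antitone_prod_passWeight (η : Conf ℕ+) (i : ℕ) :
    Antitone fun m => ∏ k ∈ Finset.range m, passWeight q s η (i + k).succPNat := by
  refine antitone_nat_of_succ_le fun m => ?_
  rw [Finset.prod_range_succ]
  exact mul_le_of_le_one_right (prod_passWeight_pos hq hs η i m).le (passWeight_lt_one hq hs η _).le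

theorem hcJump_one (η rest : Conf ℕ+) (i : ℕ) : hcJump q s 1 η rest i = 1 := by
  have h := tsum_sub_succ_add_iInf (antitone_prod_passWeight hq hs η i)
    fun m => (prod_passWeight_pos hq hs η i m).le
  simp only [Finset.prod_range_zero, ENNReal.ofReal_one] at h
  rw [hcJump_eq, ← h]
  simp only [Pi.one_apply, mul_one]
  congr 1
  refine tsum_congr fun m => ?_
  rw [Finset.prod_range_succ]
  congr 1; ring

omit hs in
theorem one_sub_pow_mem (m : ℕ) : 1 - q ^ m ∈ Icc (0 : ℝ) 1 :=
  ⟨sub_nonneg.2 (pow_le_one₀ hq.1.le hq.2.le), by linarith [pow_pos hq.1 m]⟩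

variable (hξ₀ : 0 < ξ₀) (hξ : ∀ i, 0 < ξ i)

include hξ in
theorem leaveRate_nonneg (η : Conf ℕ+) (i : ℕ+) : 0 ≤ ξ i * (-s i) * (1 - q ^ η.count i) :=
  mul_nonneg (mul_nonneg (hξ i).le (by linarith [(hs i).2])) (one_sub_pow_mem hq _).1

include hξ₀ hξ

theorem totalRate_pos (η : Conf ℕ+) : 0 < totalRate q ξ₀ ξ s η := by
  have := Finset.sum_nonneg fun i (_ : i ∈ η.toFinset) => leaveRate_nonneg hq hs hξ η i
  unfold totalRate; linarith

theorem hcIntensity_one (η : Conf ℕ+) :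
    hcIntensity q ξ₀ ξ s 1 η = ENNReal.ofReal (totalRate q ξ₀ ξ s η) := by
  have h := Finset.sum_nonneg fun i (_ : i ∈ η.toFinset) => leaveRate_nonneg hq hs hξ η i
  rw [hcIntensity, totalRate, ENNReal.ofReal_add hξ₀.le h,
    ENNReal.ofReal_sum_of_nonneg fun i _ => leaveRate_nonneg hq hs hξ η i]
  simp only [hcJump_one hq hs, mul_one]

theorem toReal_hcIntensity_one (η : Conf ℕ+) :
    (hcIntensity q ξ₀ ξ s 1 η).toReal = totalRate q ξ₀ ξ s η := by
  rw [hcIntensity_one hq hs hξ₀ hξ, ENNReal.toReal_ofReal (totalRate_pos hq hs hξ₀ hξ η).le]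

end Rates

theorem card_toFinset_le {α : Type*} [DecidableEq α] (η : Multiset α) :
    η.toFinset.card ≤ η.card := by
  rw [← Multiset.toFinset_sum_count_eq, Finset.card_eq_sum_ones]
  exact Finset.sum_le_sum fun i hi => Multiset.one_le_count_iff_mem.2 (Multiset.mem_toFinset.1 hi)

theorem hcJump_mono_of_card {q : ℝ} {s : ℕ+ → ℝ} {f g : Conf ℕ+ → ℝ≥0∞} {η rest : Conf ℕ+} {i : ℕ}
    {N : ℕ} (hr : rest.card ≤ N) (hfg : ∀ y : Conf ℕ+, y.card ≤ N + 1 → f y ≤ g y) :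
    hcJump q s f η rest i ≤ hcJump q s g η rest i := by
  rw [hcJump_eq, hcJump_eq]
  gcongr with m
  · exact hfg _ (by simpa using hr)
  · exact hfg _ (by omega)

section Admissible

variable {q ξ₀ : ℝ} (hq : q ∈ Ioo (0 : ℝ) 1) {ξ s : ℕ+ → ℝ} (hξ₀ : 0 < ξ₀)
  (hadm : AdmissibleVertexParameters ξ s)

include hq hξ₀ hadm

/-- The half-continuous vertex model does not explode. -/
theorem jumpTransition_hc_const (t : ℝ≥0) (c : ℝ≥0∞) (η : Conf ℕ+) :
    jumpTransition (hcIntensity q ξ₀ ξ s) t (fun _ => c) η = c := by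
  have hone := hcIntensity_one hq hadm.spin hξ₀ hadm.pos
  obtain ⟨C, hC⟩ := hadm.bounded
  have hC0 : 0 ≤ C := le_trans (by nlinarith [hadm.pos 1, (hadm.spin 1).2]) (hC 1)
  rw [jumpTransition_const (isSumFunctional_hcIntensity q ξ₀ ξ s),
    -- The stack contributes `ξ₀` and each occupied location at most `C`, so the rate is at most
    -- `(ξ₀ + C)(card η + 1)`.
    jumpTransition_one (isSumFunctional_hcIntensity q ξ₀ ξ s) (by simp [hone])
      (size := Multiset.card) (a := ξ₀ + C) (by linarith), mul_one]
  · intro η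
    rw [toReal_hcIntensity_one hq hadm.spin hξ₀ hadm.pos, totalRate]
    have h1 : ∑ i ∈ η.toFinset, ξ i * (-s i) * (1 - q ^ η.count i) ≤ η.toFinset.card * C := by
      rw [← nsmul_eq_mul]
      refine Finset.sum_le_card_nsmul _ _ _ fun i _ => ?_
      have := hC i
      have h2 := one_sub_pow_mem hq (η.count i)
      have h3 : 0 ≤ ξ i * (-s i) := mul_nonneg (hadm.pos i).le (by linarith [(hadm.spin i).2])
      nlinarith [h2.1, h2.2]
    have h2 : (η.toFinset.card : ℝ) ≤ η.card := by exact_mod_cast card_toFinset_le η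
    have h3 : (0 : ℝ) ≤ η.card := by positivity
    nlinarith
  · intro η f g hfg
    simp only [hcIntensity]
    gcongr with i hi
    · exact hcJump_mono_of_card le_rfl hfg
    · exact hcJump_mono_of_card (Multiset.card_le_card (Multiset.erase_le _ _)) hfg

/-- Conservation of mass is used twice: for the limit object as `u ↘ 0` and for the prelimit as `ε ↘
0`. -/
theorem fddExpectation_hc_add {k : ℕ} (t : Fin k → ℝ≥0) (F G : (Fin k → Conf ℕ+) → ℝ≥0∞) {M : ℝ≥0∞}
    (hM : ∀ z, F z + G z = M) :
    fddExpectation (jumpTransition (hcIntensity q ξ₀ ξ s)) k 0 t F 0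
      + fddExpectation (jumpTransition (hcIntensity q ξ₀ ξ s)) k 0 t G 0 = M := by
  rw [← fddExpectation_add (jumpTransition_add (isSumFunctional_hcIntensity q ξ₀ ξ s))]
  simp only [hM]
  exact fddExpectation_const (jumpTransition_hc_const hq hξ₀ hadm · M ·) k 0 t 0

end Admissible

end

noncomputable section

/-! ### Lower bounds for the transition probabilities of the vertex model -/

/-- The mean number of particles leaving `n ≥ 0` per unit of the rescaled time. -/
def leaveRate (q ξ₀ : ℝ) (ξ s : ℕ+ → ℝ) (η : Conf ℕ+) : ℕ → ℝ
  | 0 => ξ₀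
  | n + 1 => ξ n.succPNat * (-s n.succPNat) * (1 - q ^ η.count n.succPNat)

/-- The particles which stay when one particle leaves `n ≥ 0`. -/
def restConf (η : Conf ℕ+) : ℕ → Conf ℕ+
  | 0 => η
  | n + 1 => η.erase n.succPNat

/-- The configuration after a jump from `i` past `m` further locations, or to infinity. -/
def jumpTarget (η : Conf ℕ+) (i : ℕ) : Option ℕ → Conf ℕ+
  | some m => (i + m).succPNat ::ₘ restConf η i
  | none => restConf η i

/-- The horizontal flow of no particle, or of one particle with the given start and end. -/
def flowPath : Option (ℕ × Option ℕ) → ℕ → ℕ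
  | none, _ => 0
  | some (i, some m), n => if i ≤ n ∧ n ≤ i + m then 1 else 0
  | some (i, none), n => if i ≤ n then 1 else 0

theorem flowPath_eq_zero_or_one (τ : Option (ℕ × Option ℕ)) (n : ℕ) :
    flowPath τ n = 0 ∨ flowPath τ n = 1 := by
  rcases τ with _ | ⟨i, _ | m⟩ <;> simp only [flowPath] <;> (try split_ifs) <;> simp

/-- The start and the end can be read off as the first and the last index with flow `1`. Hence
distinct paths give disjoint events. -/
theorem flowPath_injective : Function.Injective flowPath := by
  have h0 : ∀ (i : ℕ) (b : Option ℕ), flowPath (some (i, b)) i = 1 := by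
    rintro i (_ | m) <;> simp [flowPath]
  have h1 : ∀ (i i' : ℕ) (b : Option ℕ), flowPath (some (i, b)) i' = 1 → i ≤ i' := by
    rintro i i' (_ | m) h
    · by_contra h'
      simp [flowPath, h'] at h
    · by_contra h'
      simp [flowPath, h'] at h
  rintro (_ | ⟨i, b⟩) (_ | ⟨i', b'⟩) h
  · rfl
  · have := congrFun h i'
    rw [h0] at this
    simp [flowPath] at this
  · have := congrFun h i
    rw [h0] at this
    simp [flowPath] at this
  · have e1 : i = i' := le_antisymm (h1 i i' b (by rw [h, h0])) (h1 i' i b' (by rw [← h, h0]))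
    subst e1
    congr 2
    rcases b with _ | m <;> rcases b' with _ | m'
    · rfl
    · have := congrFun h (i + m' + 1)
      simp [flowPath] at this
      omega
    · have := congrFun h (i + m + 1)
      simp [flowPath] at this
      omega
    · have e1 := congrFun h (i + m)
      have e2 := congrFun h (i + m')
      simp [flowPath] at e1 e2
      congr 1
      omega

/-- The probability of the transition from `a` to `b` of the horizontal flow at the location `n`. -/
def flowProb (q u ξ₀ : ℝ) (ξ s : ℕ+ → ℝ) (η : Conf ℕ+) (a : ℕ) : ℕ → ℝ
  | 0 => entranceProb u ξ₀
  | n + 1 => vertexProb q u (ξ n.succPNat) (s n.succPNat) (η.count n.succPNat) a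

/-- The probability of a step of the path `g` of the horizontal flow. -/
def pathWeight (q u ξ₀ : ℝ) (ξ s : ℕ+ → ℝ) (η : Conf ℕ+) (g : ℕ → ℕ) (n : ℕ) : ℝ :=
  if g n = 1 then flowProb q u ξ₀ ξ s η (g (n - 1)) n else 1 - flowProb q u ξ₀ ξ s η (g (n - 1)) n

/-- The uniform variables for which the horizontal flow follows the path `g` at `n`. -/
def pathBox (q u ξ₀ : ℝ) (ξ s : ℕ+ → ℝ) (η : Conf ℕ+) (g : ℕ → ℕ) (n : ℕ) : Set unitInterval :=
  if g n = 1 then {v | (v : ℝ) < flowProb q u ξ₀ ξ s η (g (n - 1)) n}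
  else {v | ¬ (v : ℝ) < flowProb q u ξ₀ ξ s η (g (n - 1)) n}

theorem measurableSet_pathBox (q u ξ₀ : ℝ) (ξ s : ℕ+ → ℝ) (η : Conf ℕ+) (g : ℕ → ℕ) (n : ℕ) :
    MeasurableSet (pathBox q u ξ₀ ξ s η g n) := by
  have h := measurableSet_lt (measurable_subtype_coe (p := (· ∈ Icc (0 : ℝ) 1)))
    (measurable_const (a := flowProb q u ξ₀ ξ s η (g (n - 1)) n))
  unfold pathBox
  split_ifs
  · exact h
  · exact h.compl

/-- Once `g` is prescribed, the threshold at `n` depends on `g (n - 1)` only, so following `g` is a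
product event for the independent uniforms. At `n = 0` the value `g (0 - 1) = g 0` is harmless,
since `flowProb` ignores it there. -/
theorem horizontalFlow_eq_of_mem_pi {q u ξ₀ : ℝ} {ξ s : ℕ+ → ℝ} {η : Conf ℕ+} {g : ℕ → ℕ}
    (hg : ∀ n, g n = 0 ∨ g n = 1) {U : ℕ → unitInterval}
    (hU : U ∈ univ.pi (pathBox q u ξ₀ ξ s η g)) (n : ℕ) : horizontalFlow q u ξ₀ ξ s η U n = g n := by
  induction n with
  | zero =>
    have h := hU 0 (mem_univ _)
    rcases hg 0 with h0 | h0
    · simp only [pathBox, h0, zero_ne_one, if_false, mem_ofPred_eq, flowProb] at h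
      simp [horizontalFlow, h, h0]
    · simp only [pathBox, h0, if_true, mem_ofPred_eq, flowProb] at h
      simp [horizontalFlow, h, h0]
  | succ n ih =>
    have h := hU (n + 1) (mem_univ _)
    rcases hg (n + 1) with h0 | h0
    · simp only [pathBox, h0, zero_ne_one, if_false, mem_ofPred_eq, flowProb,
        Nat.add_sub_cancel] at h
      simp only [horizontalFlow, ih, h0, if_neg h]
    · simp only [pathBox, h0, if_true, mem_ofPred_eq, flowProb, Nat.add_sub_cancel] at h
      simp only [horizontalFlow, ih, h0, if_pos h]

/-- A sum over disjoint events, on which the new state is known, bounds a transition operator from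
below. -/
theorem tsum_mul_le_tsum_measure_mul {ι Ω E : Type*} [Countable ι] [MeasurableSpace Ω]
    {μ : Measure Ω} {B : ι → Set Ω} (hB : ∀ τ, MeasurableSet (B τ)) (hd : Pairwise (Function.onFun Disjoint B))
    {p : ι → ℝ≥0∞} (hp : ∀ τ, p τ ≤ μ (B τ)) {y : ι → E} {S : E → Set Ω}
    (hS : ∀ τ, p τ ≠ 0 → B τ ⊆ S (y τ)) (F : E → ℝ≥0∞) :
    ∑' τ, p τ * F (y τ) ≤ ∑' z, μ (S z) * F z := by
  classical
  have h1 : ∀ τ, p τ * F (y τ) = ∑' z, (if y τ = z then p τ else 0) * F z := by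
    intro τ
    rw [tsum_eq_single (y τ) (by intro z hz; simp [hz.symm])]
    simp
  simp only [h1]
  rw [ENNReal.tsum_comm]
  refine ENNReal.tsum_le_tsum fun z => ?_
  rw [ENNReal.tsum_mul_right]
  gcongr
  calc ∑' τ, (if y τ = z then p τ else 0)
      -- Terms with `p τ = 0` must be discarded first, since the new state is known on `B τ` only
      -- when `p τ ≠ 0`.
      ≤ ∑' τ, μ (if y τ = z ∧ p τ ≠ 0 then B τ else ∅) := by
        refine ENNReal.tsum_le_tsum fun τ => ?_
        by_cases h : p τ = 0
        · simp [h]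
        · by_cases h' : y τ = z <;> simp [h, h', hp τ]
    _ = μ (⋃ τ, if y τ = z ∧ p τ ≠ 0 then B τ else ∅) := by
        refine (measure_iUnion (fun τ τ' hττ' => ?_) fun τ => ?_).symm
        · have := hd hττ'
          simp only [Function.onFun] at this ⊢
          split_ifs <;> simp [this]
        · split_ifs
          · exact hB τ
          · exact MeasurableSet.empty
    _ ≤ μ (S z) := by
        refine measure_mono (iUnion_subset fun τ => ?_)
        split_ifs with h
        · rw [← h.1]; exact hS τ h.2
        · exact empty_subset _

section Bounds

variable {q u ξ₀ : ℝ} (hq : q ∈ Ioo (0 : ℝ) 1) (hu : 0 < u) (hξ₀ : 0 < ξ₀) {ξ s : ℕ+ → ℝ}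
  (hadm : AdmissibleVertexParameters ξ s)

theorem exp_neg_le_one_div_one_add {r : ℝ} (hr : 0 ≤ r) : Real.exp (-r) ≤ 1 / (1 + r) := by
  rw [Real.exp_neg, ← one_div]
  exact one_div_le_one_div_of_le (by linarith) (by linarith [Real.add_one_le_exp r])

/-- The right side is the probability that no particle leaves a location which none enters, with `r
= -ξ s u` and `Q = q ^ η(i)`. The bound follows from `1 + y ≤ exp y` and `(1 + rQ)(1 + r(1 - Q)) -
(1 + r) = r² Q (1 - Q) ≥ 0`. -/
theorem exp_neg_mul_le {r Q : ℝ} (hr : 0 ≤ r) (hQ0 : 0 ≤ Q) (hQ : Q ≤ 1) :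
    Real.exp (-(r * (1 - Q))) ≤ (1 + r * Q) / (1 + r) := by
  have h1 : (1 + r) / (1 + r * Q) ≤ Real.exp (r * (1 - Q)) := by
    have h2 := Real.add_one_le_exp (r * (1 - Q))
    refine le_trans ?_ h2
    rw [div_le_iff₀ (by positivity)]
    nlinarith [mul_nonneg (mul_nonneg (mul_nonneg hr hr) hQ0) (sub_nonneg.2 hQ)]
  rw [Real.exp_neg, ← inv_div]
  exact inv_anti₀ (by positivity) h1

include hq hu hξ₀ hadm

theorem flowProb_mem_Icc (η : Conf ℕ+) {a : ℕ} (n : ℕ) :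
    flowProb q u ξ₀ ξ s η a n ∈ Icc (0 : ℝ) 1 := by
  rcases n with _ | n
  · simp only [flowProb, entranceProb]
    have : 0 < ξ₀ * u := by positivity
    exact ⟨by positivity, (div_le_one (by positivity)).2 (by linarith)⟩
  · simp only [flowProb, vertexProb]
    set k := n.succPNat
    have h1 := one_sub_pow_mem hq (η.count k)
    have h2 : 0 < -ξ k * s k := by nlinarith [hadm.pos k, (hadm.spin k).2]
    have h3 : 0 < -ξ k * s k * u := by positivity
    have h4 := passWeight_lt_one hq hadm.spin η k
    have h5 := passWeight_pos hq hadm.spin η k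
    unfold passWeight at h4 h5
    split_ifs
    · constructor
      · exact div_nonneg (mul_nonneg h3.le h1.1) (by linarith)
      · rw [div_le_one (by linarith)]; nlinarith [h1.1, h1.2]
    · constructor
      · exact div_nonneg (by linarith) (by linarith)
      · rw [div_le_one (by linarith)]; linarith

theorem volume_pathBox (η : Conf ℕ+) (g : ℕ → ℕ) (n : ℕ) :
    volume (pathBox q u ξ₀ ξ s η g n) = ENNReal.ofReal (pathWeight q u ξ₀ ξ s η g n) := by
  have h := flowProb_mem_Icc hq hu hξ₀ hadm η (a := g (n - 1)) n
  set p : unitInterval := ⟨_, h⟩ with hp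
  unfold pathBox pathWeight
  split_ifs
  · exact unitInterval.volume_Iio (x := p)
  · have : {v : unitInterval | ¬ (v : ℝ) < flowProb q u ξ₀ ξ s η (g (n - 1)) n} = Ici p := by
      ext v; simp [hp, ← Subtype.coe_le_coe]
    rw [this]
    exact unitInterval.volume_Ici (x := p)

/-- The probability of a path is bounded from below by bounds of its finite parts. -/
theorem le_infinitePi_pathBox (η : Conf ℕ+) (g : ℕ → ℕ) (N : ℕ) {c : ℝ≥0∞}
    (hc : ∀ M, c ≤ ENNReal.ofReal (∏ n ∈ Finset.range (N + M), pathWeight q u ξ₀ ξ s η g n)) :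
    c ≤ Measure.infinitePi (fun _ : ℕ => (volume : Measure unitInterval))
      (univ.pi (pathBox q u ξ₀ ξ s η g)) := by
  have hw : ∀ n, 0 ≤ pathWeight q u ξ₀ ξ s η g n := by
    intro n
    have h := flowProb_mem_Icc hq hu hξ₀ hadm η (a := g (n - 1)) n
    unfold pathWeight
    split_ifs
    · exact h.1
    · linarith [h.2]
  rw [Measure.infinitePi_pi_univ _ (measurableSet_pathBox q u ξ₀ ξ s η g),
    ENNReal.tprod_eq_iInf_prod fun _ => prob_le_one]
  refine le_iInf fun S => ?_
  -- The measure of the box is an infimum over finite sets of coordinates; enlarging such a set to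
  -- `range (N + M)` only adds factors at most `1`.
  obtain ⟨M, hM⟩ := S.exists_nat_subset_range
  refine (hc M).trans ?_
  rw [ENNReal.ofReal_prod_of_nonneg fun n _ => hw n]
  simp only [← volume_pathBox hq hu hξ₀ hadm]
  refine Finset.prod_le_prod_of_subset_of_le_one' (hM.trans ?_) fun _ _ _ => prob_le_one
  exact Finset.range_mono (by omega)

omit hu in
theorem leaveRate_nonneg' (η : Conf ℕ+) (n : ℕ) : 0 ≤ leaveRate q ξ₀ ξ s η n := by
  rcases n with _ | n
  · exact hξ₀.le
  · exact leaveRate_nonneg hq hadm.spin hadm.pos η _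

omit hu in
theorem sum_leaveRate_le (η : Conf ℕ+) (N : ℕ) :
    ∑ n ∈ Finset.range N, leaveRate q ξ₀ ξ s η n ≤ totalRate q ξ₀ ξ s η := by
  have h : ∀ N, ∑ n ∈ Finset.range N, leaveRate q ξ₀ ξ s η (n + 1)
      ≤ ∑ i ∈ η.toFinset, ξ i * (-s i) * (1 - q ^ η.count i) := by
    intro N
    have e := Finset.sum_image (s := Finset.range N)
      (f := fun i : ℕ+ => ξ i * (-s i) * (1 - q ^ η.count i)) (Nat.succPNat_injective.injOn)
    refine e.symm.trans_le ?_
    refine (Finset.sum_le_sum_of_subset_of_nonneg Finset.subset_union_left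
      (t := _ ∪ η.toFinset) fun i _ _ => leaveRate_nonneg hq hadm.spin hadm.pos η i).trans_eq ?_
    refine (Finset.sum_subset Finset.subset_union_right fun i _ hi => ?_).symm
    rw [Multiset.mem_toFinset] at hi
    simp [Multiset.count_eq_zero.2 hi]
  rcases N with _ | N
  · simpa using (totalRate_pos hq hadm.spin hξ₀ hadm.pos η).le
  · rw [Finset.sum_range_succ', totalRate, add_comm]
    exact add_le_add le_rfl (h N)


/-- The probability of a step of the path `g`, without the factor accounting for the resting
particles. -/
def normalizedWeight (q u ξ₀ : ℝ) (ξ s : ℕ+ → ℝ) (η : Conf ℕ+) (g : ℕ → ℕ) (n : ℕ) : ℝ :=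
  pathWeight q u ξ₀ ξ s η g n * Real.exp (u * leaveRate q ξ₀ ξ s η n)

/-- A location with no flow in or out has weight at least `exp(-u · leaveRate)`. After
normalization, the infinitely many resting locations can thus be bounded by `1` in the product. -/
theorem one_le_normalizedWeight (η : Conf ℕ+) {g : ℕ → ℕ} {n : ℕ} (h : g n = 0)
    (h' : g (n - 1) = 0) : 1 ≤ normalizedWeight q u ξ₀ ξ s η g n := by
  have key : Real.exp (-(u * leaveRate q ξ₀ ξ s η n)) ≤ pathWeight q u ξ₀ ξ s η g n := by
    rcases n with _ | n
    · simp only [pathWeight, h, zero_ne_one, if_false, flowProb, leaveRate, entranceProb]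
      have h0 : 0 ≤ u * ξ₀ := by positivity
      refine (exp_neg_le_one_div_one_add h0).trans_eq ?_
      have : (1 + ξ₀ * u) ≠ 0 := by positivity
      rw [mul_comm u]
      field_simp
      ring
    · simp only [Nat.add_sub_cancel] at h'
      simp only [pathWeight, h, h', zero_ne_one, if_false, flowProb, leaveRate, vertexProb,
        Nat.add_sub_cancel, if_true]
      set k := n.succPNat
      have h2 : 0 < -ξ k * s k * u := by nlinarith [mul_pos (hadm.pos k) hu, (hadm.spin k).2]
      have h3 := exp_neg_mul_le h2.le (pow_nonneg hq.1.le (η.count k))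
        (pow_le_one₀ hq.1.le hq.2.le)
      have e1 : -(u * (ξ k * -s k * (1 - q ^ η.count k)))
        = -(-ξ k * s k * u * (1 - q ^ η.count k)) := by ring
      rw [e1]
      refine h3.trans_eq ?_
      have h4 : (1 + -ξ k * s k * u) ≠ 0 := by positivity
      have e2 : 1 - ξ k * s k * u = 1 + -ξ k * s k * u := by ring
      rw [e2, div_eq_iff h4, sub_mul, div_mul_cancel₀ _ h4]
      ring
  unfold normalizedWeight
  calc (1 : ℝ) = Real.exp (-(u * leaveRate q ξ₀ ξ s η n))
        * Real.exp (u * leaveRate q ξ₀ ξ s η n) := by rw [← Real.exp_add]; simp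
    _ ≤ _ := by gcongr

theorem one_le_exp_leaveRate (η : Conf ℕ+) (n : ℕ) :
    1 ≤ Real.exp (u * leaveRate q ξ₀ ξ s η n) :=
  Real.one_le_exp (mul_nonneg hu.le (leaveRate_nonneg' hq hξ₀ hadm η n))

variable {C : ℝ} (hC : ∀ i, -ξ i * s i ≤ C) (hC₀ : ξ₀ ≤ C)

include hC hC₀

/-- The denominator `1 + r` with `r ≤ u C` costs at most a factor `exp(-u C)`. The guard `0 < n` is
needed because `n - 1 = n` at `n = 0`. -/
theorem start_le_normalizedWeight (η : Conf ℕ+) {g : ℕ → ℕ} {n : ℕ} (h : g n = 1)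
    (h' : 0 < n → g (n - 1) = 0) :
    u * leaveRate q ξ₀ ξ s η n * Real.exp (-(u * C)) ≤ normalizedWeight q u ξ₀ ξ s η g n := by
  have hl := leaveRate_nonneg' hq hξ₀ hadm η n
  have key : u * leaveRate q ξ₀ ξ s η n * Real.exp (-(u * C)) ≤ pathWeight q u ξ₀ ξ s η g n := by
    rcases n with _ | n
    · simp only [pathWeight, h, if_true, flowProb, leaveRate, entranceProb]
      have h0 : 0 ≤ u * ξ₀ := by positivity
      have h1 := exp_neg_le_one_div_one_add h0
      have h2 : Real.exp (-(u * C)) ≤ Real.exp (-(u * ξ₀)) := Real.exp_le_exp.2 (by nlinarith)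
      calc u * ξ₀ * Real.exp (-(u * C)) ≤ u * ξ₀ * (1 / (1 + u * ξ₀)) := by gcongr; linarith
        _ = _ := by rw [mul_comm u]; ring
    · have h' := h' (Nat.succ_pos n)
      simp only [Nat.add_sub_cancel] at h'
      simp only [leaveRate] at hl
      simp only [pathWeight, h, h', if_true, flowProb, leaveRate, vertexProb,
        Nat.add_sub_cancel]
      set k := n.succPNat
      have h2 : 0 < -ξ k * s k * u := by nlinarith [mul_pos (hadm.pos k) hu, (hadm.spin k).2]
      have h3 := exp_neg_le_one_div_one_add h2.le
      have h4 : Real.exp (-(u * C)) ≤ Real.exp (-(-ξ k * s k * u)) :=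
        Real.exp_le_exp.2 (by nlinarith [hC k])
      calc u * (ξ k * -s k * (1 - q ^ η.count k)) * Real.exp (-(u * C))
          ≤ u * (ξ k * -s k * (1 - q ^ η.count k)) * (1 / (1 + -ξ k * s k * u)) := by
            gcongr; linarith
        _ = _ := by
            have e2 : 1 - ξ k * s k * u = 1 + -ξ k * s k * u := by ring
            rw [e2]; ring
  unfold normalizedWeight
  have h1 := one_le_exp_leaveRate hq hu hξ₀ hadm η n
  have h2 : 0 ≤ u * leaveRate q ξ₀ ξ s η n * Real.exp (-(u * C)) := by positivity
  exact key.trans (le_mul_of_one_le_right (h2.trans key) h1)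

omit hC hC₀ in
-- No factor `exp(-u C)` may be lost here, since a particle can pass arbitrarily many locations;
-- none is, because `w ≤ (w + r) / (1 + r)` for `w ≤ 1`.
theorem pass_le_normalizedWeight (η : Conf ℕ+) {g : ℕ → ℕ} {n : ℕ} (h : g (n + 1) = 1)
    (h' : g n = 1) : passWeight q s η n.succPNat ≤ normalizedWeight q u ξ₀ ξ s η g (n + 1) := by
  have hp := passWeight_pos hq hadm.spin η n.succPNat
  have hp1 := passWeight_lt_one hq hadm.spin η n.succPNat
  have key : passWeight q s η n.succPNat ≤ pathWeight q u ξ₀ ξ s η g (n + 1) := by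
    simp only [pathWeight, h, h', if_true, flowProb, vertexProb, Nat.add_sub_cancel,
      one_ne_zero, if_false]
    unfold passWeight at hp hp1 ⊢
    set k := n.succPNat
    have h2 : 0 < -ξ k * s k * u := by nlinarith [mul_pos (hadm.pos k) hu, (hadm.spin k).2]
    rw [le_div_iff₀ (by linarith)]
    nlinarith
  exact key.trans (le_mul_of_one_le_right (hp.le.trans key) (one_le_exp_leaveRate hq hu hξ₀ hadm η _))

omit hC₀ in
theorem stop_le_normalizedWeight (η : Conf ℕ+) {g : ℕ → ℕ} {n : ℕ} (h : g (n + 1) = 0)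
    (h' : g n = 1) : (1 - passWeight q s η n.succPNat) * Real.exp (-(u * C))
      ≤ normalizedWeight q u ξ₀ ξ s η g (n + 1) := by
  have hp1 := sub_pos.2 (passWeight_lt_one hq hadm.spin η n.succPNat)
  have h0 : 0 ≤ (1 - passWeight q s η n.succPNat) * Real.exp (-(u * C)) := by positivity
  have key : (1 - passWeight q s η n.succPNat) * Real.exp (-(u * C))
      ≤ pathWeight q u ξ₀ ξ s η g (n + 1) := by
    simp only [pathWeight, h, h', flowProb, vertexProb, Nat.add_sub_cancel,
      one_ne_zero, zero_ne_one, if_false]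
    unfold passWeight at hp1 ⊢
    set k := n.succPNat
    have h2 : 0 < -ξ k * s k * u := by nlinarith [mul_pos (hadm.pos k) hu, (hadm.spin k).2]
    have h3 := exp_neg_le_one_div_one_add h2.le
    have h4 : Real.exp (-(u * C)) ≤ Real.exp (-(-ξ k * s k * u)) :=
      Real.exp_le_exp.2 (by nlinarith [hC k])
    have h5 : (1 + -ξ k * s k * u) ≠ 0 := by positivity
    calc (1 - s k ^ 2 * q ^ η.count k) * Real.exp (-(u * C))
        ≤ (1 - s k ^ 2 * q ^ η.count k) * (1 / (1 + -ξ k * s k * u)) := by gcongr; linarith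
      _ = _ := by
          have e2 : 1 - ξ k * s k * u = 1 + -ξ k * s k * u := by ring
          rw [e2, mul_one_div, div_eq_iff h5, sub_mul, div_mul_cancel₀ _ h5]
          ring
  exact key.trans (le_mul_of_one_le_right (h0.trans key) (one_le_exp_leaveRate hq hu hξ₀ hadm η _))

omit hC hC₀ in
theorem exp_mul_prod_normalizedWeight_le (η : Conf ℕ+) {g : ℕ → ℕ} {N : ℕ} {c : ℝ} (hc₀ : 0 ≤ c)
    (hc : c ≤ ∏ n ∈ Finset.range N, normalizedWeight q u ξ₀ ξ s η g n) :
    Real.exp (-(u * totalRate q ξ₀ ξ s η)) * c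
      ≤ ∏ n ∈ Finset.range N, pathWeight q u ξ₀ ξ s η g n := by
  have h1 : ∏ n ∈ Finset.range N, pathWeight q u ξ₀ ξ s η g n
      = Real.exp (-(u * ∑ n ∈ Finset.range N, leaveRate q ξ₀ ξ s η n))
        * ∏ n ∈ Finset.range N, normalizedWeight q u ξ₀ ξ s η g n := by
    simp only [normalizedWeight, Finset.prod_mul_distrib, ← Real.exp_sum, ← Finset.mul_sum]
    rw [mul_left_comm, ← Real.exp_add]
    simp
  rw [h1]
  gcongr
  exact sum_leaveRate_le hq hξ₀ hadm η N

/-- The lower bound for the normalized weight of the path of one particle. -/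
def pathLowerBound (q u C ξ₀ : ℝ) (ξ s : ℕ+ → ℝ) (η : Conf ℕ+) (i : ℕ) : Option ℕ → ℝ≥0∞
  | some m => ENNReal.ofReal (u * leaveRate q ξ₀ ξ s η i * Real.exp (-(u * C))
      * ((∏ k ∈ Finset.range m, passWeight q s η (i + k).succPNat)
        * ((1 - passWeight q s η (i + m).succPNat) * Real.exp (-(u * C)))))
  | none => ⨅ m, ENNReal.ofReal (u * leaveRate q ξ₀ ξ s η i * Real.exp (-(u * C))
      * (∏ k ∈ Finset.range m, passWeight q s η (i + k).succPNat))

theorem start_pass_le_prod (η : Conf ℕ+) (i m : ℕ) {g : ℕ → ℕ} (h0 : ∀ n < i, g n = 0)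
    (h1 : ∀ k ≤ m, g (i + k) = 1) :
    u * leaveRate q ξ₀ ξ s η i * Real.exp (-(u * C))
      * (∏ k ∈ Finset.range m, passWeight q s η (i + k).succPNat)
      ≤ ∏ n ∈ Finset.range (i + (m + 1)), normalizedWeight q u ξ₀ ξ s η g n := by
  have hl := leaveRate_nonneg' hq hξ₀ hadm η i
  have hpp := (prod_passWeight_pos hq hadm.spin η i m).le
  rw [Finset.prod_range_add, Finset.prod_range_succ']
  have b1 : 1 ≤ ∏ n ∈ Finset.range i, normalizedWeight q u ξ₀ ξ s η g n := by
    refine (Finset.prod_const_one (s := Finset.range i)).symm.trans_le ?_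
    refine Finset.prod_le_prod (fun _ _ => zero_le_one) fun n hn => ?_
    rw [Finset.mem_range] at hn
    exact one_le_normalizedWeight hq hu hξ₀ hadm η (h0 n hn) (h0 _ (by omega))
  have b2 : ∏ k ∈ Finset.range m, passWeight q s η (i + k).succPNat
      ≤ ∏ k ∈ Finset.range m, normalizedWeight q u ξ₀ ξ s η g (i + (k + 1)) := by
    refine Finset.prod_le_prod (fun k _ => (passWeight_pos hq hadm.spin η _).le) fun k hk => ?_
    rw [Finset.mem_range] at hk
    exact pass_le_normalizedWeight hq hu hξ₀ hadm η (n := i + k) (h1 (k + 1) (by omega))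
      (h1 k hk.le)
  have b3 := start_le_normalizedWeight hq hu hξ₀ hadm hC hC₀ η (g := g) (n := i) (h1 0 (by omega))
    (fun hi => h0 _ (by omega))
  have p3 : 0 ≤ u * leaveRate q ξ₀ ξ s η i * Real.exp (-(u * C)) := by positivity
  calc u * leaveRate q ξ₀ ξ s η i * Real.exp (-(u * C))
        * (∏ k ∈ Finset.range m, passWeight q s η (i + k).succPNat)
      = 1 * ((∏ k ∈ Finset.range m, passWeight q s η (i + k).succPNat)
        * (u * leaveRate q ξ₀ ξ s η i * Real.exp (-(u * C)))) := by ring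
    _ ≤ _ := by
      gcongr
      · exact hpp.trans b2
      · exact b3

/-- The path splits into rest, start, passes, stop and rest. Only start and stop lose a factor
`exp(-u C)`, and restoring the normalization costs the prefactor `exp(-u R)`. -/
theorem pathLowerBound_le (η : Conf ℕ+) (i : ℕ) (b : Option ℕ) :
    ENNReal.ofReal (Real.exp (-(u * totalRate q ξ₀ ξ s η))) * pathLowerBound q u C ξ₀ ξ s η i b
      ≤ Measure.infinitePi (fun _ : ℕ => (volume : Measure unitInterval))
        (univ.pi (pathBox q u ξ₀ ξ s η (flowPath (some (i, b))))) := by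
  have hl := leaveRate_nonneg' hq hξ₀ hadm η i
  rcases b with _ | m
  · refine le_infinitePi_pathBox hq hu hξ₀ hadm η _ (i + 1) fun M => ?_
    have p : 0 ≤ u * leaveRate q ξ₀ ξ s η i * Real.exp (-(u * C))
        * (∏ k ∈ Finset.range M, passWeight q s η (i + k).succPNat) :=
      mul_nonneg (by positivity) (prod_passWeight_pos hq hadm.spin η i M).le
    -- For an escaping particle, the first `i + 1 + M` factors contain exactly `M` passes, so the
    -- `M`-th term of the infimum is the one to compare with.
    refine (mul_le_mul_right (iInf_le _ M) _).trans ?_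
    rw [← ENNReal.ofReal_mul (by positivity)]
    refine ENNReal.ofReal_le_ofReal (exp_mul_prod_normalizedWeight_le hq hu hξ₀ hadm η p ?_)
    rw [show i + 1 + M = i + (M + 1) by ring]
    refine start_pass_le_prod hq hu hξ₀ hadm hC hC₀ η i M (fun n hn => ?_) fun k _ => ?_
    · simp [flowPath, hn]
    · simp [flowPath]
  · refine le_infinitePi_pathBox hq hu hξ₀ hadm η _ (i + (m + 1) + 1) fun M => ?_
    have p1 : 0 ≤ u * leaveRate q ξ₀ ξ s η i * Real.exp (-(u * C))
        * (∏ k ∈ Finset.range m, passWeight q s η (i + k).succPNat) :=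
      mul_nonneg (by positivity) (prod_passWeight_pos hq hadm.spin η i m).le
    have p2 : 0 ≤ (1 - passWeight q s η (i + m).succPNat) * Real.exp (-(u * C)) :=
      mul_nonneg (sub_pos.2 (passWeight_lt_one hq hadm.spin η _)).le (Real.exp_pos _).le
    rw [pathLowerBound, ← mul_assoc, ← ENNReal.ofReal_mul (by positivity)]
    refine ENNReal.ofReal_le_ofReal
      (exp_mul_prod_normalizedWeight_le hq hu hξ₀ hadm η (mul_nonneg p1 p2) ?_)
    rw [Finset.prod_range_add, Finset.prod_range_succ]
    have c1 := start_pass_le_prod hq hu hξ₀ hadm hC hC₀ η i m (g := flowPath (some (i, some m)))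
      (fun n hn => by simp [flowPath, hn]) fun k hk => by simp [flowPath, hk]
    have c2 := stop_le_normalizedWeight hq hu hξ₀ hadm hC η (g := flowPath (some (i, some m)))
      (n := i + m) (by simp [flowPath]) (by simp [flowPath])
    have c3 : 1 ≤ ∏ x ∈ Finset.range M, normalizedWeight q u ξ₀ ξ s η
        (flowPath (some (i, some m))) (i + (m + 1) + 1 + x) := by
      refine (Finset.prod_const_one (s := Finset.range M)).symm.trans_le ?_
      refine Finset.prod_le_prod (fun _ _ => zero_le_one) fun n hn => ?_
      exact one_le_normalizedWeight hq hu hξ₀ hadm η (by simp [flowPath]; omega)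
        (by simp [flowPath]; omega)
    calc _ ≤ ((∏ n ∈ Finset.range (i + (m + 1)), normalizedWeight q u ξ₀ ξ s η
          (flowPath (some (i, some m))) n) * normalizedWeight q u ξ₀ ξ s η
          (flowPath (some (i, some m))) (i + m + 1)) * 1 := by
          rw [mul_one]
          exact mul_le_mul c1 c2 p2 (p1.trans c1)
      _ ≤ _ := by
          refine mul_le_mul_of_nonneg_left c3 ?_
          exact mul_nonneg (p1.trans c1) (p2.trans c2)

end Bounds
end

/-! ### Domination of the jump intensities by one step of the vertex model -/

noncomputable section

theorem ENNReal.tsum_option_eq {α : Type*} (f : Option α → ℝ≥0∞) :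
    ∑' b, f b = f none + ∑' a, f (some a) := by
  have h := (Equiv.optionEquivSumPUnit.{0} α).symm.tsum_eq f
  rw [← h, ENNReal.summable.tsum_sum ENNReal.summable]
  simp [add_comm]

section VertexStep

variable {q u ξ₀ : ℝ} (hq : q ∈ Ioo (0 : ℝ) 1) (hu : 0 < u) (hξ₀ : 0 < ξ₀) {ξ s : ℕ+ → ℝ}
  (hadm : AdmissibleVertexParameters ξ s)

/-- Particle conservation along a one-particle path. The start must be occupied, since otherwise
`erase` removes nothing. -/
theorem count_jumpTarget {η : Conf ℕ+} {i : ℕ} (b : Option ℕ)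
    (hi : ∀ n, i = n + 1 → η.count n.succPNat ≠ 0) (n : ℕ) :
    (jumpTarget η i b).count n.succPNat + flowPath (some (i, b)) (n + 1)
      = η.count n.succPNat + flowPath (some (i, b)) n := by
  have hrest : (restConf η i).count n.succPNat + (if i = n + 1 then 1 else 0)
      = η.count n.succPNat := by
    rcases i with _ | i
    · simp [restConf]
    · have := hi i rfl
      simp only [restConf]
      by_cases h : i = n
      · subst h
        simp only [Multiset.count_erase_self, if_true]
        omega
      · rw [Multiset.count_erase_of_ne (fun h' => h (Nat.succPNat_injective h').symm)]
        simp [h]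
  rcases b with _ | m
  · simp only [jumpTarget, flowPath]
    split_ifs at hrest ⊢ <;> omega
  · simp only [jumpTarget, flowPath, Multiset.count_cons]
    have h : n.succPNat = (i + m).succPNat ↔ n = i + m := Nat.succPNat_injective.eq_iff
    simp only [h]
    split_ifs at hrest ⊢ <;> omega

/-- Empty locations have rate zero, so the sum extends to all of `ℕ`, with the stack as index `0`.
-/
theorem hcIntensity_eq_tsum (f : Conf ℕ+ → ℝ≥0∞) (η : Conf ℕ+) :
    hcIntensity q ξ₀ ξ s f η
      = ∑' i, ENNReal.ofReal (leaveRate q ξ₀ ξ s η i) * hcJump q s f η (restConf η i) i := by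
  rw [tsum_eq_zero_add' ENNReal.summable, hcIntensity]
  congr 1
  have h := Equiv.pnatEquivNat.symm.tsum_eq fun i : ℕ+ =>
    ENNReal.ofReal (ξ i * (-s i) * (1 - q ^ η.count i)) * hcJump q s f η (η.erase i) i
  simp only [Equiv.pnatEquivNat_symm_apply, Nat.succPNat_coe] at h
  simp only [leaveRate, restConf]
  refine Eq.trans ?_ h.symm
  refine (tsum_eq_sum fun i hi => ?_).symm
  rw [Multiset.mem_toFinset] at hi
  simp [Multiset.count_eq_zero.2 hi]

include hq hu hξ₀ hadm

theorem exp_le_infinitePi_pathBox_none (η : Conf ℕ+) :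
    ENNReal.ofReal (Real.exp (-(u * totalRate q ξ₀ ξ s η)))
      ≤ Measure.infinitePi (fun _ : ℕ => (volume : Measure unitInterval))
        (univ.pi (pathBox q u ξ₀ ξ s η (flowPath none))) := by
  refine le_infinitePi_pathBox hq hu hξ₀ hadm η _ 0 fun M => ENNReal.ofReal_le_ofReal ?_
  have h := exp_mul_prod_normalizedWeight_le hq hu hξ₀ hadm η (g := flowPath none) (N := 0 + M)
    zero_le_one ?_
  · simpa using h
  · refine (Finset.prod_const_one (s := Finset.range (0 + M))).symm.trans_le ?_
    refine Finset.prod_le_prod (fun _ _ => zero_le_one) fun n hn => ?_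
    exact one_le_normalizedWeight hq hu hξ₀ hadm η rfl rfl

variable {C : ℝ} (hC : ∀ i, -ξ i * s i ≤ C) (hC₀ : ξ₀ ≤ C)

include hC hC₀

omit hu hC hC₀ in
theorem mul_hcIntensity_le (f : Conf ℕ+ → ℝ≥0∞) (η : Conf ℕ+) (hu : 0 < u) (hC0 : 0 ≤ C) :
    ENNReal.ofReal u * ENNReal.ofReal (Real.exp (-(2 * u * C))) * hcIntensity q ξ₀ ξ s f η
      ≤ ∑' i, ∑' b, pathLowerBound q u C ξ₀ ξ s η i b * f (jumpTarget η i b) := by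
  rw [hcIntensity_eq_tsum, ← ENNReal.tsum_mul_left]
  refine ENNReal.tsum_le_tsum fun i => ?_
  have hl := leaveRate_nonneg' hq hξ₀ hadm η i
  have he : Real.exp (-(2 * u * C)) = Real.exp (-(u * C)) * Real.exp (-(u * C)) := by
    rw [← Real.exp_add]; ring_nf
  have he' : Real.exp (-(2 * u * C)) ≤ Real.exp (-(u * C)) :=
    Real.exp_le_exp.2 (by nlinarith [mul_nonneg hu.le hC0])
  rw [hcJump_eq, ENNReal.tsum_option_eq, mul_add, mul_add, add_comm]
  refine add_le_add ?_ ?_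
  · simp only [jumpTarget, pathLowerBound]
    have h : ∀ m, ENNReal.ofReal (u * leaveRate q ξ₀ ξ s η i * Real.exp (-(u * C))
        * (∏ k ∈ Finset.range m, passWeight q s η (i + k).succPNat))
        = ENNReal.ofReal (u * leaveRate q ξ₀ ξ s η i * Real.exp (-(u * C)))
        * ENNReal.ofReal (∏ k ∈ Finset.range m, passWeight q s η (i + k).succPNat) :=
      fun m => ENNReal.ofReal_mul (by positivity)
    simp only [h]
    rw [← ENNReal.mul_iInf (fun h => absurd h ENNReal.ofReal_ne_top)]
    rw [ENNReal.ofReal_mul (by positivity), ENNReal.ofReal_mul hu.le]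
    calc _ = (ENNReal.ofReal u * ENNReal.ofReal (leaveRate q ξ₀ ξ s η i))
          * ENNReal.ofReal (Real.exp (-(2 * u * C)))
          * (⨅ m, ENNReal.ofReal (∏ k ∈ Finset.range m, passWeight q s η (i + k).succPNat))
          * f (restConf η i) := by ring
      _ ≤ _ := by gcongr
  · rw [← ENNReal.tsum_mul_left, ← ENNReal.tsum_mul_left]
    refine ENNReal.tsum_le_tsum fun m => le_of_eq ?_
    simp only [jumpTarget, pathLowerBound]
    have hp := (prod_passWeight_pos hq hadm.spin η i m).le
    have hp1 := (sub_pos.2 (passWeight_lt_one hq hadm.spin η (i + m).succPNat)).le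
    rw [← mul_assoc, ← mul_assoc, ← ENNReal.ofReal_mul hu.le, ← ENNReal.ofReal_mul (by positivity),
      ← ENNReal.ofReal_mul (by positivity), he]
    congr 2
    ring

/-- One step of the vertex model dominates a small multiple of the jumps of the half-continuous
model. -/
theorem le_vertexStep (f : Conf ℕ+ → ℝ≥0∞) (η : Conf ℕ+) :
    ENNReal.ofReal (Real.exp (-(u * totalRate q ξ₀ ξ s η))) * f η
      + ENNReal.ofReal u * ENNReal.ofReal (Real.exp (-(u * (totalRate q ξ₀ ξ s η + 2 * C))))
        * hcIntensity q ξ₀ ξ s f η ≤ vertexStep q u ξ₀ ξ s f η := by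
  set κ := ENNReal.ofReal (Real.exp (-(u * totalRate q ξ₀ ξ s η))) with hκ
  set p : Option (ℕ × Option ℕ) → ℝ≥0∞ := fun τ =>
    match τ with
    | none => κ
    | some (i, b) => κ * pathLowerBound q u C ξ₀ ξ s η i b with hp
  set y : Option (ℕ × Option ℕ) → Conf ℕ+ := fun τ =>
    match τ with
    | none => η
    | some (i, b) => jumpTarget η i b with hy
  have key := tsum_mul_le_tsum_measure_mul
    (μ := Measure.infinitePi (fun _ : ℕ => (volume : Measure unitInterval)))
    (B := fun τ => univ.pi (pathBox q u ξ₀ ξ s η (flowPath τ))) (p := p) (y := y)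
    (S := fun η' => {U | ∀ n : ℕ, η'.count n.succPNat + horizontalFlow q u ξ₀ ξ s η U (n + 1)
      = η.count n.succPNat + horizontalFlow q u ξ₀ ξ s η U n})
    (fun τ => MeasurableSet.univ_pi fun n => measurableSet_pathBox q u ξ₀ ξ s η _ n)
    ?_ ?_ ?_ f
  · refine le_trans ?_ key
    rw [ENNReal.tsum_option_eq]
    simp only [hp, hy]
    gcongr
    rw [ENNReal.tsum_prod' (f := fun x : ℕ × Option ℕ =>
      κ * pathLowerBound q u C ξ₀ ξ s η x.1 x.2 * f (jumpTarget η x.1 x.2))]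
    simp only [mul_assoc κ, ENNReal.tsum_mul_left]
    refine le_trans (le_of_eq ?_) (mul_le_mul_right (mul_hcIntensity_le hq hξ₀ hadm f η hu
      (hξ₀.le.trans hC₀)) κ)
    have : Real.exp (-(u * (totalRate q ξ₀ ξ s η + 2 * C)))
        = Real.exp (-(u * totalRate q ξ₀ ξ s η)) * Real.exp (-(2 * u * C)) := by
      rw [← Real.exp_add]; ring_nf
    rw [this, ENNReal.ofReal_mul (Real.exp_pos _).le, hκ]
    ring
  · intro τ τ' hτ
    refine Set.disjoint_left.2 fun U hU hU' => hτ (flowPath_injective (funext fun n => ?_))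
    rw [← horizontalFlow_eq_of_mem_pi (flowPath_eq_zero_or_one τ) hU,
      ← horizontalFlow_eq_of_mem_pi (flowPath_eq_zero_or_one τ') hU']
  · rintro (_ | ⟨i, b⟩)
    · exact exp_le_infinitePi_pathBox_none hq hu hξ₀ hadm η
    · exact pathLowerBound_le hq hu hξ₀ hadm hC hC₀ η i b
  · rintro (_ | ⟨i, b⟩) hpτ U hU n
    · simp only [horizontalFlow_eq_of_mem_pi (flowPath_eq_zero_or_one _) hU, hy]
      simp [flowPath]
    · simp only [horizontalFlow_eq_of_mem_pi (flowPath_eq_zero_or_one _) hU, hy]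
      -- A path starting at an empty location has rate zero, hence `p τ = 0`, and is excluded.
      refine count_jumpTarget b (fun n hn h0 => hpτ ?_) n
      have hl : leaveRate q ξ₀ ξ s η i = 0 := by subst hn; simp [leaveRate, h0]
      rcases b with _ | m <;> simp [hp, pathLowerBound, hl]

end VertexStep
end

noncomputable section

/-! ### From discrete time Markov chains to pure jump processes -/

/-- Each value `m` is taken on an interval of length `u`, possibly cut off at `t`. This turns a sum
over time steps into an integral to which Fatou's lemma applies. -/
theorem lintegral_floor_le {u t : ℝ} (hu : 0 < u) (g : ℕ → ℝ≥0∞) :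
    ∫⁻ s in Ioc 0 t, g ⌊s / u⌋₊ ≤ ENNReal.ofReal u * ∑' m, g m := by
  have hm : Measurable fun s : ℝ => ⌊s / u⌋₊ := (measurable_id.div_const u).nat_floor
  rw [← lintegral_map (μ := volume.restrict (Ioc 0 t)) (f := g) measurable_from_nat hm,
    lintegral_countable', ← ENNReal.tsum_mul_left]
  refine ENNReal.tsum_le_tsum fun m => ?_
  rw [mul_comm]
  gcongr
  rw [Measure.map_apply hm (measurableSet_singleton m), Measure.restrict_apply (hm
    (measurableSet_singleton m))]
  calc volume ((fun s : ℝ => ⌊s / u⌋₊) ⁻¹' {m} ∩ Ioc 0 t)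
      ≤ volume (Ico (m * u) ((m + 1) * u)) := by
        refine measure_mono fun s hs => ?_
        have h0 : 0 ≤ s / u := div_nonneg hs.2.1.le hu.le
        have h1 := (Nat.floor_eq_iff h0).1 hs.1
        exact ⟨(le_div_iff₀ hu).1 h1.1, (div_lt_iff₀ hu).1 h1.2⟩
    _ = ENNReal.ofReal u := by rw [Real.volume_Ico]; congr 1; ring

section Chain

variable {E : Type*} {A : JumpIntensity E}

/-- Decomposition of the iterates of a transition operator at the first jump. -/
theorem sum_first_jump_le_iterate {P : (E → ℝ≥0∞) → E → ℝ≥0∞} {x : E} {u R K : ℝ}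
    (hP : ∀ f, ENNReal.ofReal (Real.exp (-(u * R))) * f x
      + ENNReal.ofReal u * ENNReal.ofReal (Real.exp (-(u * K))) * A f x ≤ P f x)
    (f : E → ℝ≥0∞) (N : ℕ) :
    ENNReal.ofReal (Real.exp (-(R * (u * N)))) * f x
      + ENNReal.ofReal u * ∑ m ∈ Finset.range N, ENNReal.ofReal (Real.exp (-(R * (u * m))))
        * ENNReal.ofReal (Real.exp (-(u * K))) * A (P^[N - 1 - m] f) x ≤ P^[N] f x := by
  induction N with
  | zero => simp
  | succ N ih =>
    rw [Function.iterate_succ_apply']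
    refine le_trans ?_ (hP _)
    refine le_trans (le_of_eq ?_) (add_le_add (mul_le_mul_right ih _) le_rfl)
    -- Without a jump in the first step, every term of the bound for `N` is delayed by one step; a
    -- jump in the first step supplies the new term `m = 0`.
    rw [Finset.sum_range_succ']
    have e1 : ∀ m : ℕ, ENNReal.ofReal (Real.exp (-(R * (u * (m + 1 : ℕ)))))
        = ENNReal.ofReal (Real.exp (-(u * R))) * ENNReal.ofReal (Real.exp (-(R * (u * m)))) := by
      intro m
      rw [← ENNReal.ofReal_mul (Real.exp_pos _).le, ← Real.exp_add]
      push_cast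
      ring_nf
    have e2 : ∀ m, N - (m + 1) = N - 1 - m := by intro m; omega
    simp only [e1, Nat.add_sub_cancel, Nat.sub_zero, Nat.cast_zero, mul_zero, neg_zero,
      Real.exp_zero, ENNReal.ofReal_one, one_mul, mul_add, Finset.mul_sum]
    rw [add_assoc]
    congr 1
    · ring
    · congr 1
      · exact Finset.sum_congr rfl fun m _ => by rw [e2]; ring
      · ring

variable {ι : Type*} {l : Filter ι} [l.NeBot] [l.IsCountablyGenerated]

omit [l.NeBot] [l.IsCountablyGenerated] in
theorem tendsto_mul_floor_div {u : ι → ℝ} (hu : ∀ i, 0 < u i) (hu0 : Tendsto u l (𝓝 0)) {s : ℝ}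
    (hs : 0 ≤ s) : Tendsto (fun i => u i * ⌊s / u i⌋₊) l (𝓝 s) := by
  have h1 : Tendsto (fun i => s - u i) l (𝓝 s) := by
    simpa using (tendsto_const_nhds (x := s)).sub hu0
  refine tendsto_of_tendsto_of_tendsto_of_le_of_le h1 tendsto_const_nhds (fun i => ?_) fun i => ?_
  · have h := (Nat.lt_floor_add_one (s / u i)).le
    rw [div_le_iff₀ (hu i)] at h
    simp only
    linarith
  · have h := Nat.floor_le (div_nonneg hs (hu i).le)
    rw [le_div_iff₀ (hu i)] at h
    simp only
    linarith

/-- The iterates of transition operators with small jump probabilities asymptotically dominate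
the transition operators of the jump process. -/
theorem jumpOpUpTo_le_liminf_iterate (hA : ∀ x, IsSumFunctional fun f => A f x)
    {u : ι → ℝ} (hu : ∀ i, 0 < u i) (hu0 : Tendsto u l (𝓝 0))
    {P : ι → (E → ℝ≥0∞) → E → ℝ≥0∞} {K : E → ℝ}
    (hP : ∀ i f x, ENNReal.ofReal (Real.exp (-(u i * (A 1 x).toReal))) * f x
      + ENNReal.ofReal (u i) * ENNReal.ofReal (Real.exp (-(u i * K x))) * A f x ≤ P i f x)
    {F : ι → E → ℝ≥0∞} {F' : E → ℝ≥0∞} (hF : ∀ y, F' y ≤ liminf (fun i => F i y) l)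
    (n : ℕ) {t : ℝ} {N : ι → ℕ} (hN : Tendsto (fun i => u i * N i) l (𝓝 t)) (x : E) :
    jumpOpUpTo A n t F' x ≤ liminf (fun i => (P i)^[N i] (F i) x) l := by
  induction n generalizing t N x with
  | zero => exact zero_le
  | succ n ih =>
    set R := (A 1 x).toReal with hR
    refine le_trans ?_ (liminf_le_liminf (Eventually.of_forall fun i =>
      sum_first_jump_le_iterate (fun f => hP i f x) (F i) (N i)))
    rw [jumpOpUpTo_succ]
    have hexp : ∀ {a : ι → ℝ} {b : ℝ}, Tendsto a l (𝓝 b) →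
        Tendsto (fun i => ENNReal.ofReal (Real.exp (-(R * a i)))) l
          (𝓝 (ENNReal.ofReal (Real.exp (-R * b)))) := by
      intro a b h
      refine ENNReal.tendsto_ofReal ((Real.continuous_exp.tendsto _).comp ?_)
      have := (h.const_mul R).neg
      rwa [← neg_mul] at this
    refine le_liminf_add_of_le (le_liminf_mul_of_tendsto (hexp hN) (hF x)) ?_
    set g : ι → ℕ → ℝ≥0∞ := fun i m => if m < N i then ENNReal.ofReal (Real.exp (-(R * (u i * m))))
        * ENNReal.ofReal (Real.exp (-(u i * K x))) * A ((P i)^[N i - 1 - m] (F i)) x else 0 with hg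
    have h1 : ∀ i, ∫⁻ s in Ioc 0 t, g i ⌊s / u i⌋₊ ≤ ENNReal.ofReal (u i)
        * ∑ m ∈ Finset.range (N i), ENNReal.ofReal (Real.exp (-(R * (u i * m))))
        * ENNReal.ofReal (Real.exp (-(u i * K x))) * A ((P i)^[N i - 1 - m] (F i)) x := by
      intro i
      refine (lintegral_floor_le (hu i) (g i)).trans_eq ?_
      congr 1
      rw [tsum_eq_sum (s := Finset.range (N i)) (fun m hm => by simp [hg] at hm ⊢; omega)]
      refine Finset.sum_congr rfl fun m hm => ?_
      simp only [hg, if_pos (Finset.mem_range.1 hm)]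
    refine le_trans ?_ (liminf_le_liminf (Eventually.of_forall h1))
    refine lintegral_le_liminf_lintegral (fun i => ?_) ?_
    · exact (measurable_from_nat (f := g i)).comp ((measurable_id.div_const (u i)).nat_floor)
    -- The condition `⌊s / u⌋ < N` holds eventually for `s < t` but may fail at `s = t`.
    have hne : ∀ᵐ s ∂(volume.restrict (Ioc 0 t)), s ≠ t :=
      ae_restrict_of_ae (by simp [ae_iff])
    filter_upwards [hne, ae_restrict_mem measurableSet_Ioc] with s hst hs
    have hfl := tendsto_mul_floor_div hu hu0 hs.1.le
    have hlt : s < t := lt_of_le_of_ne hs.2 hst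
    have hev : ∀ᶠ i in l, ⌊s / u i⌋₊ < N i := by
      filter_upwards [hfl.eventually_lt hN hlt] with i hi
      exact_mod_cast lt_of_mul_lt_mul_left hi (hu i).le
    -- The number of steps left after the first jump corresponds to the remaining time `t - s`, so
    -- the induction hypothesis applies to it.
    have hN' : Tendsto (fun i => u i * (N i - 1 - ⌊s / u i⌋₊ : ℕ)) l (𝓝 (t - s)) := by
      have h2 := (hN.sub hu0).sub hfl
      rw [sub_zero] at h2
      refine h2.congr' ?_
      filter_upwards [hev] with i hi
      rw [Nat.cast_sub (by omega), Nat.cast_sub (by omega)]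
      push_cast
      ring
    have h3 := (hA x).le_liminf fun y => ih hN' y
    have hK : Tendsto (fun i => ENNReal.ofReal (Real.exp (-(u i * K x)))) l (𝓝 1) := by
      have h4 : Tendsto (fun i => Real.exp (-(u i * K x))) l (𝓝 (Real.exp 0)) := by
        refine (Real.continuous_exp.tendsto _).comp ?_
        have := (hu0.mul_const (K x)).neg
        simpa using this
      have := ENNReal.tendsto_ofReal h4
      simpa using this
    have h5 := ENNReal.Tendsto.mul (hexp hfl) (Or.inr ENNReal.one_ne_top) hK
      (Or.inr ENNReal.ofReal_ne_top)
    rw [mul_one] at h5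
    refine (le_liminf_mul_of_tendsto h5 h3).trans_eq (liminf_congr ?_)
    filter_upwards [hev] with i hi
    simp only [hg, if_pos hi]

end Chain

/-! ### Lower limits of the finite-dimensional distributions of the vertex model -/

section VertexLimit

variable {q ξ₀ : ℝ} (hq : q ∈ Ioo (0 : ℝ) 1) (hξ₀ : 0 < ξ₀) {ξ s : ℕ+ → ℝ}
  (hadm : AdmissibleVertexParameters ξ s)

include hq hξ₀ hadm

theorem fddExpectation_hc_le_liminf_vertex {k : ℕ} {t : Fin k → ℝ≥0} (ht : Monotone t)
    (F : (Fin k → Conf ℕ+) → ℝ≥0∞) :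
    fddExpectation (jumpTransition (hcIntensity q ξ₀ ξ s)) k 0 t F 0
      ≤ liminf (fun u : PosReal => fddExpectation
        (fun (n : ℕ) f => (vertexStep q u ξ₀ ξ s)^[n] f) k 0
        (fun i => ⌊(t i : ℝ) * (u : ℝ)⁻¹⌋₊) F 0) downToZero := by
  obtain ⟨C, hC⟩ := hadm.bounded
  have hfl : ∀ r : ℝ≥0, Tendsto (fun u : PosReal => (u : ℝ) * ⌊(r : ℝ) * (u : ℝ)⁻¹⌋₊) downToZero
      (𝓝 r) := fun r => tendsto_mul_floor_div (fun u => u.2) tendsto_val_downToZero r.2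
  -- The lattice configurations do not change with `u`, so only constant families of states are
  -- needed; numbers of steps converge after multiplication by `u`.
  refine fddExpectation_le_liminf (ι := PosReal) (C := fun y y' => y = fun _ => y')
    (D := fun N r => Tendsto (fun u : PosReal => (u : ℝ) * N u) downToZero (𝓝 r))
    (P := fun u (n : ℕ) f => (vertexStep q u ξ₀ ξ s)^[n] f) ?_ k (fun _ => 0) 0
    (fun u i => ⌊(t i : ℝ) * (u : ℝ)⁻¹⌋₊) t ?_ ?_ (fun _ => F) F ?_ (fun _ => 0) 0 rfl
  · rintro N r hN G G' hG x x' rfl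
    refine iSup_le fun n => ?_
    refine jumpOpUpTo_le_liminf_iterate (isSumFunctional_hcIntensity q ξ₀ ξ s) (fun u => u.2)
      tendsto_val_downToZero (K := fun η => totalRate q ξ₀ ξ s η + 2 * max C ξ₀) ?_
      (fun y => hG _ y rfl) n hN x'
    intro u f η
    rw [toReal_hcIntensity_one hq hadm.spin hξ₀ hadm.pos]
    exact le_vertexStep hq u.2 hξ₀ hadm (fun i => (hC i).trans (le_max_left _ _))
      (le_max_right _ _) f η
  · intro j _
    simpa using hfl (t j)
  · intro j j' hjj'
    have hle : t j ≤ t j' := ht (Fin.le_def.2 (by omega))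
    rw [NNReal.coe_sub hle]
    refine ((hfl (t j')).sub (hfl (t j))).congr fun u => ?_
    rw [Nat.cast_sub, mul_sub]
    refine Nat.floor_mono (mul_le_mul_of_nonneg_right ?_ (inv_nonneg.2 u.2.le))
    exact_mod_cast hle
  · intro z z' hz
    have : z = fun _ => z' := by
      ext u j
      exact congrFun (hz j) u ▸ rfl
    rw [this]
    simp

end VertexLimit
end

noncomputable section

/-! ### Convergence of the vertex model -/

theorem exists_compl_boundedContinuous {α : Type*} [TopologicalSpace α] (F : α →ᵇ ℝ≥0) :
    ∃ (M : ℝ≥0) (G : α →ᵇ ℝ≥0), ∀ z, (F z : ℝ≥0∞) + G z = M := by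
  refine ⟨nndist F 0, BoundedContinuousFunction.const α (nndist F 0) - F, fun z => ?_⟩
  rw [← ENNReal.coe_add, ENNReal.coe_inj]
  simp only [BoundedContinuousFunction.coe_sub, Pi.sub_apply,
    BoundedContinuousFunction.const_apply]
  exact add_tsub_cancel_of_le (BoundedContinuousFunction.NNReal.upper_bound F z)

/-- The integral of nonnegative functions is superadditive without measurability, and for the
prelimit only this direction is needed. -/
theorem IsMarkovProcess.lintegral_add_lintegral_le {T E Ω : Type*} [Sub T] [Zero T] [Preorder T]
    [TopologicalSpace E] [MeasurableSpace E] [MeasurableSpace Ω] {P : TransitionOp T E} {x₀ : E}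
    {X : T → Ω → E} {μ : Measure Ω} (h : IsMarkovProcess P x₀ X μ) {k : ℕ} (t : Fin k → T)
    {F G : (Fin k → E) → ℝ≥0∞} {M : ℝ≥0∞} (hM : ∀ z, F z + G z = M) :
    ∫⁻ ω, F (fun i => X (t i) ω) ∂μ + ∫⁻ ω, G (fun i => X (t i) ω) ∂μ ≤ M := by
  have := h.isProbabilityMeasure
  refine (le_lintegral_add _ _).trans_eq ?_
  simp [hM]

/-- The limit is expressed by transition operators instead of a process, so that the iterated limit
needs no half-continuous process. -/
theorem tendsto_lintegral_vertex {q ξ₀ : ℝ} (hq : q ∈ Ioo (0 : ℝ) 1) (hξ₀ : 0 < ξ₀) {ξ s : ℕ+ → ℝ}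
    (hadm : AdmissibleVertexParameters ξ s) {Ω : PosReal → Type*} [∀ u, MeasurableSpace (Ω u)]
    {μ : ∀ u, Measure (Ω u)} {X : ∀ u, ℕ → Ω u → Conf ℕ+}
    (hX : ∀ u : PosReal, IsVertexModel q u ξ₀ ξ s (X u) (μ u)) {k : ℕ} {t : Fin k → ℝ≥0}
    (ht : Monotone t) (F : (Fin k → Conf ℕ+) →ᵇ ℝ≥0) :
    Tendsto (fun u : PosReal => ∫⁻ ω, (F (fun i => X u ⌊(t i : ℝ) * (u : ℝ)⁻¹⌋₊ ω) : ℝ≥0∞) ∂(μ u))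
      downToZero
      (𝓝 (fddExpectation (jumpTransition (hcIntensity q ξ₀ ξ s)) k 0 t (fun z => (F z : ℝ≥0∞)) 0)) := by
  obtain ⟨M, G, hM⟩ := exists_compl_boundedContinuous F
  have hfdd : ∀ (H : (Fin k → Conf ℕ+) →ᵇ ℝ≥0) (u : PosReal),
      ∫⁻ ω, (H (fun i => X u ⌊(t i : ℝ) * (u : ℝ)⁻¹⌋₊ ω) : ℝ≥0∞) ∂(μ u)
        = fddExpectation (fun (n : ℕ) f => (vertexStep q u ξ₀ ξ s)^[n] f) k 0
          (fun i => ⌊(t i : ℝ) * (u : ℝ)⁻¹⌋₊) (fun z => (H z : ℝ≥0∞)) 0 := by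
    intro H u
    refine (hX u).fdd k _ (fun i j hij => ?_) (fun i => Nat.zero_le _) H
    exact Nat.floor_mono (mul_le_mul_of_nonneg_right (NNReal.coe_le_coe.2 (ht hij))
      (inv_nonneg.2 u.2.le))
  refine tendsto_of_le_liminf_of_compl (M := M) ENNReal.coe_ne_top
    (g := fun u : PosReal => ∫⁻ ω, (G (fun i => X u ⌊(t i : ℝ) * (u : ℝ)⁻¹⌋₊ ω) : ℝ≥0∞) ∂(μ u))
    ?_ ?_ (fddExpectation_hc_add hq hξ₀ hadm t _ (fun z => (G z : ℝ≥0∞)) hM).ge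
    fun u => (hX u).lintegral_add_lintegral_le _ (F := fun z => (F z : ℝ≥0∞))
      (G := fun z => (G z : ℝ≥0∞)) hM
  · simp only [hfdd F]
    exact fddExpectation_hc_le_liminf_vertex hq hξ₀ hadm ht _
  · simp only [hfdd G]
    exact fddExpectation_hc_le_liminf_vertex hq hξ₀ hadm ht _

end

noncomputable section

/-! ### Travel probabilities of the exponential jump model -/

/-- The probability of passing all particles and roadblocks in the set `I`. -/
def passProb (q : ℝ) (B : Set ℝ) (p : ℝ → ℝ) (η : Conf PosReal) (I : Set ℝ) : ℝ :=
  (open scoped Classical in (η.map fun z : PosReal => if (z : ℝ) ∈ I then q else 1).prod)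
    * ∏ᶠ b ∈ B ∩ I, p b

/-- The locations of particles and roadblocks. -/
def obstacles (B : Set ℝ) (η : Conf PosReal) : Set ℝ := {y | y ∈ B ∨ ∃ z ∈ η, (z : ℝ) = y}

theorem pow_countP_eq_prod_map {α : Type*} (q : ℝ) (P : α → Prop) [DecidablePred P]
    (η : Multiset α) : q ^ η.countP P = (η.map fun z => if P z then q else 1).prod := by
  induction η using Multiset.induction_on with
  | empty => simp
  | cons a η ih =>
    rw [Multiset.countP_cons, Multiset.map_cons, Multiset.prod_cons, ← ih, pow_add, mul_comm]
    split_ifs <;> simp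

theorem travelProb_eq (q lam : ℝ) (B : Set ℝ) (p : ℝ → ℝ) (η : Conf PosReal) (x y : ℝ) :
    travelProb q lam B p η x y = Real.exp (-lam * y) * passProb q B p η (Ioo x (x + y)) := by
  -- `travelProb` counts in `η` coerced to a multiset of reals, and this coercion is a monadic bind.
  have hη : (do let a ← η; pure (a : ℝ)) = η.map fun z : PosReal => (z : ℝ) :=
    Multiset.bind_singleton η _
  rw [travelProb, passProb, ← mul_assoc, pow_countP_eq_prod_map, hη, Multiset.map_map]
  congr 3
  refine Multiset.map_congr rfl fun z _ => ?_
  simp only [mem_Ioo, Function.comp]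

theorem finite_inter_Icc_of_not_accPt {D : Set ℝ} (hD : ∀ x, 0 ≤ x → ¬ AccPt x (𝓟 D)) (M : ℝ) :
    (D ∩ Icc 0 M).Finite := by
  by_contra h
  obtain ⟨x, hx, hacc⟩ := Set.Infinite.exists_accPt_of_subset_isCompact h isCompact_Icc
    inter_subset_right
  exact hD x hx.1 (hacc.mono (principal_mono.2 inter_subset_left))

theorem countable_inter_Ici_of_not_accPt {D : Set ℝ} (hD : ∀ x, 0 ≤ x → ¬ AccPt x (𝓟 D)) :
    (D ∩ Ici 0).Countable := by
  have : D ∩ Ici 0 ⊆ ⋃ n : ℕ, D ∩ Icc 0 (n : ℝ) := by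
    intro x hx
    obtain ⟨n, hn⟩ := exists_nat_ge x
    exact mem_iUnion.2 ⟨n, hx.1, hx.2, hn⟩
  exact (countable_iUnion fun n : ℕ => (finite_inter_Icc_of_not_accPt hD n).countable).mono this

theorem ae_unitInterval_pos_lt_one : ∀ᵐ v : unitInterval, 0 < (v : ℝ) ∧ (v : ℝ) < 1 := by
  have h0 : ∀ᵐ v : unitInterval, v ≠ 0 := by simp [ae_iff]
  have h1 : ∀ᵐ v : unitInterval, v ≠ 1 := by simp [ae_iff]
  filter_upwards [h0, h1] with v hv0 hv1
  exact ⟨unitInterval.pos_iff_ne_zero.2 hv0, unitInterval.lt_one_iff_ne_one.2 hv1⟩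

section Model

variable {q lam : ℝ} (hq : q ∈ Ioo (0 : ℝ) 1) {ξ : ℝ → ℝ} {B : Set ℝ} {p : ℝ → ℝ}
  (h : IsExpModelData lam ξ B p) (η : Conf PosReal)

theorem passProb_congr {I J : Set ℝ} (hIJ : ∀ y ∈ obstacles B η, (y ∈ I ↔ y ∈ J)) :
    passProb q B p η I = passProb q B p η J := by
  unfold passProb
  congr 1
  · congr 1
    refine Multiset.map_congr rfl fun z hz => ?_
    have := hIJ z (Or.inr ⟨z, hz, rfl⟩)
    split_ifs <;> tauto
  · have : B ∩ I = B ∩ J := by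
      ext b
      exact ⟨fun hb => ⟨hb.1, (hIJ b (Or.inl hb.1)).1 hb.2⟩,
        fun hb => ⟨hb.1, (hIJ b (Or.inl hb.1)).2 hb.2⟩⟩
    rw [this]

theorem passProb_empty : passProb q B p η ∅ = 1 := by
  simp [passProb]

include h

theorem obstacles_isolated {z : ℝ} (hz : 0 ≤ z) :
    ∃ δ > 0, ∀ y ∈ obstacles B η, |y - z| < δ → y = z := by
  have h1 : ∀ᶠ y in 𝓝 z, y ∈ B → y = z := by
    have := h.roadblock_discrete z hz
    rw [accPt_iff_frequently, not_frequently] at this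
    filter_upwards [this] with y hy hyB
    by_contra hne
    exact hy ⟨hne, hyB⟩
  have h2 : ∀ᶠ y in 𝓝 z, ∀ w ∈ η.toFinset, (w : ℝ) = y → y = z := by
    rw [eventually_all_finset]
    intro w _
    by_cases hw : (w : ℝ) = z
    · exact Eventually.of_forall fun y hy => by rw [← hy, hw]
    · filter_upwards [isOpen_ne.mem_nhds (Ne.symm hw)] with y hy hy'
      exact absurd hy'.symm hy
  obtain ⟨δ, hδ, hball⟩ := Metric.eventually_nhds_iff.1 (h1.and h2)
  refine ⟨δ, hδ, fun y hy hyz => ?_⟩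
  have := hball (y := y) (by rwa [Real.dist_eq])
  rcases hy with hy | ⟨w, hw, hwy⟩
  · exact this.1 hy
  · exact this.2 w (Multiset.mem_toFinset.2 hw) hwy

theorem finite_roadblocks {x y : ℝ} (hx : 0 ≤ x) : (B ∩ Icc x y).Finite :=
  (finite_inter_Icc_of_not_accPt h.roadblock_discrete y).subset
    (inter_subset_inter_right _ (Icc_subset_Icc_left hx))

/-- A bounded interval contains finitely many roadblocks; a `finprod` with infinite support would
default to `1` and multiplicativity could fail. -/
theorem passProb_union {I J : Set ℝ} {x y : ℝ} (hx : 0 ≤ x) (hI : I ⊆ Icc x y) (hJ : J ⊆ Icc x y)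
    (hIJ : Disjoint I J) :
    passProb q B p η (I ∪ J) = passProb q B p η I * passProb q B p η J := by
  classical
  unfold passProb
  rw [inter_union_distrib_left, finprod_mem_union (hIJ.mono inter_subset_right inter_subset_right)
    ((finite_roadblocks h hx).subset (inter_subset_inter_right _ hI))
    ((finite_roadblocks h hx).subset (inter_subset_inter_right _ hJ)), mul_mul_mul_comm,
    ← Multiset.prod_map_mul]
  congr 2
  refine Multiset.map_congr rfl fun z _ => ?_
  have := fun hz : (z : ℝ) ∈ I => Set.disjoint_left.1 hIJ hz
  by_cases h1 : (z : ℝ) ∈ I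
  · simp [h1, this h1]
  · by_cases h2 : (z : ℝ) ∈ J <;> simp [h1, h2]

include hq

theorem passProb_mem_Ioc (I : Set ℝ) : passProb q B p η I ∈ Ioc (0 : ℝ) 1 := by
  have hmul : ∀ a b : ℝ, a ∈ Ioc (0 : ℝ) 1 → b ∈ Ioc (0 : ℝ) 1 → a * b ∈ Ioc (0 : ℝ) 1 :=
    fun a b ha hb => ⟨mul_pos ha.1 hb.1, mul_le_one₀ ha.2 hb.1.le hb.2⟩
  refine hmul _ _ ?_ ?_
  · refine Multiset.prod_induction (· ∈ Ioc (0 : ℝ) 1) _ hmul (by simp) fun a ha => ?_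
    obtain ⟨z, _, rfl⟩ := Multiset.mem_map.1 ha
    split_ifs
    · exact ⟨hq.1, hq.2.le⟩
    · simp
  · refine finprod_mem_induction (· ∈ Ioc (0 : ℝ) 1) (by simp) (fun a b => hmul a b) fun b hb => ?_
    exact ⟨(h.roadblock_prob b hb.1).1, (h.roadblock_prob b hb.1).2.le⟩

omit hq in
theorem travelProb_split {x y z : ℝ} (hx : 0 ≤ x) (hxy : x < y) (hyz : y ≤ z) :
    travelProb q lam B p η x (z - x) = travelProb q lam B p η x (y - x)
      * (Real.exp (-lam * (z - y)) * passProb q B p η (Ico y z)) := by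
  simp only [travelProb_eq, add_sub_cancel]
  rw [← Ioo_union_Ico_eq_Ioo hxy hyz, passProb_union h η hx (y := z)
    (Ioo_subset_Icc_self.trans (Icc_subset_Icc_right hyz))
    (Ico_subset_Icc_self.trans (Icc_subset_Icc_left hxy.le))
    (Set.disjoint_left.2 fun a ha ha' => absurd ha.2 (not_lt.2 ha'.1))]
  have : Real.exp (-lam * (z - x)) = Real.exp (-lam * (y - x)) * Real.exp (-lam * (z - y)) := by
    rw [← Real.exp_add]; ring_nf
  rw [this]; ring

theorem travelProb_pos (x y : ℝ) : 0 < travelProb q lam B p η x y := by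
  rw [travelProb_eq]
  exact mul_pos (Real.exp_pos _) (passProb_mem_Ioc hq h η _).1

theorem travelProb_le (x y : ℝ) : travelProb q lam B p η x y ≤ Real.exp (-lam * y) := by
  rw [travelProb_eq]
  exact mul_le_of_le_one_right (Real.exp_pos _).le (passProb_mem_Ioc hq h η _).2

theorem travelProb_lt {x y z : ℝ} (hx : 0 ≤ x) (hxy : x < y) (hyz : y < z) :
    travelProb q lam B p η x (z - x) < travelProb q lam B p η x (y - x) := by
  rw [travelProb_split h η hx hxy hyz.le]
  refine mul_lt_of_lt_one_right (travelProb_pos hq h η _ _) ?_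
  refine (mul_le_of_le_one_right (Real.exp_pos _).le (passProb_mem_Ioc hq h η _).2).trans_lt ?_
  exact Real.exp_lt_one_iff.2 (by nlinarith [h.lam_pos])


omit hq in
-- Near `z` the only possible obstacle is `z` itself, and it counts only for destinations beyond
-- `z`. So the travel probability is left continuous at `z` and drops by the factor `passProb {z}`
-- on the right.
theorem travelProb_local {x z : ℝ} (hx : 0 ≤ x) (hxz : x < z) :
    ∃ δ > 0, (∀ y, x < y → z - δ < y → y < z →
        travelProb q lam B p η x (y - x)
          = travelProb q lam B p η x (z - x) * Real.exp (lam * (z - y))) ∧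
      (∀ y, z < y → y < z + δ → travelProb q lam B p η x (y - x)
          = travelProb q lam B p η x (z - x) * passProb q B p η {z}
            * Real.exp (-lam * (y - z))) := by
  obtain ⟨δ, hδ, hiso⟩ := obstacles_isolated h η (hx.trans hxz.le)
  refine ⟨δ, hδ, fun y hxy hy hyz => ?_, fun y hzy hy => ?_⟩
  · rw [travelProb_split h η hx hxy hyz.le, passProb_congr η (J := ∅), passProb_empty, mul_one,
      mul_assoc, ← Real.exp_add]
    · simp
    · intro a ha
      refine ⟨fun h1 => ?_, fun h1 => absurd h1 (notMem_empty a)⟩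
      have := hiso a ha (by rw [abs_lt]; constructor <;> linarith [h1.1, h1.2])
      exact absurd h1.2 (by rw [this]; exact lt_irrefl z)
  · rw [travelProb_split h η hx hxz hzy.le, passProb_congr η (J := {z})]
    · ring
    · intro a ha
      constructor
      · intro h1
        exact hiso a ha (by rw [abs_lt]; constructor <;> linarith [h1.1, h1.2])
      · rintro rfl
        exact ⟨le_rfl, hzy⟩

theorem travelDistance_spec {x : ℝ} (hx : 0 ≤ x) {v : unitInterval} (hv0 : 0 < (v : ℝ))
    (hv1 : (v : ℝ) < 1) :
    0 < travelDistance q lam B p η x v ∧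
      (∀ y, 0 < y → y < travelDistance q lam B p η x v → (v : ℝ) < travelProb q lam B p η x y) ∧
      ∀ y, travelDistance q lam B p η x v < y → travelProb q lam B p η x y < v := by
  have hlam := h.lam_pos
  set A := {y : ℝ | 0 < y ∧ (v : ℝ) ≤ travelProb q lam B p η x y} with hA
  have hlog : Real.log v < 0 := Real.log_neg hv0 hv1
  have hbdd : BddAbove A := by
    refine ⟨-Real.log v / lam, fun y hy => ?_⟩
    have h1 := hy.2.trans (travelProb_le hq h η x y)
    rw [← Real.log_le_iff_le_exp hv0] at h1
    rw [le_div_iff₀ hlam]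
    linarith
  have hne : ∃ y, y ∈ A := by
    -- Within distance `δ` to the right of `x` there are no obstacles, so there the travel
    -- probability is `exp(-lam y)`, which is at least `v` for small `y`.
    obtain ⟨δ, hδ, hiso⟩ := obstacles_isolated h η hx
    refine ⟨min δ (-Real.log v / lam), lt_min hδ (div_pos (by linarith) hlam), ?_⟩
    set y := min δ (-Real.log v / lam) with hy
    rw [travelProb_eq, passProb_congr η (J := ∅), passProb_empty, mul_one,
      ← Real.log_le_iff_le_exp hv0]
    · have : y ≤ -Real.log v / lam := min_le_right _ _
      rw [le_div_iff₀ hlam] at this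
      linarith
    · intro a ha
      refine ⟨fun h1 => ?_, fun h1 => absurd h1 (notMem_empty a)⟩
      have h2 : y ≤ δ := min_le_left _ _
      have := hiso a ha (by rw [abs_lt]; constructor <;> linarith [h1.1, h1.2])
      exact absurd h1.1 (by rw [this]; exact lt_irrefl x)
  have hd : travelDistance q lam B p η x v = sSup A := rfl
  obtain ⟨y₀, hy₀⟩ := hne
  have hpos : 0 < sSup A := hy₀.1.trans_le (le_csSup hbdd hy₀)
  rw [hd]
  refine ⟨hpos, fun y hy hyd => ?_, fun y hy => ?_⟩
  · obtain ⟨y', hy', hlt⟩ := exists_lt_of_lt_csSup ⟨y₀, hy₀⟩ hyd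
    have := travelProb_lt hq h η hx (y := x + y) (z := x + y') (by linarith) (by linarith)
    simp only [add_sub_cancel_left] at this
    exact hy'.2.trans_lt this
  · by_contra hcon
    exact absurd (le_csSup hbdd (show y ∈ A from ⟨hpos.trans hy, not_lt.1 hcon⟩)) (not_le.2 hy)

/-- One-sided limits at `z` of the strict inequalities in `travelDistance_spec`. The interval is a
single point unless `z` is an obstacle, where its length is the atom of the landing law. -/
theorem le_travelProb_travelDistance {x : ℝ} (hx : 0 ≤ x) {v : unitInterval} (hv0 : 0 < (v : ℝ))
    (hv1 : (v : ℝ) < 1) {z : ℝ} (hz : z = x + travelDistance q lam B p η x v) :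
    (v : ℝ) ∈ Icc (travelProb q lam B p η x (z - x) * passProb q B p η {z})
      (travelProb q lam B p η x (z - x)) := by
  obtain ⟨hd, hlt, hgt⟩ := travelDistance_spec hq h η hx hv0 hv1
  obtain ⟨δ, hδ, hl, hr⟩ := travelProb_local h η hx (show x < z by linarith)
  constructor
  · have hc : Tendsto (fun y => travelProb q lam B p η x (z - x) * passProb q B p η {z}
        * Real.exp (-lam * (y - z))) (𝓝[>] z)
        (𝓝 (travelProb q lam B p η x (z - x) * passProb q B p η {z}
        * Real.exp (-lam * (z - z)))) :=
      (Continuous.tendsto (by fun_prop) z).mono_left nhdsWithin_le_nhds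
    rw [sub_self, mul_zero, Real.exp_zero, mul_one] at hc
    refine le_of_tendsto hc ?_
    filter_upwards [Ioo_mem_nhdsGT (show z < z + δ by linarith)] with y hy
    rw [← hr y hy.1 hy.2]
    exact (hgt _ (by linarith [hy.1])).le
  · have hc : Tendsto (fun y => travelProb q lam B p η x (z - x) * Real.exp (lam * (z - y)))
        (𝓝[<] z) (𝓝 (travelProb q lam B p η x (z - x) * Real.exp (lam * (z - z)))) :=
      (Continuous.tendsto (by fun_prop) z).mono_left nhdsWithin_le_nhds
    rw [sub_self, mul_zero, Real.exp_zero, mul_one] at hc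
    refine ge_of_tendsto hc ?_
    filter_upwards [Ioo_mem_nhdsLT (show max x (z - δ) < z from
      max_lt (by linarith) (by linarith))] with y hy
    rw [← hl y ((le_max_left _ _).trans_lt hy.1) ((le_max_right _ _).trans_lt hy.1) hy.2]
    exact (hlt _ (by linarith [(le_max_left x (z - δ)).trans_lt hy.1]) (by linarith [hy.2])).le

/-- The distance is antitone in `v > 0`. The point `v = 0` is left out: its set of distances is
unbounded and `sSup` takes the default value `0`. -/
theorem aemeasurable_travelDistance (x : ℝ) :
    AEMeasurable (fun v => x + travelDistance q lam B p η x v) (volume : Measure unitInterval) := by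
  refine AEMeasurable.const_add ?_ x
  have hanti : AntitoneOn (travelDistance q lam B p η x) (Ioi 0) := by
    intro v hv v' hv' hvv'
    have hv0 : 0 < (v : ℝ) := hv
    unfold travelDistance
    rcases Set.eq_empty_or_nonempty {y : ℝ | 0 < y ∧ (v' : ℝ) ≤ travelProb q lam B p η x y}
      with he | hne
    · rw [he, Real.sSup_empty]
      exact Real.sSup_nonneg fun y hy => hy.1.le
    · refine csSup_le_csSup ?_ hne fun y hy => ⟨hy.1, le_trans hvv' hy.2⟩
      refine ⟨-Real.log v / lam, fun y hy => ?_⟩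
      have h1 := hy.2.trans (travelProb_le hq h η x y)
      rw [← Real.log_le_iff_le_exp hv0] at h1
      rw [le_div_iff₀ h.lam_pos]
      linarith
  have := aemeasurable_restrict_of_antitoneOn (μ := (volume : Measure unitInterval))
    measurableSet_Ioi hanti
  rwa [Measure.restrict_eq_self_of_ae_mem] at this
  filter_upwards [ae_unitInterval_pos_lt_one] with v hv
  exact hv.1

theorem landingLaw_univ {x : ℝ} (hx : 0 ≤ x) : landingLaw q lam B p η x univ = 1 := by
  have hemb : MeasurableEmbedding (Subtype.val : PosReal → ℝ) :=
    MeasurableEmbedding.subtype_coe measurableSet_Ioi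
  rw [landingLaw, hemb.comap_apply, image_univ, show range (Subtype.val : PosReal → ℝ) = Ioi 0 from Subtype.range_val,
    Measure.map_apply_of_aemeasurable (aemeasurable_travelDistance hq h η x) measurableSet_Ioi]
  refine (prob_compl_eq_zero_iff₀ ?_).1 ?_
  · exact (aemeasurable_travelDistance hq h η x).nullMeasurableSet_preimage measurableSet_Ioi
  · have : ∀ᵐ v : unitInterval, v ∈ (fun v => x + travelDistance q lam B p η x v) ⁻¹' Ioi 0 := by
      filter_upwards [ae_unitInterval_pos_lt_one] with v hv
      have := (travelDistance_spec hq h η hx hv.1 hv.2).1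
      simp only [mem_preimage, mem_Ioi]
      linarith
    exact this

end Model

/-- For a function `f` not known to be measurable, change of variables is only an inequality, but in
the direction needed for lower bounds. -/
theorem lintegral_landingLaw_le (q lam : ℝ) (B : Set ℝ) (p : ℝ → ℝ) (η : Conf PosReal) (x : ℝ)
    (f : PosReal → ℝ≥0∞) :
    ∫⁻ z, f z ∂(landingLaw q lam B p η x)
      ≤ ∫⁻ v, (open scoped Classical in
        if hz : 0 < x + travelDistance q lam B p η x v then f ⟨_, hz⟩ else 0) := by
  classical
  have hemb : MeasurableEmbedding (Subtype.val : PosReal → ℝ) :=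
    MeasurableEmbedding.subtype_coe measurableSet_Ioi
  set g : ℝ → ℝ≥0∞ := fun y => if hy : 0 < y then f ⟨y, hy⟩ else 0 with hg
  have h1 : ∀ z : PosReal, f z = g z := fun z => by simp [hg, z.2]
  calc ∫⁻ z, f z ∂(landingLaw q lam B p η x) = ∫⁻ z, g z ∂(landingLaw q lam B p η x) :=
        lintegral_congr h1
    _ = ∫⁻ y, g y ∂((landingLaw q lam B p η x).map Subtype.val) := (hemb.lintegral_map g).symm
    _ ≤ ∫⁻ y, g y ∂((volume : Measure unitInterval).map
          (fun v => x + travelDistance q lam B p η x v)) := by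
        rw [landingLaw, hemb.map_comap]
        exact lintegral_mono' Measure.restrict_le_self le_rfl
    _ ≤ _ := lintegral_map_le _ _

end

noncomputable section

/-! ### Limits of the jump probabilities of the half-continuous model -/

/-- The lattice locations `j ε` approximate `z`, and they are exact if `z` is a roadblock. -/
def TracksSite (B : Set ℝ) (j : PosReal → ℕ) (z : ℝ) : Prop :=
  Tendsto (fun ε : PosReal => (j ε : ℝ) * ε) downToZero (𝓝 z) ∧
    (z ∈ B → ∀ᶠ ε : PosReal in downToZero, ⌊(ε : ℝ)⁻¹ * z⌋ = (j ε : ℤ))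

theorem TracksSite.eventually_lt {B : Set ℝ} {i j : PosReal → ℕ} {x z : ℝ} (hi : TracksSite B i x)
    (hj : TracksSite B j z) (hxz : x < z) : ∀ᶠ ε in downToZero, i ε < j ε := by
  filter_upwards [hi.1.eventually_lt hj.1 hxz] with ε hε
  exact_mod_cast lt_of_mul_lt_mul_right hε ε.2.le

theorem tracksSite_floor {B : Set ℝ} {z : ℝ} (hz : 0 ≤ z) :
    TracksSite B (fun ε => ⌊(ε : ℝ)⁻¹ * z⌋₊) z := by
  refine ⟨?_, fun _ => Eventually.of_forall fun ε => ?_⟩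
  · have := tendsto_mul_floor_div (l := downToZero) (fun ε : PosReal => ε.2) tendsto_val_downToZero hz
    refine this.congr fun ε => ?_
    rw [mul_comm, div_eq_inv_mul]
  · rw [Int.natCast_floor_eq_floor (mul_nonneg (inv_nonneg.2 ε.2.le) hz)]

theorem mul_le_and_lt_of_floor_eq {ε b : ℝ} {k : ℕ} (hε : 0 < ε) (h : ⌊ε⁻¹ * b⌋ = (k : ℤ)) :
    k * ε ≤ b ∧ b < k * ε + ε := by
  obtain ⟨h1, h2⟩ := Int.floor_eq_iff.1 h
  push_cast at h1 h2
  rw [inv_mul_eq_div] at h1 h2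
  rw [le_div_iff₀ hε] at h1
  rw [div_lt_iff₀ hε] at h2
  constructor <;> linarith

section Limits

variable {q lam : ℝ} {ξ : ℝ → ℝ} {B : Set ℝ} {p : ℝ → ℝ} (h : IsExpModelData lam ξ B p)

include h

theorem roadblocks_isolated {z : ℝ} (hz : 0 ≤ z) : ∃ δ > 0, ∀ b ∈ B, |b - z| < δ → b = z := by
  obtain ⟨δ, hδ, hiso⟩ := obstacles_isolated h (0 : Multiset PosReal) hz
  exact ⟨δ, hδ, fun b hb => hiso b (Or.inl hb)⟩

/-- A roadblock rounding to `j ε` lies within `ε` of `j ε · ε`, hence near `z`, and roadblocks are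
isolated. This settles which roadblock may determine the parameters at `j ε`. -/
theorem TracksSite.eventually_roadblock_eq {j : PosReal → ℕ} {z : ℝ} (hj : TracksSite B j z)
    (hz : 0 ≤ z) :
    ∀ᶠ ε : PosReal in downToZero, ∀ b ∈ B, ⌊(ε : ℝ)⁻¹ * b⌋ = (j ε : ℤ) → b = z := by
  obtain ⟨δ, hδ, hiso⟩ := roadblocks_isolated h hz
  filter_upwards [hj.1.eventually (Ioo_mem_nhds (show z - δ < z by linarith)
    (show z < z + δ / 2 by linarith)), tendsto_val_downToZero.eventually_lt_const
    (show 0 < δ / 2 by linarith)] with ε h1 h2 b hb hfl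
  have := mul_le_and_lt_of_floor_eq ε.2 hfl
  exact hiso b hb (by rw [abs_lt]; constructor <;> linarith [h1.1, h1.2, this.1, this.2])

variable {ξv s : PosReal → ℕ+ → ℝ} (hsc : ∀ ε, IsScaledParameters lam ξ B p ε (ξv ε) (s ε))

include hsc

theorem tendsto_spin_sq {j : PosReal → ℕ+} {z : ℝ} (hz : 0 ≤ z)
    (hj : TracksSite B (fun ε => j ε) z) :
    Tendsto (fun ε => s ε (j ε) ^ 2) downToZero (𝓝 (∏ᶠ b ∈ B ∩ {z}, p b)) := by
  have hev := hj.eventually_roadblock_eq h hz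
  by_cases hzB : z ∈ B
  · have hB : B ∩ {z} = {z} := inter_eq_right.2 (singleton_subset_iff.2 hzB)
    rw [hB, finprod_mem_singleton]
    refine tendsto_const_nhds.congr' ?_
    filter_upwards [hev, hj.2 hzB] with ε h1 h2
    obtain ⟨b, hb, hbj, hs, _⟩ := (hsc ε).roadblock (j ε) ⟨z, hzB, h2⟩
    rw [hs, h1 b hb hbj]
  · have hB : B ∩ {z} = ∅ := by
      ext b; simp only [mem_inter_iff, mem_singleton_iff, mem_empty_iff_false, iff_false]
      rintro ⟨hb, rfl⟩; exact hzB hb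
    rw [hB, finprod_mem_empty]
    have h0 : Tendsto (fun ε : PosReal => Real.exp (-(ε : ℝ) * lam)) downToZero (𝓝 1) := by
      rw [← Real.exp_zero]
      refine (Real.continuous_exp.tendsto _).comp ?_
      simpa using tendsto_val_downToZero.neg.mul_const lam
    refine h0.congr' ?_
    filter_upwards [hev] with ε h1
    refine ((hsc ε).regular (j ε) ?_).1.symm
    rintro ⟨b, hb, hbj⟩
    exact hzB (h1 b hb hbj ▸ hb)

/-- At a roadblock the lattice rate is eventually equal to `ξ z`, so continuity of the speed is
needed only elsewhere. -/
theorem tendsto_speed {j : PosReal → ℕ+} {z : ℝ} (hz : 0 ≤ z)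
    (hj : TracksSite B (fun ε => j ε) z) (hcont : z ∈ B ∨ ContinuousAt ξ z) :
    Tendsto (fun ε => ξv ε (j ε) * (-s ε (j ε))) downToZero (𝓝 (ξ z)) := by
  have hev := hj.eventually_roadblock_eq h hz
  by_cases hzB : z ∈ B
  · refine tendsto_const_nhds.congr' ?_
    filter_upwards [hev, hj.2 hzB] with ε h1 h2
    obtain ⟨b, hb, hbj, _, hs⟩ := (hsc ε).roadblock (j ε) ⟨z, hzB, h2⟩
    rw [← h1 b hb hbj, ← hs]; ring
  · have hc := hcont.resolve_left hzB
    refine (hc.tendsto.comp hj.1).congr' ?_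
    filter_upwards [hev] with ε h1
    have := ((hsc ε).regular (j ε) ?_).2
    · rw [Function.comp, ← this]; ring
    · rintro ⟨b, hb, hbj⟩
      exact hzB (h1 b hb hbj ▸ hb)

/-- Between `i ε` and `j ε` there is eventually exactly one special location per roadblock in `(x,
z)`; the other locations, about `(z - x) / ε` in number, contribute `exp(-ε lam)` each. -/
theorem tendsto_prod_spin_sq {i : PosReal → ℕ} {j : PosReal → ℕ+} {x z : ℝ} (hx : 0 ≤ x)
    (hxz : x < z) (hi : TracksSite B i x) (hj : TracksSite B (fun ε => j ε) z) :
    Tendsto (fun ε => ∏ k ∈ (Finset.Ico 1 (j ε)).filter (fun k : ℕ+ => i ε < (k : ℕ)), s ε k ^ 2)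
      downToZero (𝓝 (Real.exp (-lam * (z - x)) * ∏ᶠ b ∈ B ∩ Ioo x z, p b)) := by
  classical
  have hfin : (B ∩ Ioo x z).Finite :=
    (finite_roadblocks h hx (y := z)).subset (inter_subset_inter_right _ Ioo_subset_Icc_self)
  set β := hfin.toFinset with hβ
  have hmem : ∀ {b}, b ∈ β ↔ b ∈ B ∧ x < b ∧ b < z := by
    intro b; rw [hβ, hfin.mem_toFinset]; rfl
  have hfl : ∀ b ∈ β, TracksSite B (fun ε => ⌊(ε : ℝ)⁻¹ * b⌋₊) b := fun b hb =>
    tracksSite_floor (hx.trans (hmem.1 hb).2.1.le)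
  have e0 : ∀ᶠ ε in downToZero, i ε < j ε := hi.eventually_lt hj hxz
  have e1 : ∀ᶠ ε : PosReal in downToZero, ∀ b ∈ β,
      i ε < ⌊(ε : ℝ)⁻¹ * b⌋₊ ∧ ⌊(ε : ℝ)⁻¹ * b⌋₊ < j ε := by
    rw [eventually_all_finset]
    intro b hb
    exact (hi.eventually_lt (hfl b hb) (hmem.1 hb).2.1).and
      ((hfl b hb).eventually_lt hj (hmem.1 hb).2.2)
  have e2 : ∀ᶠ ε : PosReal in downToZero, ∀ b ∈ β, ∀ b' ∈ β,
      ⌊(ε : ℝ)⁻¹ * b⌋₊ = ⌊(ε : ℝ)⁻¹ * b'⌋₊ → b = b' := by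
    rw [eventually_all_finset]
    intro b hb
    rw [eventually_all_finset]
    intro b' hb'
    rcases lt_trichotomy b b' with hlt | heq | hlt
    · filter_upwards [(hfl b hb).eventually_lt (hfl b' hb') hlt] with ε hε heq
      omega
    · exact Eventually.of_forall fun _ _ => heq
    · filter_upwards [(hfl b' hb').eventually_lt (hfl b hb) hlt] with ε hε heq
      omega
  -- No other roadblock rounds into the open range. For roadblocks at `x` or `z` themselves this
  -- needs the exactness in `TracksSite`.
  have e3 : ∀ᶠ ε : PosReal in downToZero, ∀ b ∈ B, ∀ k : ℕ, ⌊(ε : ℝ)⁻¹ * b⌋ = (k : ℤ) →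
      i ε < k → k < j ε → b ∈ β := by
    obtain ⟨δ, hδ, hiso⟩ := roadblocks_isolated h hx
    obtain ⟨δ', hδ', hiso'⟩ := roadblocks_isolated h (hx.trans hxz.le)
    have a1 : ∀ᶠ ε : PosReal in downToZero, x ∈ B → ⌊(ε : ℝ)⁻¹ * x⌋ = (i ε : ℤ) := by
      by_cases hxB : x ∈ B
      · filter_upwards [hi.2 hxB] with ε hε _ using hε
      · exact Eventually.of_forall fun _ hxB' => absurd hxB' hxB
    have a2 : ∀ᶠ ε : PosReal in downToZero, z ∈ B → ⌊(ε : ℝ)⁻¹ * z⌋ = ((j ε : ℕ) : ℤ) := by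
      by_cases hzB : z ∈ B
      · filter_upwards [hj.2 hzB] with ε hε _ using hε
      · exact Eventually.of_forall fun _ hzB' => absurd hzB' hzB
    filter_upwards [a1, a2, hi.1.eventually (lt_mem_nhds (show x - δ < x by linarith)),
      hj.1.eventually (gt_mem_nhds (show z < z + δ' by linarith))]
      with ε h1 h2 h3 h4 b hb k hk hik hkj
    have hb' := mul_le_and_lt_of_floor_eq ε.2 hk
    have c1 : (i ε : ℝ) * ε ≤ k * ε :=
      mul_le_mul_of_nonneg_right (by exact_mod_cast hik.le) ε.2.le
    have c2 : ((k : ℝ) + 1) * ε ≤ (j ε : ℕ) * ε :=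
      mul_le_mul_of_nonneg_right (by exact_mod_cast hkj) ε.2.le
    refine hmem.2 ⟨hb, ?_, ?_⟩
    · by_contra hcon
      have hbx := hiso b hb (by rw [abs_lt]; constructor <;> linarith)
      subst hbx
      have := h1 hb
      omega
    · by_contra hcon
      have hbz := hiso' b hb (by rw [abs_lt]; constructor <;> linarith)
      subst hbz
      have := h2 hb
      omega
  have key : ∀ᶠ ε : PosReal in downToZero,
      ∏ k ∈ (Finset.Ico 1 (j ε)).filter (fun k : ℕ+ => i ε < (k : ℕ)), s ε k ^ 2
        = Real.exp (-lam * ((j ε : ℕ) * ε - i ε * ε - (1 + β.card) * ε)) * ∏ b ∈ β, p b := by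
    filter_upwards [e0, e1, e2, e3] with ε h0 h1 h2 h3
    set S := (Finset.Ico 1 (j ε)).filter (fun k : ℕ+ => i ε < (k : ℕ)) with hS
    have hSmem : ∀ k : ℕ+, k ∈ S ↔ i ε < k ∧ (k : ℕ) < j ε := by
      intro k
      simp only [hS, Finset.mem_filter, Finset.mem_Ico, one_le, true_and, PNat.coe_lt_coe]
      tauto
    set g : ℝ → ℕ+ := fun b => (⌊(ε : ℝ)⁻¹ * b⌋₊).toPNat' with hg
    have hgc : ∀ b ∈ β, (g b : ℕ) = ⌊(ε : ℝ)⁻¹ * b⌋₊ := fun b hb => by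
      have := (h1 b hb).1
      simp only [hg, Nat.toPNat'_coe]
      rw [if_pos (by omega)]
    have hgf : ∀ b ∈ β, ⌊(ε : ℝ)⁻¹ * b⌋ = ((g b : ℕ) : ℤ) := fun b hb => by
      rw [hgc b hb, Int.natCast_floor_eq_floor]
      exact mul_nonneg (inv_nonneg.2 ε.2.le) (hx.trans (hmem.1 hb).2.1.le)
    have hinj : Set.InjOn g β := fun b hb b' hb' heq =>
      h2 b hb b' hb' (by rw [← hgc b hb, ← hgc b' hb', heq])
    have himg : S.filter (· ∈ scaledRoadblocks ε B) = β.image g := by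
      ext k
      simp only [Finset.mem_filter, hSmem, Finset.mem_image]
      constructor
      · rintro ⟨⟨hk1, hk2⟩, b, hb, hbk⟩
        have hbβ := h3 b hb k hbk hk1 hk2
        refine ⟨b, hbβ, ?_⟩
        have := hgf b hbβ
        rw [hbk] at this
        exact PNat.coe_injective (by exact_mod_cast this.symm)
      · rintro ⟨b, hb, rfl⟩
        refine ⟨?_, b, (hmem.1 hb).1, hgf b hb⟩
        rw [hgc b hb]; exact h1 b hb
    have hcardS : S.card + (1 + i ε) = j ε := by
      obtain ⟨m, hm⟩ := exists_eq_succPNat h0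
      rw [hS, hm, filter_Ico_succPNat, Finset.card_image_of_injective _ (succPNat_add_injective _),
        Finset.card_range, Nat.succPNat_coe]
      omega
    have hcard := Finset.card_filter_add_card_filter_not (s := S) (· ∈ scaledRoadblocks ε B)
    rw [himg, Finset.card_image_of_injOn hinj] at hcard
    rw [← Finset.prod_filter_mul_prod_filter_not S (· ∈ scaledRoadblocks ε B), himg,
      Finset.prod_image hinj, mul_comm]
    congr 1
    · rw [Finset.prod_congr rfl (g := fun _ => Real.exp (-(ε : ℝ) * lam)) fun k hk =>
        ((hsc ε).regular k (Finset.mem_filter.1 hk).2).1, Finset.prod_const, ← Real.exp_nat_mul]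
      congr 1
      have c : ((S.filter (fun k => k ∉ scaledRoadblocks ε B)).card : ℝ)
          = (j ε : ℕ) - i ε - (1 + β.card) := by
        have : (β.card : ℝ) + (S.filter (fun k => k ∉ scaledRoadblocks ε B)).card + (1 + i ε)
            = (j ε : ℕ) := by exact_mod_cast hcard ▸ hcardS
        linarith
      rw [c]; ring
    · refine Finset.prod_congr rfl fun b hb => ?_
      -- The parameters could come from another roadblock `b'` with the same floor, but distinct
      -- roadblocks in `(x, z)` have distinct floors by now.
      obtain ⟨b', hb', hbk, hs, _⟩ := (hsc ε).roadblock (g b) ⟨b, (hmem.1 hb).1, hgf b hb⟩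
      have hgb := (Finset.mem_image_of_mem g hb)
      rw [← himg, Finset.mem_filter, hSmem] at hgb
      have hb'β := h3 b' hb' (g b) hbk hgb.1.1 hgb.1.2
      have : b' = b := hinj hb'β hb (PNat.coe_injective (by
        have := hgf b' hb'β
        rw [hbk] at this
        exact_mod_cast this.symm))
      rw [hs, this]
  rw [finprod_mem_eq_finite_toFinset_prod _ hfin]
  refine (Tendsto.mul_const _ ((Real.continuous_exp.tendsto _).comp
    (Tendsto.const_mul (-lam) ?_))).congr' (key.mono fun ε hε => hε.symm)
  have := (hj.1.sub hi.1).sub (tendsto_val_downToZero.const_mul (1 + (β.card : ℝ)))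
  simpa using this

end Limits
end

/-! ### Limits of the fly-past probabilities in the presence of particles -/

noncomputable section

theorem prod_pow_count {α : Type*} [DecidableEq α] (q : ℝ) (η : Multiset α) (S : Finset α) :
    ∏ k ∈ S, q ^ η.count k = (η.map fun k => if k ∈ S then q else 1).prod := by
  induction η using Multiset.induction_on with
  | empty => simp
  | cons a η ih =>
    simp only [Multiset.count_cons, pow_add, Finset.prod_mul_distrib, Multiset.map_cons,
      Multiset.prod_cons, ih]
    rw [mul_comm]
    congr 1
    simp [Finset.prod_ite_eq', pow_ite]

/-- The lattice locations `φ ε z` of the particles approximate those of the configuration `x`. -/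
def TracksConf (B : Set ℝ) (φ : PosReal → PosReal → ℕ+) (x : Conf PosReal) : Prop :=
  ∀ w ∈ x, TracksSite B (fun ε => φ ε w) w

theorem eventually_prod_map_eq {q : ℝ} {φ : PosReal → PosReal → ℕ+} {x : Conf PosReal}
    {Q : PosReal → ℕ+ → Prop} [∀ ε, DecidablePred (Q ε)] {I : Set ℝ}
    (hQ : ∀ w ∈ x, ∀ᶠ ε in downToZero, (Q ε (φ ε w) ↔ (w : ℝ) ∈ I)) :
    ∀ᶠ ε in downToZero, ((x.map (φ ε)).map fun k => if Q ε k then q else 1).prod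
      = (open scoped Classical in (x.map fun w : PosReal => if (w : ℝ) ∈ I then q else 1).prod) := by
  classical
  have : ∀ᶠ ε in downToZero, ∀ w ∈ x.toFinset, (Q ε (φ ε w) ↔ (w : ℝ) ∈ I) := by
    rw [eventually_all_finset]
    exact fun w hw => hQ w (Multiset.mem_toFinset.1 hw)
  filter_upwards [this] with ε hε
  rw [Multiset.map_map]
  congr 1
  refine Multiset.map_congr rfl fun w hw => ?_
  have := hε w (Multiset.mem_toFinset.2 hw)
  simp only [Function.comp]
  split_ifs <;> tauto

section Limits

variable {q lam : ℝ} {ξ : ℝ → ℝ} {B : Set ℝ} {p : ℝ → ℝ} (h : IsExpModelData lam ξ B p)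
  {ξv s : PosReal → ℕ+ → ℝ} (hsc : ∀ ε, IsScaledParameters lam ξ B p ε (ξv ε) (s ε))
  {φ : PosReal → PosReal → ℕ+} {x : Conf PosReal} (hφ : TracksConf B φ x)

/-- The lattice locations `j ε` approximate `z` and agree with those of the particles at `z`. -/
def TracksWith (B : Set ℝ) (φ : PosReal → PosReal → ℕ+) (x : Conf PosReal) (j : PosReal → ℕ)
    (z : ℝ) : Prop :=
  TracksSite B j z ∧ ∀ w ∈ x, (w : ℝ) = z → ∀ᶠ ε in downToZero, (φ ε w : ℕ) = j ε

include h hsc hφ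

/-- The powers of `q` are eventually constant, as each particle settles on one side of the
endpoints. For a particle exactly at an endpoint, convergence alone would not decide this;
`TracksWith` does. -/
theorem tendsto_flyPastProb {i : PosReal → ℕ} {j : PosReal → ℕ+} {a z : ℝ} (ha : 0 ≤ a)
    (haz : a < z) (hi : TracksWith B φ x i a) (hj : TracksWith B φ x (fun ε => j ε) z) :
    Tendsto (fun ε => flyPastProb q (s ε) (x.map (φ ε)) (i ε) (j ε)) downToZero
      (𝓝 (travelProb q lam B p x a (z - a))) := by
  have h1 := tendsto_prod_spin_sq h hsc ha haz hi.1 hj.1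
  have hQ : ∀ w ∈ x, ∀ᶠ ε in downToZero, (φ ε w ∈ (Finset.Ico 1 (j ε)).filter
      (fun k : ℕ+ => i ε < (k : ℕ)) ↔ (w : ℝ) ∈ Ioo a z) := by
    intro w hw
    have hmem : ∀ ε, φ ε w ∈ (Finset.Ico 1 (j ε)).filter (fun k : ℕ+ => i ε < (k : ℕ))
        ↔ i ε < φ ε w ∧ (φ ε w : ℕ) < j ε := by
      intro ε
      simp only [Finset.mem_filter, Finset.mem_Ico, one_le, true_and, PNat.coe_lt_coe]
      tauto
    simp only [hmem, mem_Ioo]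
    have c1 : ∀ᶠ ε in downToZero, (i ε < φ ε w ↔ a < w) := by
      rcases lt_trichotomy a (w : ℝ) with hlt | heq | hlt
      · filter_upwards [hi.1.eventually_lt (hφ w hw) hlt] with ε hε
        exact iff_of_true hε hlt
      · filter_upwards [hi.2 w hw heq.symm] with ε hε
        exact iff_of_false (by omega) (by rw [heq]; exact lt_irrefl _)
      · filter_upwards [(hφ w hw).eventually_lt hi.1 hlt] with ε hε
        exact iff_of_false (by omega) (not_lt.2 hlt.le)
    have c2 : ∀ᶠ ε in downToZero, ((φ ε w : ℕ) < j ε ↔ (w : ℝ) < z) := by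
      rcases lt_trichotomy (w : ℝ) z with hlt | heq | hlt
      · filter_upwards [(hφ w hw).eventually_lt hj.1 hlt] with ε hε
        exact iff_of_true hε hlt
      · filter_upwards [hj.2 w hw heq] with ε hε
        exact iff_of_false (by omega) (by rw [heq]; exact lt_irrefl _)
      · filter_upwards [hj.1.eventually_lt (hφ w hw) hlt] with ε hε
        exact iff_of_false (by omega) (not_lt.2 hlt.le)
    filter_upwards [c1, c2] with ε h1 h2
    rw [h1, h2]
  have h2 := eventually_prod_map_eq (q := q) hQ
  rw [travelProb_eq, passProb, add_sub_cancel, mul_left_comm, mul_comm]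
  refine (h1.mul_const _).congr' ?_
  filter_upwards [h2] with ε hε
  rw [flyPastProb, Finset.prod_mul_distrib, prod_pow_count, hε]

theorem tendsto_passWeight {j : PosReal → ℕ+} {z : ℝ} (hz : 0 ≤ z)
    (hj : TracksWith B φ x (fun ε => j ε) z) :
    Tendsto (fun ε => passWeight q (s ε) (x.map (φ ε)) (j ε)) downToZero
      (𝓝 (passProb q B p x {z})) := by
  have h1 := tendsto_spin_sq h hsc hz hj.1
  have hQ : ∀ w ∈ x, ∀ᶠ ε in downToZero, (j ε = φ ε w ↔ (w : ℝ) ∈ ({z} : Set ℝ)) := by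
    intro w hw
    rw [mem_singleton_iff]
    rcases lt_trichotomy (w : ℝ) z with hlt | heq | hlt
    · filter_upwards [(hφ w hw).eventually_lt hj.1 hlt] with ε hε
      refine iff_of_false (fun he => ?_) hlt.ne
      rw [he] at hε; omega
    · filter_upwards [hj.2 w hw heq] with ε hε
      exact iff_of_true (PNat.coe_injective hε.symm) heq
    · filter_upwards [hj.1.eventually_lt (hφ w hw) hlt] with ε hε
      refine iff_of_false (fun he => ?_) hlt.ne'
      rw [he] at hε; omega
  have h2 := eventually_prod_map_eq (q := q) hQ
  rw [passProb, mul_comm]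
  refine (h1.mul_const _).congr' ?_
  filter_upwards [h2] with ε hε
  rw [passWeight, ← hε, ← pow_countP_eq_prod_map]
  rfl

theorem tendsto_flyPastProb_succ {i : PosReal → ℕ} {j : PosReal → ℕ+} {a z : ℝ} (ha : 0 ≤ a)
    (haz : a < z) (hi : TracksWith B φ x i a) (hj : TracksWith B φ x (fun ε => j ε) z) :
    Tendsto (fun ε => flyPastProb q (s ε) (x.map (φ ε)) (i ε) (j ε + 1)) downToZero
      (𝓝 (travelProb q lam B p x a (z - a) * passProb q B p x {z})) := by
  refine ((tendsto_flyPastProb h hsc hφ ha haz hi hj).mul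
    (tendsto_passWeight h hsc hφ (ha.trans haz.le) hj)).congr' ?_
  filter_upwards [hi.1.eventually_lt hj.1 haz] with ε hε
  obtain ⟨m, hm⟩ := exists_eq_succPNat hε
  have : j ε + 1 = (i ε + (m + 1)).succPNat := by
    rw [hm]; exact PNat.coe_injective rfl
  rw [this, hm, flyPastProb_succPNat, flyPastProb_succPNat, Finset.prod_range_succ]

end Limits

end

noncomputable section

/-! ### The landing location as a function of a uniform random variable -/

/-- A particle which started at `i` stops at `j` if the uniform random variable has the value
`v`. -/
def StopsAt (q : ℝ) (s : ℕ+ → ℝ) (η : Conf ℕ+) (i : ℕ) (v : ℝ) (j : ℕ+) : Prop :=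
  i < (j : ℕ) ∧ flyPastProb q s η i (j + 1) < v ∧ v ≤ flyPastProb q s η i j

section Stops

variable {q : ℝ} (hq : q ∈ Ioo (0 : ℝ) 1) {s : ℕ+ → ℝ} (hs : ∀ i, s i ∈ Ioo (-1 : ℝ) 0)
  {η : Conf ℕ+} {i : ℕ}

theorem flyPastProb_succ {j : ℕ+} (hij : i < j) :
    flyPastProb q s η i (j + 1) = flyPastProb q s η i j * passWeight q s η j := by
  obtain ⟨m, rfl⟩ := exists_eq_succPNat hij
  have : (i + m).succPNat + 1 = (i + (m + 1)).succPNat := PNat.coe_injective rfl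
  rw [this, flyPastProb_succPNat, flyPastProb_succPNat, Finset.prod_range_succ]

include hq hs

theorem flyPastProb_pos (j : ℕ+) : 0 < flyPastProb q s η i j :=
  Finset.prod_pos fun k _ => passWeight_pos hq hs η k

theorem antitone_flyPastProb : Antitone (flyPastProb q s η i) := by
  intro j j' hjj'
  have hsub : (Finset.Ico 1 j).filter (fun k : ℕ+ => i < (k : ℕ))
      ⊆ (Finset.Ico 1 j').filter (fun k : ℕ+ => i < (k : ℕ)) :=
    Finset.filter_subset_filter _ (Finset.Ico_subset_Ico_right hjj')
  rw [flyPastProb, flyPastProb, ← Finset.prod_sdiff hsub]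
  refine mul_le_of_le_one_left (flyPastProb_pos hq hs j).le ?_
  exact Finset.prod_le_one (fun k _ => (passWeight_pos hq hs η k).le)
    fun k _ => (passWeight_lt_one hq hs η k).le

theorem StopsAt.le {v : ℝ} {j j₁ : ℕ+} (hj : StopsAt q s η i v j)
    (h : v ≤ flyPastProb q s η i j₁) : j₁ ≤ j := by
  by_contra hcon
  have : flyPastProb q s η i j₁ ≤ flyPastProb q s η i (j + 1) :=
    antitone_flyPastProb hq hs (PNat.add_one_le_iff.2 (not_le.1 hcon))
  linarith [hj.2.1]

theorem StopsAt.lt {v : ℝ} {j j₂ : ℕ+} (hj : StopsAt q s η i v j)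
    (h : flyPastProb q s η i j₂ < v) : j < j₂ := by
  by_contra hcon
  have := antitone_flyPastProb hq hs (η := η) (i := i) (not_lt.1 hcon)
  linarith [hj.2.2]

theorem StopsAt.unique {v : ℝ} {j j' : ℕ+} (hj : StopsAt q s η i v j)
    (hj' : StopsAt q s η i v j') : j = j' :=
  le_antisymm (hj'.le hq hs hj.2.2) (hj.le hq hs hj'.2.2)

omit hq hs in
theorem exists_stopsAt {v : ℝ} (hv : v ≤ 1) {j₂ : ℕ+} (h : flyPastProb q s η i j₂ < v) :
    ∃ j, StopsAt q s η i v j := by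
  classical
  have hij : i < j₂ := by
    by_contra hcon
    rw [flyPastProb_eq_one q s η (by omega)] at h
    linarith
  obtain ⟨m, hm⟩ := exists_eq_succPNat hij
  have hex : ∃ m, flyPastProb q s η i (i + m).succPNat < v := ⟨m, hm ▸ h⟩
  have hfind := Nat.find_spec hex
  rcases hm0 : Nat.find hex with _ | m'
  · rw [hm0, flyPastProb_eq_one q s η (by simp)] at hfind
    linarith
  · rw [hm0] at hfind
    have hmin := Nat.find_min hex (m := m') (by omega)
    refine ⟨(i + m').succPNat, ?_, ?_, not_lt.1 hmin⟩
    · rw [Nat.succPNat_coe]; omega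
    · have : (i + m').succPNat + 1 = (i + (m' + 1)).succPNat := PNat.coe_injective rfl
      rw [this]; exact hfind

omit hq hs in
theorem measurableSet_stopsAt (j : ℕ+) :
    MeasurableSet {v : unitInterval | StopsAt q s η i v j} := by
  have hm : Measurable fun v : unitInterval => (v : ℝ) := measurable_subtype_coe
  exact (MeasurableSet.const _).inter ((measurableSet_lt measurable_const hm).inter
    (measurableSet_le hm measurable_const))

omit hq hs in
-- The values `v` for which the particle stops at `j` lie in an interval whose length is the jump
-- probability. The escape term is dropped, which is allowed in a lower bound.
theorem lintegral_stopsAt_le (f : Conf ℕ+ → ℝ≥0∞) (rest : Conf ℕ+) :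
    ∫⁻ v : unitInterval, ∑' j, {v : unitInterval | StopsAt q s η i v j}.indicator
      (fun _ => f (j ::ₘ rest)) v ≤ hcJump q s f η rest i := by
  rw [lintegral_tsum fun j => (measurable_const.indicator (measurableSet_stopsAt j)).aemeasurable]
  refine le_trans (ENNReal.tsum_le_tsum fun j => ?_) le_self_add
  rw [lintegral_indicator_const (measurableSet_stopsAt j), mul_comm]
  by_cases hij : i < (j : ℕ)
  · rw [if_pos hij]
    gcongr
    rw [unitInterval.volume_apply]
    refine (measure_mono (t := Ioc (flyPastProb q s η i (j + 1)) (flyPastProb q s η i j)) ?_).trans ?_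
    · rintro _ ⟨v, hv, rfl⟩
      exact ⟨hv.2.1, hv.2.2⟩
    · rw [Real.volume_Ioc, flyPastProb_succ hij, passWeight, mul_one_sub]
  · have : {v : unitInterval | StopsAt q s η i v j} = ∅ := by
      ext v
      simp [StopsAt, hij]
    simp [this]

/-- The location at which a particle stops. -/
def stopSite (q : ℝ) (s : ℕ+ → ℝ) (η : Conf ℕ+) (i : ℕ) (v : ℝ) : ℕ+ :=
  open scoped Classical in if h : ∃ j, StopsAt q s η i v j then h.choose else 1

omit hq hs in
theorem stopsAt_stopSite {v : ℝ} (h : ∃ j, StopsAt q s η i v j) :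
    StopsAt q s η i v (stopSite q s η i v) := by
  rw [stopSite, dif_pos h]
  exact h.choose_spec

omit hq hs in
theorem le_tsum_stopsAt {f : Conf ℕ+ → ℝ≥0∞} {rest : Conf ℕ+} {v : unitInterval} {j : ℕ+}
    (h : StopsAt q s η i v j) :
    f (j ::ₘ rest) ≤ ∑' j, {v : unitInterval | StopsAt q s η i v j}.indicator
      (fun _ => f (j ::ₘ rest)) v := by
  refine le_trans ?_ (ENNReal.le_tsum j)
  rw [indicator_of_mem (show v ∈ {v : unitInterval | StopsAt q s η i v j} from h)]

end Stops

/-! ### Convergence of the landing locations -/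

/-- The lattice configurations `η ε` converge to `y`, so that particles at the same location of `y`
are at the same location in `η ε`, particles at roadblocks are at roadblocks, and the speed is
continuous at all other particles. -/
def ConfLimit (ξ : ℝ → ℝ) (B : Set ℝ) (η : PosReal → Conf ℕ+) (y : Conf PosReal) : Prop :=
  ∃ φ : PosReal → PosReal → ℕ+, (∀ᶠ ε in downToZero, η ε = y.map (φ ε)) ∧ TracksConf B φ y ∧
    ∀ w ∈ y, (w : ℝ) ∈ B ∨ ContinuousAt ξ w

theorem TracksSite.congr {B : Set ℝ} {i j : PosReal → ℕ} {z : ℝ} (hi : TracksSite B i z)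
    (hij : ∀ᶠ ε in downToZero, i ε = j ε) : TracksSite B j z := by
  refine ⟨hi.1.congr' ?_, fun hz => ?_⟩
  · filter_upwards [hij] with ε hε
    rw [hε]
  · filter_upwards [hij, hi.2 hz] with ε hε h
    rw [h, hε]

theorem tracksSite_toPNat {B : Set ℝ} {z : ℝ} (hz : 0 < z) :
    TracksSite B (fun ε => ((⌊(ε : ℝ)⁻¹ * z⌋₊).toPNat' : ℕ)) z := by
  have h0 : TracksSite B (fun _ => 0) 0 :=
    (tracksSite_floor (B := B) le_rfl).congr (Eventually.of_forall fun ε => by simp)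
  have h1 := tracksSite_floor (B := B) hz.le
  refine h1.congr ?_
  filter_upwards [h0.eventually_lt h1 hz] with ε hε
  rw [Nat.toPNat'_coe, if_pos hε]

theorem tracksWith_toPNat {B : Set ℝ} {φ : PosReal → PosReal → ℕ+} {x : Conf PosReal} {z : ℝ}
    (hz : 0 < z) (hx : ∀ w ∈ x, (w : ℝ) ≠ z) :
    TracksWith B φ x (fun ε => ((⌊(ε : ℝ)⁻¹ * z⌋₊).toPNat' : ℕ)) z :=
  ⟨tracksSite_toPNat hz, fun w hw hwz => absurd hwz (hx w hw)⟩

theorem exists_tracksWith {B : Set ℝ} {φ : PosReal → PosReal → ℕ+} {x : Conf PosReal}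
    (hφ : TracksConf B φ x) {z : ℝ} (hz : 0 < z) :
    ∃ j : PosReal → ℕ+, TracksWith B φ x (fun ε => j ε) z := by
  by_cases hx : ∃ w ∈ x, (w : ℝ) = z
  · obtain ⟨w, hw, rfl⟩ := hx
    refine ⟨fun ε => φ ε w, hφ w hw, fun w' _ hw' => Eventually.of_forall fun ε => ?_⟩
    rw [Subtype.ext hw']
  · push Not at hx
    exact ⟨fun ε => (⌊(ε : ℝ)⁻¹ * z⌋₊).toPNat', tracksWith_toPNat hz hx⟩

theorem IsExpModelData.exists_countable_discontinuities {lam : ℝ} {ξ : ℝ → ℝ} {B : Set ℝ}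
    {p : ℝ → ℝ} (h : IsExpModelData lam ξ B p) :
    ∃ D : Set ℝ, D.Countable ∧ ∀ x, 0 < x → x ∉ D → ContinuousAt ξ x := by
  obtain ⟨D, hD, hc⟩ := h.speed_piecewise
  refine ⟨D ∩ Ici 0, countable_inter_Ici_of_not_accPt hD, fun x hx hxD => ?_⟩
  exact (hc x hx.le fun hx' => hxD ⟨hx', hx.le⟩).continuousAt (Ici_mem_nhds hx)

theorem countable_obstacles {lam : ℝ} {ξ : ℝ → ℝ} {B : Set ℝ} {p : ℝ → ℝ}
    (h : IsExpModelData lam ξ B p) (x : Conf PosReal) : (obstacles B x).Countable := by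
  have h1 : B.Countable := (countable_inter_Ici_of_not_accPt h.roadblock_discrete).mono
    (subset_inter Subset.rfl fun b hb => (h.roadblock_pos b hb).le)
  have h2 : {y : ℝ | ∃ z ∈ x, (z : ℝ) = y}.Countable := by
    refine ((x.toFinset.image fun z : PosReal => (z : ℝ)).finite_toSet.subset ?_).countable
    rintro y ⟨z, hz, rfl⟩
    simp only [Finset.coe_image, mem_image, Finset.mem_coe, Multiset.mem_toFinset]
    exact ⟨z, hz, rfl⟩
  exact h1.union h2

theorem ae_unitInterval_notMem {S : Set ℝ} (hS : S.Countable) :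
    ∀ᵐ v : unitInterval, (v : ℝ) ∉ S := by
  have : (Subtype.val ⁻¹' S : Set unitInterval).Countable :=
    hS.preimage_of_injOn Subtype.val_injective.injOn
  exact compl_mem_ae_iff.2 (this.measure_zero _)

section Landing

variable {q lam : ℝ} (hq : q ∈ Ioo (0 : ℝ) 1) {ξ : ℝ → ℝ} {B : Set ℝ} {p : ℝ → ℝ}
  (h : IsExpModelData lam ξ B p)
  {ξv s : PosReal → ℕ+ → ℝ} (hsc : ∀ ε, IsScaledParameters lam ξ B p ε (ξv ε) (s ε))
  {φ : PosReal → PosReal → ℕ+} {x : Conf PosReal} (hφ : TracksConf B φ x)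
  {i : PosReal → ℕ} {a : ℝ} (ha : 0 ≤ a) (hi : TracksWith B φ x i a)

include hq h hsc hφ ha hi

/-- The stopping locations of lattice particles converge to that of the limit. -/
theorem tracksWith_stopSite {v : unitInterval} (hv0 : 0 < (v : ℝ)) (hv1 : (v : ℝ) < 1) {z : ℝ}
    (hz : z = a + travelDistance q lam B p x a v)
    (hgood : z ∈ obstacles B x → (v : ℝ) ≠ travelProb q lam B p x a (z - a)
      ∧ (v : ℝ) ≠ travelProb q lam B p x a (z - a) * passProb q B p x {z}) :
    (∀ᶠ ε in downToZero, StopsAt q (s ε) (x.map (φ ε)) (i ε) v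
        (stopSite q (s ε) (x.map (φ ε)) (i ε) v)) ∧
      TracksWith B φ x (fun ε => (stopSite q (s ε) (x.map (φ ε)) (i ε) v : ℕ)) z := by
  obtain ⟨hd, hlt, hgt⟩ := travelDistance_spec hq h x ha hv0 hv1
  have haz : a < z := by linarith
  obtain ⟨δ, hδ, hiso⟩ := obstacles_isolated h x (ha.trans haz.le)
  -- Near `z` but off it there are no obstacles, so the rounded location of `y` tracks `y` and the
  -- fly-past probabilities converge there.
  have hfree : ∀ y, 0 < y → y ≠ z → |y - z| < δ →
      TracksWith B φ x (fun ε => ((⌊(ε : ℝ)⁻¹ * y⌋₊).toPNat' : ℕ)) y := fun y hy hyz hyδ =>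
    tracksWith_toPNat hy fun w hw hwy => hyz (hiso y (Or.inr ⟨w, hw, hwy⟩) hyδ)
  have hright : ∀ y, z < y → y < z + δ → ∀ᶠ ε : PosReal in downToZero,
      flyPastProb q (s ε) (x.map (φ ε)) (i ε) (⌊(ε : ℝ)⁻¹ * y⌋₊).toPNat' < v := by
    intro y hzy hy
    exact (tendsto_flyPastProb h hsc hφ ha (haz.trans hzy) hi (hfree y (by linarith) hzy.ne'
      (by rw [abs_lt]; constructor <;> linarith))).eventually_lt_const (hgt _ (by linarith))
  have hleft : ∀ y, a < y → z - δ < y → y < z → ∀ᶠ ε : PosReal in downToZero,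
      (v : ℝ) < flyPastProb q (s ε) (x.map (φ ε)) (i ε) (⌊(ε : ℝ)⁻¹ * y⌋₊).toPNat' := by
    intro y hay hy hyz
    exact (tendsto_flyPastProb h hsc hφ ha hay hi (hfree y (by linarith) hyz.ne
      (by rw [abs_lt]; constructor <;> linarith))).eventually_const_lt
      (hlt _ (by linarith) (by linarith))
  have hland : ∀ᶠ ε in downToZero, StopsAt q (s ε) (x.map (φ ε)) (i ε) v
      (stopSite q (s ε) (x.map (φ ε)) (i ε) v) := by
    filter_upwards [hright (z + δ / 2) (by linarith) (by linarith)] with ε hε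
    exact stopsAt_stopSite (exists_stopsAt hv1.le hε)
  -- At an obstacle, `v` is strictly inside the atom. Both ends of the lattice stopping interval at
  -- `j ε` converge to the ends of the atom, so the particle eventually stops exactly there.
  have hexact : z ∈ obstacles B x → ∀ j : PosReal → ℕ+, TracksWith B φ x (fun ε => j ε) z →
      ∀ᶠ ε in downToZero, stopSite q (s ε) (x.map (φ ε)) (i ε) v = j ε := by
    intro hzo j hj
    have hmem := le_travelProb_travelDistance hq h x ha hv0 hv1 hz
    have c1 := (tendsto_flyPastProb h hsc hφ ha haz hi hj).eventually_const_lt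
      (lt_of_le_of_ne hmem.2 (hgood hzo).1)
    have c2 := (tendsto_flyPastProb_succ h hsc hφ ha haz hi hj).eventually_lt_const
      (lt_of_le_of_ne hmem.1 (hgood hzo).2.symm)
    filter_upwards [hland, c1, c2, hi.1.eventually_lt hj.1 haz] with ε h1 h2 h3 h4
    exact h1.unique hq (hsc ε).spin ⟨h4, h3, h2.le⟩
  refine ⟨hland, ⟨?_, fun hzB => ?_⟩, fun w hw hwz => ?_⟩
  · rw [tendsto_order]
    constructor
    · intro c hc
      obtain ⟨y, hy1, hy2⟩ := exists_between (show max c (max a (z - δ)) < z from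
        max_lt hc (max_lt haz (by linarith)))
      have hcy : c < y := (le_max_left _ _).trans_lt hy1
      have hay : a < y := ((le_max_left _ _).trans (le_max_right _ _)).trans_lt hy1
      have hδy : z - δ < y := ((le_max_right _ _).trans (le_max_right _ _)).trans_lt hy1
      filter_upwards [hland, hleft y hay hδy hy2,
        (tracksSite_toPNat (B := B) (ha.trans_lt hay)).1.eventually_const_lt hcy] with ε h1 h2 h3
      have := h1.le hq (hsc ε).spin h2.le
      refine h3.trans_le (mul_le_mul_of_nonneg_right ?_ ε.2.le)
      exact_mod_cast this
    · intro c hc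
      obtain ⟨y, hy1, hy2⟩ := exists_between (show z < min c (z + δ) from
        lt_min hc (by linarith))
      have hcy : y < c := hy2.trans_le (min_le_left _ _)
      have hδy : y < z + δ := hy2.trans_le (min_le_right _ _)
      filter_upwards [hland, hright y hy1 hδy,
        (tracksSite_toPNat (B := B) ((ha.trans_lt haz).trans hy1)).1.eventually_lt_const hcy]
        with ε h1 h2 h3
      have := h1.lt hq (hsc ε).spin h2
      refine lt_of_le_of_lt (mul_le_mul_of_nonneg_right ?_ ε.2.le) h3
      exact_mod_cast this.le
  · obtain ⟨j, hj⟩ := exists_tracksWith hφ (ha.trans_lt haz)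
    filter_upwards [hj.1.2 hzB, hexact (Or.inl hzB) j hj] with ε h1 h2
    rw [h1, h2]
  · have hj : TracksWith B φ x (fun ε => φ ε w) z := by
      refine ⟨hwz ▸ hφ w hw, fun w' _ hw' => Eventually.of_forall fun ε => ?_⟩
      rw [Subtype.ext (hw'.trans hwz.symm)]
    filter_upwards [hexact (Or.inr ⟨w, hw, hwz⟩) _ hj] with ε h1
    rw [h1]

/-- The same `v` drives both jumps. Outside a countable set of `v` the new configurations again
satisfy `ConfLimit`, and Fatou's lemma in `v` applies. -/
theorem lintegral_landingLaw_le_liminf (hcont : ∀ w ∈ x, (w : ℝ) ∈ B ∨ ContinuousAt ξ w)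
    {x' : Conf PosReal} (hx' : x' ≤ x) {F : PosReal → Conf ℕ+ → ℝ≥0∞}
    {F' : Conf PosReal → ℝ≥0∞}
    (hF : ∀ η y, ConfLimit ξ B η y → F' y ≤ liminf (fun ε => F ε (η ε)) downToZero) :
    ∫⁻ z, F' (z ::ₘ x') ∂(landingLaw q lam B p x a)
      ≤ liminf (fun ε => hcJump q (s ε) (F ε) (x.map (φ ε)) (x'.map (φ ε)) (i ε)) downToZero := by
  classical
  refine (lintegral_landingLaw_le q lam B p x a _).trans ?_
  refine le_trans ?_ (liminf_le_liminf (Eventually.of_forall fun ε =>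
    lintegral_stopsAt_le (η := x.map (φ ε)) (i := i ε) (F ε) (x'.map (φ ε))))
  refine lintegral_le_liminf_lintegral (fun ε => ?_) ?_
  · exact Measurable.tsum fun j => measurable_const.indicator (measurableSet_stopsAt j)
  obtain ⟨D, hD, hDcont⟩ := h.exists_countable_discontinuities
  set S : Set ℝ := obstacles B x ∪ D with hS
  have hSc : S.Countable := (countable_obstacles h x).union hD
  filter_upwards [ae_unitInterval_pos_lt_one,
    ae_unitInterval_notMem (hSc.image fun z => travelProb q lam B p x a (z - a)),
    ae_unitInterval_notMem
      (hSc.image fun z => travelProb q lam B p x a (z - a) * passProb q B p x {z})]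
    with v hv hv1 hv2
  split_ifs with hz0
  swap
  · exact zero_le
  set z : PosReal := ⟨_, hz0⟩ with hz
  have hzv : (z : ℝ) = a + travelDistance q lam B p x a v := rfl
  have hzS : ∀ y ∈ S, (v : ℝ) ≠ travelProb q lam B p x a (y - a)
      ∧ (v : ℝ) ≠ travelProb q lam B p x a (y - a) * passProb q B p x {y} := fun y hy =>
    ⟨fun he => hv1 ⟨y, hy, he.symm⟩, fun he => hv2 ⟨y, hy, he.symm⟩⟩
  obtain ⟨hland, htr⟩ := tracksWith_stopSite hq h hsc hφ ha hi hv.1 hv.2 hzv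
    fun hzo => hzS z (Or.inl hzo)
  set J : PosReal → ℕ+ := fun ε => stopSite q (s ε) (x.map (φ ε)) (i ε) v with hJ
  have hzcont : (z : ℝ) ∈ B ∨ ContinuousAt ξ z := by
    by_cases hzo : (z : ℝ) ∈ obstacles B x
    · rcases hzo with hzB | ⟨w, hw, hwz⟩
      · exact Or.inl hzB
      · rw [← hwz]; exact hcont w hw
    -- Away from obstacles `v` equals the travel probability at `z`, so landing on a discontinuity
    -- of the speed happens only for countably many `v`.
    · refine Or.inr (hDcont z z.2 fun hzD => ?_)
      have hmem := le_travelProb_travelDistance hq h x ha hv.1 hv.2 hzv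
      rw [passProb_congr x (J := ∅), passProb_empty, mul_one, Icc_self] at hmem
      · exact (hzS z (Or.inr hzD)).1 hmem
      · intro y hy
        refine ⟨fun hyz => ?_, fun hy' => absurd hy' (notMem_empty y)⟩
        rw [mem_singleton_iff] at hyz
        exact absurd (hyz ▸ hy) hzo
  have hlim : ConfLimit ξ B (fun ε => J ε ::ₘ x'.map (φ ε)) (z ::ₘ x') := by
    -- If particles already sit at `z`, the new lattice location eventually agrees with theirs, so
    -- redefining `φ ε` at `z` leaves the rest unchanged.
    refine ⟨fun ε => Function.update (φ ε) z (J ε), ?_, fun w hw => ?_, fun w hw => ?_⟩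
    · have hev : ∀ᶠ ε in downToZero, z ∈ x → φ ε z = J ε := by
        by_cases hzx : z ∈ x
        · filter_upwards [htr.2 z hzx rfl] with ε hε _
          exact PNat.coe_injective hε
        · exact Eventually.of_forall fun _ hzx' => absurd hzx' hzx
      filter_upwards [hev] with ε hε
      rw [Multiset.map_cons, Function.update_self]
      congr 1
      refine Multiset.map_congr rfl fun w hw => ?_
      by_cases hwz : w = z
      · subst hwz
        rw [Function.update_self, hε (Multiset.mem_of_le hx' hw)]
      · rw [Function.update_of_ne hwz]
    · by_cases hwz : w = z
      · subst hwz
        simp only [Function.update_self]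
        exact htr.1
      · simp only [Function.update_of_ne hwz]
        exact hφ w (Multiset.mem_of_le hx' ((Multiset.mem_cons.1 hw).resolve_left hwz))
    · rcases Multiset.mem_cons.1 hw with rfl | hw
      · exact hzcont
      · exact hcont w (Multiset.mem_of_le hx' hw)
  refine (hF _ _ hlim).trans (liminf_le_liminf ?_)
  filter_upwards [hland] with ε hε
  exact le_tsum_stopsAt hε

end Landing
end

noncomputable section

/-! ### Convergence of the half-continuous model -/

theorem TracksConf.eventually_injOn {B : Set ℝ} {φ : PosReal → PosReal → ℕ+} {x : Conf PosReal}
    (hφ : TracksConf B φ x) : ∀ᶠ ε in downToZero, Set.InjOn (φ ε) {w | w ∈ x} := by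
  have : ∀ᶠ ε in downToZero, ∀ w ∈ x.toFinset, ∀ w' ∈ x.toFinset, φ ε w = φ ε w' → w = w' := by
    rw [eventually_all_finset]
    intro w hw
    rw [eventually_all_finset]
    intro w' hw'
    rw [Multiset.mem_toFinset] at hw hw'
    rcases lt_trichotomy w w' with hlt | heq | hlt
    · filter_upwards [(hφ w hw).eventually_lt (hφ w' hw') hlt] with ε hε he
      exact absurd (he ▸ hε) (lt_irrefl _)
    · exact Eventually.of_forall fun _ _ => heq
    · filter_upwards [(hφ w' hw').eventually_lt (hφ w hw) hlt] with ε hε he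
      exact absurd (he ▸ hε) (lt_irrefl _)
  filter_upwards [this] with ε hε w hw w' hw'
  exact hε w (Multiset.mem_toFinset.2 hw) w' (Multiset.mem_toFinset.2 hw')

theorem TracksConf.tracksWith {B : Set ℝ} {φ : PosReal → PosReal → ℕ+} {x : Conf PosReal}
    (hφ : TracksConf B φ x) {w : PosReal} (hw : w ∈ x) :
    TracksWith B φ x (fun ε => φ ε w) w :=
  ⟨hφ w hw, fun w' _ hw' => Eventually.of_forall fun ε => by rw [Subtype.ext hw']⟩

/-- Injectivity on the particles preserves multiplicities and makes `erase` commute with `map`. -/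
theorem hcIntensity_map {q ξ₀ : ℝ} {ξv s : ℕ+ → ℝ} {φ : PosReal → ℕ+} {x : Conf PosReal}
    (hφ : Set.InjOn φ {w | w ∈ x}) (F : Conf ℕ+ → ℝ≥0∞) :
    hcIntensity q ξ₀ ξv s F (x.map φ) = ENNReal.ofReal ξ₀ * hcJump q s F (x.map φ) (x.map φ) 0
      + ∑ w ∈ x.toFinset, ENNReal.ofReal (ξv (φ w) * (-s (φ w)) * (1 - q ^ x.count w))
        * hcJump q s F (x.map φ) ((x.erase w).map φ) (φ w) := by
  rw [hcIntensity, Multiset.toFinset_map, Finset.sum_image]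
  · congr 1
    refine Finset.sum_congr rfl fun w hw => ?_
    have hw := Multiset.mem_toFinset.1 hw
    rw [Multiset.count_map_eq_count φ x hφ w hw, Multiset.map_erase_of_mem φ x hw]
  · intro w hw w' hw'
    exact hφ (Multiset.mem_toFinset.1 hw) (Multiset.mem_toFinset.1 hw')

theorem totalRate_map {q ξ₀ : ℝ} {ξv s : ℕ+ → ℝ} {φ : PosReal → ℕ+} {x : Conf PosReal}
    (hφ : Set.InjOn φ {w | w ∈ x}) :
    totalRate q ξ₀ ξv s (x.map φ) = ξ₀
      + ∑ w ∈ x.toFinset, ξv (φ w) * (-s (φ w)) * (1 - q ^ x.count w) := by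
  rw [totalRate, Multiset.toFinset_map, Finset.sum_image]
  · congr 1
    refine Finset.sum_congr rfl fun w hw => ?_
    rw [Multiset.count_map_eq_count φ x hφ w (Multiset.mem_toFinset.1 hw)]
  · intro w hw w' hw'
    exact hφ (Multiset.mem_toFinset.1 hw) (Multiset.mem_toFinset.1 hw')

section Data

variable {q lam : ℝ} {ξ : ℝ → ℝ} {B : Set ℝ} {p : ℝ → ℝ}
  (h : IsExpModelData lam ξ B p)

include h

theorem IsExpModelData.speed_pos {x : ℝ} (hx : 0 ≤ x) : 0 < ξ x := by
  obtain ⟨c, C, hc, hb⟩ := h.speed_bounds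
  exact hc.trans_le (hb x hx).1

theorem tracksWith_zero (φ : PosReal → PosReal → ℕ+) (x : Conf PosReal) :
    TracksWith B φ x (fun _ => 0) 0 :=
  ⟨⟨by simp, fun h0 => absurd (h.roadblock_pos 0 h0) (lt_irrefl _)⟩,
    fun w _ hw => absurd hw w.2.ne'⟩

theorem IsScaledParameters.admissible {ε : PosReal} {ξv s : ℕ+ → ℝ}
    (hsc : IsScaledParameters lam ξ B p ε ξv s) : AdmissibleVertexParameters ξv s := by
  obtain ⟨c, C, hc, hb⟩ := h.speed_bounds
  refine ⟨hsc.pos, hsc.spin, C, fun i => ?_⟩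
  by_cases hi : i ∈ scaledRoadblocks ε B
  · obtain ⟨b, hbB, _, _, hs⟩ := hsc.roadblock i hi
    rw [hs]
    exact (hb b (h.roadblock_pos b hbB).le).2
  · rw [(hsc.regular i hi).2]
    exact (hb _ (mul_nonneg (Nat.cast_nonneg _) ε.2.le)).2

variable (hq : q ∈ Ioo (0 : ℝ) 1)

include hq

theorem toReal_expIntensity_one (x : Conf PosReal) :
    (expIntensity q lam ξ B p 1 x).toReal
      = ξ 0 + ∑ w ∈ x.toFinset, ξ w * (1 - q ^ x.count w) := by
  have hn : ∀ w ∈ x.toFinset, 0 ≤ ξ w * (1 - q ^ x.count w) := fun w _ =>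
    mul_nonneg (h.speed_pos w.2.le).le (one_sub_pow_mem hq _).1
  have h1 : expIntensity q lam ξ B p 1 x
      = ENNReal.ofReal (ξ 0 + ∑ w ∈ x.toFinset, ξ w * (1 - q ^ x.count w)) := by
    rw [expIntensity, ENNReal.ofReal_add (h.speed_pos le_rfl).le (Finset.sum_nonneg hn),
      ENNReal.ofReal_sum_of_nonneg hn]
    simp only [Pi.one_apply, lintegral_one, landingLaw_univ hq h x le_rfl, mul_one]
    congr 1
    refine Finset.sum_congr rfl fun w _ => ?_
    rw [landingLaw_univ hq h x w.2.le, mul_one]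
  rw [h1, ENNReal.toReal_ofReal (add_nonneg (h.speed_pos le_rfl).le (Finset.sum_nonneg hn))]

variable {ξv s : PosReal → ℕ+ → ℝ} (hsc : ∀ ε, IsScaledParameters lam ξ B p ε (ξv ε) (s ε))

include hsc

theorem expIntensity_le_liminf {F : PosReal → Conf ℕ+ → ℝ≥0∞} {F' : Conf PosReal → ℝ≥0∞}
    (hF : ∀ η y, ConfLimit ξ B η y → F' y ≤ liminf (fun ε => F ε (η ε)) downToZero)
    {η : PosReal → Conf ℕ+} {x : Conf PosReal} (hx : ConfLimit ξ B η x) :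
    expIntensity q lam ξ B p F' x
      ≤ liminf (fun ε => hcIntensity q (ξ 0) (ξv ε) (s ε) (F ε) (η ε)) downToZero := by
  obtain ⟨φ, hη, hφ, hcont⟩ := hx
  have hev : ∀ᶠ ε in downToZero, hcIntensity q (ξ 0) (ξv ε) (s ε) (F ε) (η ε)
      = ENNReal.ofReal (ξ 0) * hcJump q (s ε) (F ε) (x.map (φ ε)) (x.map (φ ε)) 0
      + ∑ w ∈ x.toFinset,
        ENNReal.ofReal (ξv ε (φ ε w) * (-s ε (φ ε w)) * (1 - q ^ x.count w))
          * hcJump q (s ε) (F ε) (x.map (φ ε)) ((x.erase w).map (φ ε)) (φ ε w) := by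
    filter_upwards [hη, hφ.eventually_injOn] with ε h1 h2
    rw [h1, hcIntensity_map h2]
  rw [liminf_congr hev, expIntensity]
  refine le_liminf_add_of_le (le_liminf_mul_of_tendsto tendsto_const_nhds ?_)
    (sum_le_liminf_sum fun w hw => ?_)
  · exact lintegral_landingLaw_le_liminf hq h hsc hφ le_rfl (tracksWith_zero h φ x) hcont le_rfl hF
  · have hw := Multiset.mem_toFinset.1 hw
    refine le_liminf_mul_of_tendsto (ENNReal.tendsto_ofReal
      ((tendsto_speed h hsc w.2.le (hφ w hw) (hcont w hw)).mul_const _)) ?_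
    exact lintegral_landingLaw_le_liminf hq h hsc hφ w.2.le (hφ.tracksWith hw) hcont
      (Multiset.erase_le w x) hF

/-- A lower bound would not suffice here: the total rate enters the waiting time with a negative
sign. -/
theorem tendsto_toReal_hcIntensity_one {η : PosReal → Conf ℕ+} {x : Conf PosReal}
    (hx : ConfLimit ξ B η x) :
    Tendsto (fun ε => (hcIntensity q (ξ 0) (ξv ε) (s ε) 1 (η ε)).toReal) downToZero
      (𝓝 (expIntensity q lam ξ B p 1 x).toReal) := by
  obtain ⟨φ, hη, hφ, hcont⟩ := hx
  rw [toReal_expIntensity_one h hq]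
  have hlim : Tendsto (fun ε => ξ 0 + ∑ w ∈ x.toFinset,
      ξv ε (φ ε w) * (-s ε (φ ε w)) * (1 - q ^ x.count w)) downToZero
      (𝓝 (ξ 0 + ∑ w ∈ x.toFinset, ξ w * (1 - q ^ x.count w))) := by
    refine tendsto_const_nhds.add (tendsto_finsetSum _ fun w hw => ?_)
    have hw := Multiset.mem_toFinset.1 hw
    exact (tendsto_speed h hsc w.2.le (hφ w hw) (hcont w hw)).mul_const _
  refine hlim.congr' ?_
  filter_upwards [hη, hφ.eventually_injOn] with ε h1 h2
  rw [toReal_hcIntensity_one hq (hsc ε).spin (h.speed_pos le_rfl) (hsc ε).pos, h1,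
    totalRate_map h2]

/-- Fatou's lemma in the time of the first jump, by induction on the number of jumps. Only the
integrands of the lattice model must be measurable, which its countable state space provides. -/
theorem jumpOpUpTo_le_liminf_hc {F : PosReal → Conf ℕ+ → ℝ≥0∞} {F' : Conf PosReal → ℝ≥0∞}
    (hF : ∀ η y, ConfLimit ξ B η y → F' y ≤ liminf (fun ε => F ε (η ε)) downToZero)
    (n : ℕ) (t : ℝ) {η : PosReal → Conf ℕ+} {x : Conf PosReal} (hx : ConfLimit ξ B η x) :
    jumpOpUpTo (expIntensity q lam ξ B p) n t F' x
      ≤ liminf (fun ε => jumpOpUpTo (hcIntensity q (ξ 0) (ξv ε) (s ε)) n t (F ε) (η ε))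
        downToZero := by
  induction n generalizing t η x with
  | zero => exact zero_le
  | succ n ih =>
    simp only [jumpOpUpTo_succ]
    have hexp : ∀ r : ℝ, Tendsto (fun ε => ENNReal.ofReal (Real.exp
        (-(hcIntensity q (ξ 0) (ξv ε) (s ε) 1 (η ε)).toReal * r))) downToZero
        (𝓝 (ENNReal.ofReal (Real.exp (-(expIntensity q lam ξ B p 1 x).toReal * r)))) := fun r =>
      ENNReal.tendsto_ofReal ((Real.continuous_exp.tendsto _).comp
        ((tendsto_toReal_hcIntensity_one h hq hsc hx).neg.mul_const r))
    refine le_liminf_add_of_le (le_liminf_mul_of_tendsto (hexp t) (hF η x hx))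
      (lintegral_le_liminf_lintegral (fun ε => ?_) (Eventually.of_forall fun r => ?_))
    · exact measurable_jump_integrand (isSumFunctional_hcIntensity q (ξ 0) (ξv ε) (s ε)) n t _ _
    · exact le_liminf_mul_of_tendsto (hexp r) (expIntensity_le_liminf h hq hsc
        (fun η' y hy => ih (t - r) hy) hx)

theorem fddExpectation_exp_le_liminf {k : ℕ} (t : Fin k → ℝ≥0)
    {F : (Fin k → Conf PosReal) → ℝ≥0∞} (hF : Continuous F) :
    fddExpectation (jumpTransition (expIntensity q lam ξ B p)) k 0 t F 0
      ≤ liminf (fun ε => fddExpectation (jumpTransition (hcIntensity q (ξ 0) (ξv ε) (s ε))) k 0 t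
        (fun z => F fun i => (z i).map (scaleSite ε)) 0) downToZero := by
  refine fddExpectation_le_liminf (C := ConfLimit ξ B) (D := fun τ r => τ = fun _ => r)
    (P := fun ε => jumpTransition (hcIntensity q (ξ 0) (ξv ε) (s ε))) ?_ k (fun _ => 0) 0
    (fun _ => t) t (fun _ _ => rfl) (fun _ _ _ => rfl)
    (fun ε z => F fun i => (z i).map (scaleSite ε)) F ?_ (fun _ => 0) 0 ?_
  · rintro τ r rfl G G' hG η x hx
    refine iSup_le fun n => (jumpOpUpTo_le_liminf_hc h hq hsc hG n r hx).trans ?_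
    exact liminf_le_liminf (Eventually.of_forall fun ε =>
      le_iSup (fun n => jumpOpUpTo (hcIntensity q (ξ 0) (ξv ε) (s ε)) n r (G ε) (η ε)) n)
  · intro z z' hz
    refine (Tendsto.liminf_eq ?_).ge
    refine (hF.tendsto z').comp (tendsto_pi_nhds.2 fun i => ?_)
    obtain ⟨φ, hη, hφ, -⟩ := hz i
    have := tendsto_map_conf (φ := fun ε w => scaleSite ε (φ ε w)) (ψ := id) (l := downToZero) (z' i)
      fun w hw => tendsto_subtype_rng.2 (hφ w hw).1
    rw [Multiset.map_id] at this
    refine this.congr' ?_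
    filter_upwards [hη] with ε hε
    rw [hε, Multiset.map_map]
    rfl
  · exact ⟨fun _ _ => 1, Eventually.of_forall fun _ => by simp, fun w hw => by simp at hw,
      fun w hw => by simp at hw⟩

/-- The mass of the limit comes from `X` itself, which lives on a probability space, so
non-explosion of the exponential model needs no separate proof. -/
theorem tendsto_fddExpectation_hc {Ω : Type*} [MeasurableSpace Ω] {μ : Measure Ω}
    {X : ℝ≥0 → Ω → Conf PosReal} (hX : IsExponentialModel q lam ξ B p X μ) {k : ℕ}
    {t : Fin k → ℝ≥0} (ht : Monotone t) (F : (Fin k → Conf PosReal) →ᵇ ℝ≥0) :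
    Tendsto (fun ε => fddExpectation (jumpTransition (hcIntensity q (ξ 0) (ξv ε) (s ε))) k 0 t
        (fun z => (F fun i => (z i).map (scaleSite ε) : ℝ≥0∞)) 0) downToZero
      (𝓝 (∫⁻ ω, (F (fun i => X (t i) ω) : ℝ≥0∞) ∂μ)) := by
  obtain ⟨M, G, hM⟩ := exists_compl_boundedContinuous F
  have hcont : ∀ H : (Fin k → Conf PosReal) →ᵇ ℝ≥0, Continuous fun z => (H z : ℝ≥0∞) := fun H =>
    ENNReal.continuous_coe.comp H.continuous
  have hlim : ∀ H : (Fin k → Conf PosReal) →ᵇ ℝ≥0, ∫⁻ ω, (H (fun i => X (t i) ω) : ℝ≥0∞) ∂μ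
      ≤ liminf (fun ε => fddExpectation (jumpTransition (hcIntensity q (ξ 0) (ξv ε) (s ε))) k 0 t
        (fun z => (H fun i => (z i).map (scaleSite ε) : ℝ≥0∞)) 0) downToZero := fun H => by
    rw [hX.fdd k t ht (fun _ => zero_le) H]
    exact fddExpectation_exp_le_liminf h hq hsc t (hcont H)
  refine tendsto_of_le_liminf_of_compl (M := M) ENNReal.coe_ne_top (hlim F) (hlim G) ?_ fun ε =>
    (fddExpectation_hc_add hq (h.speed_pos le_rfl) ((hsc ε).admissible h) t _ _ fun z => hM _).le
  have hmeas : Measurable fun ω => (F (fun i => X (t i) ω) : ℝ≥0∞) :=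
    (hcont F).measurable.comp (measurable_pi_lambda _ fun i => hX.measurable (t i))
  have := hX.isProbabilityMeasure
  rw [← lintegral_add_left hmeas]
  simp [hM]

end Data

end

/-! ### Assembly of the three limits -/

noncomputable section

/-- A function of rescaled lattice configurations. -/
def rescaledTest {k : ℕ} (ε : PosReal) (F : (Fin k → Conf PosReal) →ᵇ ℝ≥0) :
    (Fin k → Conf ℕ+) →ᵇ ℝ≥0 :=
  F.compContinuous ⟨fun z i => (z i).map (scaleSite ε), continuous_pi fun i =>
    (continuous_map_conf (scaleSite ε)).comp (continuous_apply i)⟩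

end

theorem proposition3p2 (q : ℝ) (hq : q ∈ Ioo (0 : ℝ) 1) :
    -- the limit `u ↘ 0` to the half-continuous vertex model
    (∀ (ξ₀ : ℝ) (ξv s : ℕ+ → ℝ), 0 < ξ₀ → AdmissibleVertexParameters ξv s →
      ∀ (Ωv : PosReal → Type*) [∀ u, MeasurableSpace (Ωv u)] (μv : ∀ u, Measure (Ωv u))
        (Xv : ∀ u, ℕ → Ωv u → Conf ℕ+)
        (Ωhc : Type*) [MeasurableSpace Ωhc] (μhc : Measure Ωhc) (Xhc : ℝ≥0 → Ωhc → Conf ℕ+),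
      (∀ u : PosReal, IsVertexModel q u ξ₀ ξv s (Xv u) (μv u)) →
      IsHalfContinuousModel q ξ₀ ξv s Xhc μhc →
      ConvergesFDD (fun (u : PosReal) (t : ℝ≥0) ω => Xv u ⌊(t : ℝ) * (u : ℝ)⁻¹⌋₊ ω) μv
        downToZero Xhc μhc) ∧
    -- the limit `ε ↘ 0` of the rescaled half-continuous model to the exponential jump model
    (∀ (lam : ℝ) (ξ : ℝ → ℝ) (B : Set ℝ) (p : ℝ → ℝ), IsExpModelData lam ξ B p →
      ∀ (ξv s : PosReal → ℕ+ → ℝ),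
      (∀ ε : PosReal, IsScaledParameters lam ξ B p ε (ξv ε) (s ε)) →
      ∀ (Ωhc : PosReal → Type*) [∀ ε, MeasurableSpace (Ωhc ε)] (μhc : ∀ ε, Measure (Ωhc ε))
        (Xhc : ∀ ε, ℝ≥0 → Ωhc ε → Conf ℕ+)
        (Ω : Type*) [MeasurableSpace Ω] (μ : Measure Ω) (X : ℝ≥0 → Ω → Conf PosReal),
      (∀ ε : PosReal, IsHalfContinuousModel q (ξ 0) (ξv ε) (s ε) (Xhc ε) (μhc ε)) →
      IsExponentialModel q lam ξ B p X μ →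
      ConvergesFDD (fun (ε : PosReal) (t : ℝ≥0) ω => (Xhc ε t ω).map (scaleSite ε)) μhc
        downToZero X μ) ∧
    -- both limits, one after the other
    (∀ (lam : ℝ) (ξ : ℝ → ℝ) (B : Set ℝ) (p : ℝ → ℝ), IsExpModelData lam ξ B p →
      ∀ (ξv s : PosReal → ℕ+ → ℝ),
      (∀ ε : PosReal, IsScaledParameters lam ξ B p ε (ξv ε) (s ε)) →
      ∀ (Ωv : PosReal → PosReal → Type*) [∀ ε u, MeasurableSpace (Ωv ε u)]
        (μv : ∀ ε u, Measure (Ωv ε u)) (Xv : ∀ ε u, ℕ → Ωv ε u → Conf ℕ+)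
        (Ω : Type*) [MeasurableSpace Ω] (μ : Measure Ω) (X : ℝ≥0 → Ω → Conf PosReal),
      (∀ ε u : PosReal, IsVertexModel q u (ξ 0) (ξv ε) (s ε) (Xv ε u) (μv ε u)) →
      IsExponentialModel q lam ξ B p X μ →
      ∀ (k : ℕ) (t : Fin k → ℝ≥0), Monotone t → ∀ f : (Fin k → Conf PosReal) →ᵇ ℝ≥0,
      ∃ g : PosReal → ℝ≥0∞,
        (∀ ε : PosReal, Tendsto
          (fun u : PosReal => ∫⁻ ω, (f (fun i =>
            (Xv ε u ⌊(t i : ℝ) * (u : ℝ)⁻¹⌋₊ ω).map (scaleSite ε)) : ℝ≥0∞) ∂(μv ε u))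
          downToZero (𝓝 (g ε))) ∧
        Tendsto g downToZero (𝓝 (∫⁻ ω, (f (fun i => X (t i) ω) : ℝ≥0∞) ∂μ))) := by
  refine ⟨?_, ?_, ?_⟩
  · intro ξ₀ ξv s hξ₀ hadm Ωv _ μv Xv Ωhc _ μhc Xhc hXv hXhc k t ht f
    rw [hXhc.fdd k t ht (fun _ => zero_le) f]
    exact tendsto_lintegral_vertex hq hξ₀ hadm hXv ht f
  · intro lam ξ B p h ξv s hsc Ωhc _ μhc Xhc Ω _ μ X hXhc hX k t ht f
    refine (tendsto_fddExpectation_hc h hq hsc hX ht f).congr fun ε => ?_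
    exact ((hXhc ε).fdd k t ht (fun _ => zero_le) (rescaledTest ε f)).symm
  · intro lam ξ B p h ξv s hsc Ωv _ μv Xv Ω _ μ X hXv hX k t ht f
    -- The inner limit `g ε` is the expectation given by the half-continuous transition operators,
    -- with the rescaling absorbed in the test function.
    exact ⟨_, fun ε => tendsto_lintegral_vertex hq (h.speed_pos le_rfl) ((hsc ε).admissible h)
      (hXv ε) ht (rescaledTest ε f), tendsto_fddExpectation_hc h hq hsc hX ht f⟩
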